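/- **Theorem 1.1.** For a partition, let its rank be its largest part minus its number of parts (rank $0$ for the empty partition), let $N(m,n)$ be the number of partitions of $n$ with rank $m$, and put $$\eta_2(n):=\sum_{m\in\mathbb Z}\binom m2 N(m,n),\qquad \binom m2=\frac{m(m-1)}2,\qquad R_2(q):=\sum_{n\ge 0}\eta_2(n)\,q^n\quad(|q|<1).$$ For $z=x+iy$ in the upper half-plane $\mathbb H$ let $\eta(z)=e^{\pi i z/12}\prod_{n\ge1}(1-e^{2\pi i nz})$, $E_2(z)=1-24\sum_{n\ge1}\sigma_1(n)e^{2\pi i nz}$ with $\sigma_1(n)=\sum_{d\mid n}d$, and $$\mathcal R(z):=R_2\!\left(e^{2\pi i\cdot 24z}\right)e^{-2\pi i z},\qquad \mathcal N(z):=-\frac{i}{4\sqrt2\,\pi}\int_{-\bar z}^{i\infty}\frac{\eta(24\tau)}{(-i(\tau+z))^{3/2}}\,d\tau,$$ $$\mathcal M(z):=\mathcal R(z)-\mathcal N(z)-\frac1{24\,\eta(24z)}+\frac{E_2(24z)}{8\,\eta(24z)} .$$ Then $\mathcal M$ is a harmonic weak Maass form of weight $\frac32$ on $\Gamma_0(576)$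 with Nebentypus $\chi_{12}=\left(\frac{12}{\cdot}\right)$. Here, for $k\in\frac12\mathbb Z\setminus\mathbb Z$, a subgroup $\Gamma\subseteq\Gamma_0(4)$ and a Dirichlet character $\chi$, a harmonic weak Maass form of weight $k$ with Nebentypus $\chi$ on $\Gamma$ is a smooth function $g:\mathbb H\to\mathbb C$ such that: 1. for all $A=\begin{pmatrix}a&b\\c&d\end{pmatrix}\in\Gamma$ and $z\in\mathbb H$, $\;g(Az)=\left(\frac cd\right)^{2k}\epsilon_d^{-2k}\chi(d)(cz+d)^k g(z)$, where $\left(\frac cd\right)$ is the Kronecker symbol, powers of $cz+d$ are taken with the principal branch, and $\epsilon_d=1$ if $d\equiv1\pmod 4$, $\epsilon_d=i$ if $d\equiv3\pmod 4$; 2. $\Delta_k g=0$, where $\Delta_k=-y^2\left(\frac{\partial^2}{\partial x^2}+\frac{\partial^2}{\partial y^2}\right)+iky\left(\frac{\partial}{\partial x}+i\frac{\partial}{\partial y}\right)$; 3. $g$ has at most linear exponential growth at all cusps of $\Gamma$: for every $B=\begin{pmatrix}a&b\\c&d\end{pmatrix}\in\mathrm{SL}_2(\mathbb Z)$ such that $B\infty$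 is a cusp of $\Gamma$ there is a constant $C$ with $(cz+d)^{-k}g(Bz)=O(e^{Cy})$ as $y\to\infty$, uniformly in $x$. -/

import Mathlib

open scoped MatrixGroups ContDiff

namespace RankMoment

noncomputable section

/-! ## Partition ranks and the symmetrized second rank moment -/

/-- Dyson's rank of a partition: its largest part minus its number of parts
(so the rank of the empty partition is `0`). -/
def rank {n : ℕ} (p : n.Partition) : ℤ :=
  (p.parts.sup : ℤ) - (Multiset.card p.parts : ℤ)

/-- `N(m, n)`: the number of partitions of `n` with rank `m`. -/
def rankCount (m : ℤ) (n : ℕ) : ℕ :=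
  Nat.card {p : n.Partition // rank p = m}

/-- `η₂(n) = ∑_{m ∈ ℤ} (m choose 2) N(m, n)`, with `(m choose 2) = m (m - 1) / 2` also for
negative `m`. Only finitely many terms are nonzero. -/
def secondMoment (n : ℕ) : ℤ :=
  ∑ᶠ m : ℤ, Ring.choose m 2 * (rankCount m n : ℤ)

/-- `R₂(q) = ∑_{n ≥ 0} η₂(n) qⁿ`, for `|q| < 1`. -/
def R2 (q : ℂ) : ℂ := ∑' n : ℕ, (secondMoment n : ℂ) * q ^ n

/-! ## The function `𝓜` -/

/-- `E₂(z) = 1 - 24 ∑_{n ≥ 1} σ₁(n) e^{2πinz}`. -/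
def E2 (z : ℂ) : ℂ :=
  1 - 24 * ∑' n : ℕ+, (ArithmeticFunction.sigma 1 (n : ℕ) : ℂ) *
    Complex.exp (2 * Real.pi * Complex.I * z) ^ (n : ℕ)

/-- `E2` agrees with Mathlib's normalized Eisenstein series of weight `2`. -/
theorem E2_coe (z : UpperHalfPlane) : E2 (z : ℂ) = EisensteinSeries.E2 z := by
  rw [EisensteinSeries.E2_eq_tsum_cexp]
  simp [E2]

/-- `𝓡(z) = R₂(q²⁴) q⁻¹` with `q = e^{2πiz}`. -/
def calR (z : UpperHalfPlane) : ℂ :=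
  R2 (Complex.exp (2 * Real.pi * Complex.I * (24 * (z : ℂ)))) *
    Complex.exp (-(2 * Real.pi * Complex.I * (z : ℂ)))

/-- The contour integral `∫_{a}^{i∞} f(τ) dτ`, taken along the vertical half-line
`τ = a + i t`, `t > 0`. -/
def verticalIntegral (f : ℂ → ℂ) (a : ℂ) : ℂ :=
  ∫ t in Set.Ioi (0 : ℝ), f (a + Complex.I * (t : ℂ)) * Complex.I

/-- `𝓝(z) = -i / (4 √2 π) ∫_{-z̄}^{i∞} η(24 τ) / (-i (τ + z))^{3/2} dτ`. -/
def calN (z : UpperHalfPlane) : ℂ :=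
  -Complex.I / (4 * (Real.sqrt 2 : ℂ) * (Real.pi : ℂ)) *
    verticalIntegral
      (fun τ => ModularForm.eta (24 * τ) /
        (-Complex.I * (τ + (z : ℂ))) ^ ((3 : ℂ) / 2))
      (-(starRingEnd ℂ (z : ℂ)))

/-- `𝓜(z) = 𝓡(z) - 𝓝(z) - 1 / (24 η(24 z)) + E₂(24 z) / (8 η(24 z))`. -/
def calM (z : UpperHalfPlane) : ℂ :=
  calR z - calN z - 1 / (24 * ModularForm.eta (24 * (z : ℂ))) +
    E2 (24 * (z : ℂ)) / (8 * ModularForm.eta (24 * (z : ℂ)))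

/-! ## Harmonic weak Maass forms of half-integral weight -/

/-- The extended Legendre symbol `(c/d)` for odd `d` (Shimura's convention, which is also the
Kronecker symbol): the Jacobi symbol `(c/|d|)`, with an additional minus sign if both `c` and `d`
are negative. In particular `(0/±1) = 1`. -/
def extSymbol (c d : ℤ) : ℤ :=
  if c < 0 ∧ d < 0 then -jacobiSym c d.natAbs else jacobiSym c d.natAbs

/-- `ε_v` for odd `v`: it is `1` if `v ≡ 1 (mod 4)` and `i` if `v ≡ 3 (mod 4)`. -/
def eps (v : ℤ) : ℂ := if v % 4 = 1 then 1 else Complex.I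

/-- `∂F/∂x` at `z = x + i y`. -/
def partialX (F : ℂ → ℂ) (z : ℂ) : ℂ := fderiv ℝ F z 1

/-- `∂F/∂y` at `z = x + i y`. -/
def partialY (F : ℂ → ℂ) (z : ℂ) : ℂ := fderiv ℝ F z Complex.I

/-- The weight `k` hyperbolic Laplacian
`Δ_k = -y² (∂²/∂x² + ∂²/∂y²) + i k y (∂/∂x + i ∂/∂y)`. -/
def hypLaplacian (k : ℂ) (F : ℂ → ℂ) (z : ℂ) : ℂ :=
  -(z.im : ℂ) ^ 2 * (partialX (partialX F) z + partialY (partialY F) z) +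
    Complex.I * k * (z.im : ℂ) * (partialX F z + Complex.I * partialY F z)

/-- `IsHarmonicWeakMaassForm twoK χ Γ g`: the function `g` on the upper half-plane is a harmonic
weak Maass form of weight `k = twoK / 2`, where `twoK` is an odd integer, with Nebentypus the
Dirichlet character `χ`, on the subgroup `Γ ⊆ Γ₀(4)`. Powers of `c z + d` use the principal branch.
To take derivatives, `g` is regarded as a function on the open subset `{Im z > 0}` of `ℂ`. -/
structure IsHarmonicWeakMaassForm (twoK : ℤ) {N : ℕ} (χ : DirichletCharacter ℂ N)
    (Γ : Subgroup SL(2, ℤ)) (g : UpperHalfPlane → ℂ) : Prop where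
  odd_twoK : Odd twoK
  le_Gamma0_four : Γ ≤ CongruenceSubgroup.Gamma0 4
  /-- `g` is a smooth (real `C^∞`) function. -/
  smooth : ContDiffOn ℝ ∞ (fun z : ℂ => g (UpperHalfPlane.ofComplex z)) {z : ℂ | 0 < z.im}
  /-- `g (A z) = (c/d)^{2k} ε_d^{-2k} χ(d) (c z + d)^k g(z)` for `A = (a b; c d)` in `Γ`. -/
  transform : ∀ A ∈ Γ, ∀ z : UpperHalfPlane,
    g (A • z) = (extSymbol (A 1 0) (A 1 1) : ℂ) ^ twoK * eps (A 1 1) ^ (-twoK) *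
      χ ((A 1 1 : ℤ) : ZMod N) *
      (((A 1 0 : ℤ) : ℂ) * (z : ℂ) + ((A 1 1 : ℤ) : ℂ)) ^ ((twoK : ℂ) / 2) * g z
  /-- `Δ_k g = 0`. -/
  harmonic : ∀ z : UpperHalfPlane,
    hypLaplacian ((twoK : ℂ) / 2) (fun w : ℂ => g (UpperHalfPlane.ofComplex w)) (z : ℂ) = 0
  /-- At most linear exponential growth at every cusp `B ∞`, `B = (a b; c d) ∈ SL₂(ℤ)`, of `Γ`:
  there is a constant `C` with `(c z + d)^{-k} g(B z) = O(e^{C y})` as `y = Im z → ∞`,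
  uniformly in `Re z`. -/
  growth : ∀ B : SL(2, ℤ),
    IsCusp (Matrix.SpecialLinearGroup.mapGL ℝ B • OnePoint.infty)
      (Γ.map (Matrix.SpecialLinearGroup.mapGL ℝ)) →
    ∃ C : ℝ,
      (fun z : UpperHalfPlane =>
        (((B 1 0 : ℤ) : ℂ) * (z : ℂ) + ((B 1 1 : ℤ) : ℂ)) ^ (-((twoK : ℂ) / 2)) * g (B • z))
      =O[UpperHalfPlane.atImInfty] (fun z : UpperHalfPlane => Real.exp (C * z.im))

/-- The Dirichlet character modulo `12` (with integer values) that is `1` at `±1`, `-1` at `±5`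
and `0` at the non-units. -/
def chi12Int : MulChar (ZMod 12) ℤ where
  toFun a :=
    match a with
    | 1 | 11 => 1
    | 5 | 7 => -1
    | 0 | 2 | 3 | 4 | 6 | 8 | 9 | 10 => 0
  map_one' := rfl
  map_mul' := by decide
  map_nonunit' := by decide

/-- The Dirichlet character `χ₁₂ = (12/·)`. -/
def chi12 : DirichletCharacter ℂ 12 := chi12Int.ringHomComp (Int.castRingHom ℂ)

/-- `χ₁₂(d)` is the extended symbol `(12/d)` for every odd `d`. -/
theorem chi12_eq_extSymbol (d : ℤ) (hd : Odd d) :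
    chi12 (d : ZMod 12) = (extSymbol 12 d : ℂ) := by
  have hneg : ∀ a : ZMod 12, chi12Int (-a) = chi12Int a := by decide
  have habs : chi12Int (d : ZMod 12) = chi12Int ((d.natAbs : ℕ) : ZMod 12) := by
    rcases Int.natAbs_eq d with h | h
    · conv_lhs => rw [h]
      simp
    · conv_lhs => rw [h]
      simp [hneg]
  have key : ∀ n : ℕ, Odd n → chi12Int (n : ZMod 12) = jacobiSym 12 n := by
    intro n hn
    have h1 : jacobiSym 12 n = jacobiSym 12 (n % 48) := by
      simpa using jacobiSym.mod_right 12 hn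
    have h2 : (n : ZMod 12) = ((n % 48 : ℕ) : ZMod 12) := by
      rw [ZMod.natCast_eq_natCast_iff]
      exact ((Nat.mod_modEq n 48).of_dvd (by norm_num)).symm
    have h3 : (n % 48) % 2 = 1 := by have := Nat.odd_iff.mp hn; omega
    have h4 : n % 48 < 48 := Nat.mod_lt _ (by norm_num)
    rw [h1, h2]
    generalize n % 48 = r at h3 h4
    interval_cases r <;> first
      | omega
      | (norm_num; done)
      | (norm_num; decide)
  have h12 : extSymbol 12 d = jacobiSym 12 d.natAbs := by simp [extSymbol]
  rw [h12, ← key _ (Int.natAbs_odd.mpr hd), ← habs]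
  rfl

end

end RankMoment

/-!
The completed function times `η(24 z)` turns out to be a nonholomorphic modular form of weight `2`
for the full modular group in the variable `τ = 24 z`; the theorem is then a matter of dividing
by `η`.

*The holomorphic part.* Dyson's map relates the partitions of large rank to those of very negative
rank (`card_rank_le_eq`). It gives a recursion which proves that the rank is symmetrically
distributed (`rankLe_eq_rankGe`), and its iteration gives
`∏ (1 - qⁿ) · R₂(q) = ∑_{j ≥ 1} (-1)^{j-1} ∑_{M ≥ 0} (2M + 1) q^{j(3j + 2M + 1)/2}`
(`eulerProd_mul_R2`).

*The nonholomorphic part.* On the path of integration the integrand times `η(τ)` is a product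
`η(τ) η(-τ̄ + 2i(Y - y))`. By the pentagonal number theorem it is a sum over `ℤ²`, and, after
averaging over symmetries of the lattice, Poisson summation in one variable makes it a signed
Gaussian sum over pairs `(c, d)`, depending on them through `c τ + d` and `c (τ - 2iY) + d`
(`eta_mul_eta`). Integration over `Y` can be carried out term by term (`calN_mul_eta_eq`): each pair
contributes a holomorphic term and a term of `Φ(τ) = ∑ ± (c τ + d)^{-2} e^{-(3π/2)|c τ + d|²/y}`, and
the pair `(0, 0)` contributes a multiple of `1/y`. By the Lipschitz formula the holomorphic terms
sum to the double series for `R₂` above (`tsum_holEisensteinTerm`). They cancel against `𝓡`, so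
that `𝓜(z) η(τ) = Φ(τ)/(4π²) + E₂(τ)/8 - 3/(8πy)` with `y = Im τ` (`calM_mul_eta`). Both `Φ` and
`E₂ - 3/(πy)` have weight `2` for `SL₂(ℤ)` (`weightTwoForm_smul`).

*Conclusion.* The transformation law follows from that of `η(24 z)` (`eta_transform_Gamma0`), which
is computed with the Euclidean algorithm and quadratic reciprocity (`etaMul_of_odd`). For the growth
at the cusp `B ∞`, `24 B z` is written as `γ w` with `γ ∈ SL₂(ℤ)` and `w` an affine function of `z`,
which reduces it to the growth of the weight `2` form and of `1/η` at `∞` (`calM_growth`). Finally,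
the period integral is a function of `(-z̄, 2 Im z)` which is holomorphic in two variables, whence
smoothness, and its `∂/∂z̄`-derivative is the boundary term `η(-24 z̄) (2 Im z)^{-3/2}` up to a
constant (`dbar_calM`), whence the Laplace equation (`hypLaplacian_calM`).
-/

namespace RankMoment
noncomputable section

/-! ### The multiplier of the Dedekind eta function -/

open Complex in
/-- The root of unity `e^{2πin/24}`. -/
def e24 (n : ℤ) : ℂ := exp (2 * Real.pi * I * n / 24)

lemma e24_add (m n : ℤ) : e24 (m + n) = e24 m * e24 n := by
  rw [e24, e24, e24, ← Complex.exp_add]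
  push_cast
  ring_nf

@[simp] lemma e24_zero : e24 0 = 1 := by simp [e24]

lemma e24_mul_24 (n : ℤ) : e24 (24 * n) = 1 := by
  rw [e24, Complex.exp_eq_one_iff]
  exact ⟨n, by push_cast; ring⟩

lemma e24_congr {m n : ℤ} (h : (24 : ℤ) ∣ m - n) : e24 m = e24 n := by
  obtain ⟨k, hk⟩ := h
  rw [show m = n + 24 * k by linarith, e24_add, e24_mul_24, mul_one]

lemma e24_twelve : e24 12 = -1 := by
  rw [e24, show (2 * Real.pi * Complex.I * ((12 : ℤ) : ℂ) / 24) = Real.pi * Complex.I by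
    push_cast; ring, Complex.exp_pi_mul_I]

lemma e24_six : e24 6 = Complex.I := by
  rw [e24, show (2 * Real.pi * Complex.I * ((6 : ℤ) : ℂ) / 24) = Real.pi / 2 * Complex.I by
    push_cast; ring, Complex.exp_pi_div_two_mul_I]

lemma eta_add_int (τ : ℂ) (k : ℤ) :
    ModularForm.eta (τ + k) = e24 k * ModularForm.eta τ := by
  have h : ∀ n : ℕ, ModularForm.eta_q n (τ + k) = ModularForm.eta_q n τ := by
    intro n
    rw [ModularForm.eta_q_eq_pow, ModularForm.eta_q_eq_pow]
    congr 1
    rw [Complex.exp_eq_exp_iff_exists_int]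
    exact ⟨k, by ring⟩
  simp only [ModularForm.eta, h]
  rw [← mul_assoc]
  congr 1
  rw [e24, Function.Periodic.qParam, Function.Periodic.qParam, ← Complex.exp_add]
  congr 1
  push_cast
  ring

lemma eta_neg_one_div {τ : ℂ} (hτ : 0 < τ.im) :
    ModularForm.eta (-1 / τ) = e24 (-3) * τ ^ (1 / 2 : ℂ) * ModularForm.eta τ := by
  have h := ModularForm.eta_comp_eq_csqrt_I_inv (x := τ) hτ
  simp only [Function.comp_apply, Pi.smul_apply, Pi.mul_apply, smul_eq_mul, Complex.sqrt] at h
  rw [h, ← mul_assoc, one_div]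
  congr 2
  rw [Complex.cpow_def_of_ne_zero Complex.I_ne_zero, Complex.log_I, e24, ← Complex.exp_neg]
  congr 1
  push_cast
  ring

/-- Both arguments lie in `(0, π)`, so that their sum minus `π` is the principal argument of `-x y`. -/
lemma sqrt_mul_sqrt {x y : ℂ} (hx : 0 < x.im) (hy : 0 < y.im) :
    x ^ (1 / 2 : ℂ) * y ^ (1 / 2 : ℂ) = Complex.I * (-(x * y)) ^ (1 / 2 : ℂ) := by
  have hx0 : x ≠ 0 := fun h => by rw [h] at hx; simp at hx
  have hy0 : y ≠ 0 := fun h => by simp [h] at hy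
  have hxa : 0 < x.arg ∧ x.arg < Real.pi :=
    ⟨(Complex.arg_nonneg_iff.2 hx.le).lt_of_ne fun h => by
      have := (Complex.arg_eq_zero_iff.1 h.symm).2; linarith,
     Complex.arg_lt_pi_iff.2 (Or.inr hx.ne')⟩
  have hya : 0 < y.arg ∧ y.arg < Real.pi :=
    ⟨(Complex.arg_nonneg_iff.2 hy.le).lt_of_ne fun h => by
      have := (Complex.arg_eq_zero_iff.1 h.symm).2; linarith,
     Complex.arg_lt_pi_iff.2 (Or.inr hy.ne')⟩
  have hlog : Complex.log (-(x * y)) = Complex.log x + Complex.log y - Real.pi * Complex.I := by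
    have h1 : Complex.exp (Complex.log x + Complex.log y - Real.pi * Complex.I) = -(x * y) := by
      rw [Complex.exp_sub, Complex.exp_add, Complex.exp_log hx0, Complex.exp_log hy0,
        Complex.exp_pi_mul_I]
      ring
    rw [← h1, Complex.log_exp]
    · simp [Complex.log_im]; linarith
    · simp [Complex.log_im]; linarith
  rw [Complex.cpow_def_of_ne_zero hx0, Complex.cpow_def_of_ne_zero hy0,
    Complex.cpow_def_of_ne_zero (neg_ne_zero.2 (mul_ne_zero hx0 hy0)), hlog]
  have hI : ∀ w, Complex.I * Complex.exp w = Complex.exp (Real.pi / 2 * Complex.I + w) := fun w => by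
    rw [Complex.exp_add, Complex.exp_pi_div_two_mul_I]
  rw [hI, ← Complex.exp_add]
  congr 1
  ring

lemma neg_sqrt_of_im_pos {p : ℂ} (hp : 0 < p.im) :
    Complex.I * (-p) ^ (1 / 2 : ℂ) = p ^ (1 / 2 : ℂ) := by
  have hp0 : p ≠ 0 := fun h => by simp [h] at hp
  have hlog : Complex.log (-p) = Complex.log p - Real.pi * Complex.I := by
    rw [Complex.log, Complex.log, Complex.arg_neg_eq_arg_sub_pi_of_im_pos hp, norm_neg]
    push_cast
    ring
  rw [Complex.cpow_def_of_ne_zero hp0, Complex.cpow_def_of_ne_zero (neg_ne_zero.2 hp0), hlog]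
  have hI : ∀ w, Complex.I * Complex.exp w = Complex.exp (Real.pi / 2 * Complex.I + w) := fun w => by
    rw [Complex.exp_add, Complex.exp_pi_div_two_mul_I]
  rw [hI]
  congr 1
  ring

/-- `EtaMul a b c d v` says that `v` is the multiplier of `η` at `(a b; c d)`. -/
def EtaMul (a b c d : ℤ) (v : ℂ) : Prop :=
  ∀ τ : ℂ, 0 < τ.im → ModularForm.eta ((a * τ + b) / (c * τ + d)) =
    v * (c * τ + d) ^ (1 / 2 : ℂ) * ModularForm.eta τ

lemma im_neg_one_div_pos {τ : ℂ} (hτ : 0 < τ.im) : 0 < (-1 / τ).im := by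
  rw [neg_div, one_div, Complex.neg_im, Complex.inv_im, neg_div, neg_neg]
  exact div_pos hτ (Complex.normSq_pos.2 fun h => by simp [h] at hτ)

lemma linear_ne_zero {c d : ℤ} (h : c ≠ 0 ∨ d ≠ 0) {τ : ℂ} (hτ : 0 < τ.im) :
    (c : ℂ) * τ + d ≠ 0 := by
  intro h0
  have him := congrArg Complex.im h0
  have hre := congrArg Complex.re h0
  simp at him hre
  rcases him with hc | hc
  · simp [hc] at hre h
    exact h hre
  · linarith

/-- Passing from `γ` to `γ T^k`. -/
lemma EtaMul.mul_T {a b c d : ℤ} {v : ℂ} (h : EtaMul a b c d v) (k : ℤ) :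
    EtaMul a (b + k * a) c (d + k * c) (v * e24 k) := by
  intro τ hτ
  have := h (τ + k) (by simpa using hτ)
  rw [eta_add_int, show (a : ℂ) * (τ + k) + b = a * τ + ((b + k * a : ℤ) : ℂ) by push_cast; ring,
    show (c : ℂ) * (τ + k) + d = c * τ + ((d + k * c : ℤ) : ℂ) by push_cast; ring] at this
  rw [this]
  ring

/-- Passing from `γ S` to `γ = (a b; c d)` when `d > 0`. -/
lemma EtaMul.of_mul_S {a b c d : ℤ} {v : ℂ} (hd : 0 < d) (h : EtaMul b (-a) d (-c) v) :
    EtaMul a b c d (v * e24 3) := by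
  intro τ hτ
  have hτ0 : τ ≠ 0 := fun h => by simp [h] at hτ
  have h1 := h (-1 / τ) (im_neg_one_div_pos hτ)
  have hx : 0 < ((d : ℂ) * (-1 / τ) + ((-c : ℤ) : ℂ)).im := by
    have := mul_pos (Int.cast_pos (R := ℝ).2 hd) (im_neg_one_div_pos hτ)
    simpa using this
  have e1 : ((b : ℂ) * (-1 / τ) + ((-a : ℤ) : ℂ)) / ((d : ℂ) * (-1 / τ) + ((-c : ℤ) : ℂ)) =
      (a * τ + b) / (c * τ + d) := by
    have hu : (c : ℂ) * τ + d ≠ 0 := linear_ne_zero (Or.inr hd.ne') hτ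
    have hx0 : (d : ℂ) * (-1 / τ) + ((-c : ℤ) : ℂ) ≠ 0 := fun h => by rw [h] at hx; simp at hx
    rw [div_eq_div_iff hx0 hu]
    push_cast
    field_simp
    ring
  have h2 := sqrt_mul_sqrt hx hτ
  rw [show -(((d : ℂ) * (-1 / τ) + ((-c : ℤ) : ℂ)) * τ) = c * τ + d by
    push_cast; field_simp; ring] at h2
  rw [e1, eta_neg_one_div hτ] at h1
  have h3 : e24 3 = e24 (-3) * Complex.I := by rw [← e24_six, ← e24_add]; norm_num
  rw [h1, h3]
  linear_combination (v * e24 (-3) * ModularForm.eta τ) * h2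

/-- Passing from `γ S⁻¹` to `γ = (a b; c d)` when `c > 0 > d`. -/
lemma EtaMul.of_mul_S_inv {a b c d : ℤ} {v : ℂ} (hc : 0 < c) (hd : d < 0)
    (h : EtaMul (-b) a (-d) c v) : EtaMul a b c d (v * e24 (-3)) := by
  intro τ hτ
  have hτ0 : τ ≠ 0 := fun h => by simp [h] at hτ
  have h1 := h (-1 / τ) (im_neg_one_div_pos hτ)
  have hx : 0 < (((-d : ℤ) : ℂ) * (-1 / τ) + c).im := by
    have := mul_pos (Int.cast_pos (R := ℝ).2 (neg_pos.2 hd)) (im_neg_one_div_pos hτ)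
    simpa using this
  have e1 : (((-b : ℤ) : ℂ) * (-1 / τ) + a) / (((-d : ℤ) : ℂ) * (-1 / τ) + c) =
      (a * τ + b) / (c * τ + d) := by
    have hu : (c : ℂ) * τ + d ≠ 0 := linear_ne_zero (Or.inr hd.ne) hτ
    have hx0 : ((-d : ℤ) : ℂ) * (-1 / τ) + c ≠ 0 := fun h => by rw [h] at hx; simp at hx
    rw [div_eq_div_iff hx0 hu]
    push_cast
    field_simp
    ring
  have h2 := sqrt_mul_sqrt hx hτ
  rw [show (((-d : ℤ) : ℂ) * (-1 / τ) + c) * τ = c * τ + d by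
    push_cast; field_simp; ring, neg_sqrt_of_im_pos (by simp; positivity)] at h2
  rw [e1, eta_neg_one_div hτ] at h1
  rw [h1]
  linear_combination (v * e24 (-3) * ModularForm.eta τ) * h2

/-- The exponent of `e^{2πi/24}` in the multiplier of `η` at `(a b; c d)` for odd `c > 0`; the
remaining factor is the Jacobi symbol `(d/c)`. -/
def etaExponent (a b c d : ℤ) : ℤ := (a + d) * c - b * d * (c ^ 2 - 1) - 3 * c

lemma dvd_cube_sub_self {c : ℤ} (hc : Odd c) : (24 : ℤ) ∣ (c ^ 2 - 1) * c := by
  obtain ⟨k, rfl⟩ := hc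
  have h2 : (8 : ℤ) ∣ ((2 * k + 1) ^ 2 - 1) * (2 * k + 1) := by
    obtain ⟨m, hm⟩ := (Int.even_mul_succ_self k)
    exact ⟨m * (2 * k + 1), by linear_combination 4 * (2 * k + 1) * hm⟩
  have h3 : (3 : ℤ) ∣ ((2 * k + 1) ^ 2 - 1) * (2 * k + 1) := by
    have : k % 3 = 0 ∨ k % 3 = 1 ∨ k % 3 = 2 := by omega
    apply Int.dvd_of_emod_eq_zero
    rcases this with h | h | h <;> simp [Int.mul_emod, Int.sub_emod, Int.add_emod, pow_two, h]
  omega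

/-- Quadratic reciprocity for the Jacobi symbol, with the sign as a 24th root of unity. -/
lemma jacobi_reciprocity {m n : ℕ} (hm : Odd m) (hn : Odd n) :
    (jacobiSym m n : ℂ) = jacobiSym (-n) m * e24 (3 * (m - 1) * (n + 1)) := by
  have h1 : m % 4 = 1 ∨ m % 4 = 3 := Nat.odd_mod_four_iff.1 (Nat.odd_iff.1 hm)
  have h2 : n % 4 = 1 ∨ n % 4 = 3 := Nat.odd_mod_four_iff.1 (Nat.odd_iff.1 hn)
  have hm2 : m % 2 ≠ 0 := by omega
  rw [jacobiSym.neg _ hm, ZMod.χ₄_nat_eq_if_mod_four, if_neg hm2]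
  rcases h1 with h1 | h1
  · have : (24 : ℤ) ∣ 3 * (m - 1) * (n + 1) - 0 := by
      obtain ⟨k, rfl⟩ := hn
      have : (4 : ℤ) ∣ (m : ℤ) - 1 := by omega
      obtain ⟨j, hj⟩ := this
      exact ⟨j * (k + 1), by push_cast; linear_combination 6 * (k + 1) * hj⟩
    rw [if_pos h1, e24_congr this, e24_zero, jacobiSym.quadratic_reciprocity_one_mod_four h1 hn]
    simp
  · have hm1 : m % 4 ≠ 1 := by omega
    obtain ⟨j, hj⟩ : (4 : ℤ) ∣ (m : ℤ) - 3 := by omega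
    rcases h2 with h2 | h2
    · obtain ⟨k, hk⟩ : (4 : ℤ) ∣ (n : ℤ) - 1 := by omega
      have : (24 : ℤ) ∣ 3 * (m - 1) * (n + 1) - 12 := by
        rw [show (m : ℤ) = 4 * j + 3 by linarith, show (n : ℤ) = 4 * k + 1 by linarith]
        exact ⟨2 * j * k + j + k, by ring⟩
      rw [if_neg hm1, e24_congr this, e24_twelve,
        jacobiSym.quadratic_reciprocity_one_mod_four h2 hm]
      simp
    · obtain ⟨k, hk⟩ : (4 : ℤ) ∣ (n : ℤ) - 3 := by omega
      have : (24 : ℤ) ∣ 3 * (m - 1) * (n + 1) - 0 := by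
        rw [show (m : ℤ) = 4 * j + 3 by linarith, show (n : ℤ) = 4 * k + 3 by linarith]
        exact ⟨(2 * j + 1) * (k + 1), by ring⟩
      rw [if_neg hm1, e24_congr this, e24_zero,
        jacobiSym.quadratic_reciprocity_three_mod_four h1 h2]
      simp

/-- The multiplier of `η` at `(a b; c d)` for odd `c > 0`. The proof is the Euclidean algorithm:
`d` is reduced modulo `c` to `±D` with `D < c` odd, then `S` or `S⁻¹` moves `D` to the lower left
corner, and quadratic reciprocity compares the Jacobi symbols. -/
lemma etaMul_of_odd (c : ℕ) : Odd c → ∀ a b d : ℤ, a * d - b * c = 1 →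
    EtaMul a b c d (jacobiSym d c * e24 (etaExponent a b c d)) := by
  induction c using Nat.strong_induction_on with
  | _ c ih =>
  intro hc
  have hcpos : 0 < c := hc.pos
  -- Translating `d` by a multiple of `c` is harmless.
  suffices H : ∀ d : ℤ, ∃ k : ℤ, ∀ a b : ℤ, a * (d - k * c) - b * c = 1 →
      EtaMul a b c (d - k * c) (jacobiSym d c * e24 (etaExponent a b c (d - k * c))) by
    intro a b d hdet
    obtain ⟨k, hk⟩ := H d
    have h1 := (hk a (b - k * a) (by linear_combination hdet)).mul_T k
    rw [show b - k * a + k * a = b by ring, show d - k * c + k * c = d by ring, mul_assoc,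
      ← e24_add] at h1
    convert h1 using 2
    apply e24_congr
    obtain ⟨j, hj⟩ := dvd_cube_sub_self (c := c) (by exact_mod_cast hc)
    refine ⟨-j * k * (2 * b - k * a), ?_⟩
    simp only [etaExponent]
    linear_combination -k * (c ^ 2 - 1) * hdet - k * (2 * b - k * a) * hj
  intro d
  -- For `c = 1` the reduced matrix is `T^a S`.
  rcases eq_or_ne c 1 with rfl | hc1
  · refine ⟨d, fun a b hab => ?_⟩
    have hb : b = -1 := by push_cast at hab; linarith
    intro τ hτ
    have hτ0 : τ ≠ 0 := fun h => by simp [h] at hτ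
    rw [show (a * τ + b) / (((1 : ℕ) : ℤ) * τ + ((d - d * ((1 : ℕ) : ℤ) : ℤ) : ℂ)) = -1 / τ + a by
      rw [hb]; push_cast; rw [show (1 : ℂ) * τ + (d - d * 1) = τ by ring]; field_simp; ring,
      eta_add_int, eta_neg_one_div hτ]
    simp only [etaExponent, jacobiSym.one_right]
    rw [show (a + (d - d * ((1 : ℕ) : ℤ))) * ((1 : ℕ) : ℤ) - b * (d - d * ((1 : ℕ) : ℤ)) *
      (((1 : ℕ) : ℤ) ^ 2 - 1) - 3 * ((1 : ℕ) : ℤ) = a + -3 by push_cast; ring, e24_add]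
    push_cast
    ring_nf
  by_cases hg : IsCoprime d (c : ℤ)
  swap
  · refine ⟨0, fun a b hab => (hg ⟨a, -b, ?_⟩).elim⟩
    linarith
  have hr0 : 0 ≤ d % c := Int.emod_nonneg _ (by positivity)
  have hr1 : d % c < c := Int.emod_lt_of_pos _ (by positivity)
  have hr2 : d % c ≠ 0 := by
    intro h
    have h1 : (c : ℤ) ∣ d := Int.dvd_of_emod_eq_zero h
    have h2 := hg.isUnit_of_dvd' h1 dvd_rfl
    rw [Int.isUnit_iff] at h2
    omega
  have hrd : d % c = d - d / c * c := by rw [Int.emod_def]; ring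
  rcases Int.even_or_odd (d % c) with hpar | hpar
  -- An even remainder is replaced by its difference with `c`, which is odd: `d ↦ -D`.
  · refine ⟨d / c + 1, fun a b hab => ?_⟩
    obtain ⟨D, hD⟩ : ∃ D : ℕ, (D : ℤ) = c - d % c := ⟨(c - d % c).toNat, by omega⟩
    have hd0 : d - (d / c + 1) * c = -(D : ℤ) := by rw [hD, hrd]; ring
    have hDodd : Odd D := by
      have : Odd (D : ℤ) := by
        rw [hD]; exact Odd.sub_even (by exact_mod_cast hc) hpar
      exact_mod_cast this
    have hDc : D < c := by omega
    rw [hd0] at hab ⊢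
    have h1 := ih D hDc hDodd (-b) a c (by linear_combination hab)
    have h2 := EtaMul.of_mul_S_inv (a := a) (b := b) (c := c) (d := -(D : ℤ))
      (by exact_mod_cast hcpos) (by have := hDodd.pos; omega) (by simpa using h1)
    convert h2 using 1
    have h3 : jacobiSym d c = jacobiSym (-D) c := by
      apply jacobiSym.mod_left'
      rw [← hd0]
      simp [Int.sub_mul_emod_self_right]
    rw [h3, jacobi_reciprocity hc hDodd, mul_assoc (_ : ℂ), mul_assoc (_ : ℂ), ← e24_add,
      ← e24_add]
    congr 1
    apply e24_congr
    obtain ⟨i, rfl⟩ := hc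
    obtain ⟨j, rfl⟩ := hDodd
    refine ⟨-i * (j + 1), ?_⟩
    simp only [etaExponent]
    push_cast at hab ⊢
    linear_combination -(2 * i + 1) * (2 * j + 1) * hab
  · refine ⟨d / c, fun a b hab => ?_⟩
    obtain ⟨D, hD⟩ : ∃ D : ℕ, (D : ℤ) = d % c := ⟨(d % c).toNat, by omega⟩
    have hDodd : Odd D := by
      have : Odd (D : ℤ) := by rw [hD]; exact hpar
      exact_mod_cast this
    have hDc : D < c := by omega
    rw [← hrd, ← hD] at hab ⊢
    have h1 := ih D hDc hDodd b (-a) (-c) (by linear_combination hab)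
    have h2 := h1.of_mul_S (by exact_mod_cast hDodd.pos)
    convert h2 using 1
    have h3 : jacobiSym d c = jacobiSym D c := by
      apply jacobiSym.mod_left'
      rw [hD, Int.emod_emod_of_dvd _ dvd_rfl]
    rw [h3, jacobi_reciprocity hDodd hc, mul_assoc (_ : ℂ), mul_assoc (_ : ℂ), ← e24_add,
      ← e24_add]
    congr 1
    apply e24_congr
    obtain ⟨i, rfl⟩ := hc
    obtain ⟨j, rfl⟩ := hDodd
    refine ⟨j * (i + 1), ?_⟩
    simp only [etaExponent]
    push_cast at hab ⊢
    linear_combination (2 * i + 1) * (2 * j + 1) * hab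

/-- The multiplier of `η` at `(a b; c d)` with `24 ∣ b`, `24 ∣ c`, `d > 0`. -/
lemma etaMul_of_pos {a b c : ℤ} {d : ℕ} (hd : Odd d) (hdet : a * d - b * c = 1)
    (hb : (24 : ℤ) ∣ b) (hc : (24 : ℤ) ∣ c) :
    EtaMul a b c d (jacobiSym (-c) d * e24 (3 - 3 * d)) := by
  have h := (etaMul_of_odd d hd b (-a) (-c) (by linear_combination hdet)).of_mul_S
    (by exact_mod_cast hd.pos)
  rw [mul_assoc, ← e24_add] at h
  convert h using 2
  apply e24_congr
  obtain ⟨b, rfl⟩ := hb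
  obtain ⟨c, rfl⟩ := hc
  refine ⟨-(b - c) * d + a * c * (d ^ 2 - 1), ?_⟩
  simp only [etaExponent]
  ring

/-- The multiplier for positive `d` in terms of `χ₁₂` and `ε_d`. -/
lemma jacobi_mul_e24 {c : ℤ} {d : ℕ} (hd : Odd d) (hcop : IsCoprime (24 * c) (d : ℤ)) :
    (jacobiSym (-c) d * e24 (3 - 3 * d) : ℂ) =
      jacobiSym (24 * c) d * (eps d)⁻¹ * chi12 ((d : ℤ) : ZMod 12) := by
  have h24 : jacobiSym (24 * c) d * jacobiSym 12 d = jacobiSym 2 d * jacobiSym c d := by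
    rw [← jacobiSym.mul_left, ← jacobiSym.mul_left, show 24 * c * 12 = 12 ^ 2 * (2 * c) by ring,
      jacobiSym.mul_left, jacobiSym.sq_one', one_mul]
    exact Int.isCoprime_iff_gcd_eq_one.1 (IsCoprime.of_mul_left_left
      (y := 2 * c) (by convert hcop using 1; ring))
  have hχ : chi12 ((d : ℤ) : ZMod 12) = jacobiSym 12 d := by
    rw [chi12_eq_extSymbol _ (by exact_mod_cast hd)]
    simp [extSymbol]
  have h24' := congrArg (Int.cast (R := ℂ)) h24
  push_cast at h24'
  rw [hχ]
  have key : (ZMod.χ₄ d : ℂ) * e24 (3 - 3 * d) = jacobiSym 2 d * (eps d)⁻¹ := by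
    rw [jacobiSym.at_two hd, ZMod.χ₄_nat_eq_if_mod_four, ZMod.χ₈_nat_eq_if_mod_eight,
      if_neg (show ¬ d % 2 = 0 by have := Nat.odd_iff.1 hd; omega),
      if_neg (show ¬ d % 2 = 0 by have := Nat.odd_iff.1 hd; omega)]
    have hi : (eps d)⁻¹ = if d % 4 = 1 then 1 else -Complex.I := by
      have : ((d : ℤ) % 4 = 1) ↔ d % 4 = 1 := by omega
      simp only [eps, this]
      split_ifs <;> simp
    rw [hi]
    have h8 : d % 8 = 1 ∨ d % 8 = 3 ∨ d % 8 = 5 ∨ d % 8 = 7 := by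
      have := Nat.odd_iff.1 hd; omega
    rcases h8 with h | h | h | h
    · rw [e24_congr (n := 0) (by omega), if_pos (by omega), if_pos (by omega), if_pos (by omega)]
      simp
    · rw [e24_congr (n := 12 + 6) (by omega), if_neg (by omega), if_neg (by omega),
        if_neg (by omega), e24_add, e24_six, e24_twelve]
      simp
    · rw [e24_congr (n := 12) (by omega), if_pos (by omega), if_neg (by omega),
        if_pos (by omega), e24_twelve]
      simp
    · rw [e24_congr (n := 6) (by omega), if_neg (by omega), if_pos (by omega),
        if_neg (by omega), e24_six]
      simp
  rw [jacobiSym.neg _ hd]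
  push_cast
  linear_combination (jacobiSym c d : ℂ) * key - (eps d)⁻¹ * h24'

lemma neg_sqrt_of_im_neg {p : ℂ} (hp : p.im < 0) :
    (-p) ^ (1 / 2 : ℂ) = Complex.I * p ^ (1 / 2 : ℂ) := by
  have := neg_sqrt_of_im_pos (p := -p) (by simpa using hp)
  rw [neg_neg] at this
  exact this.symm

lemma neg_sqrt_of_neg {x : ℝ} (hx : x < 0) :
    Complex.I * (-(x : ℂ)) ^ (1 / 2 : ℂ) = (x : ℂ) ^ (1 / 2 : ℂ) := by
  have hx0 : (x : ℂ) ≠ 0 := by exact_mod_cast hx.ne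
  have hlog : Complex.log x = Complex.log (-(x : ℂ)) + Real.pi * Complex.I := by
    rw [Complex.log, Complex.log, norm_neg, Complex.arg_ofReal_of_neg hx, ← Complex.ofReal_neg,
      Complex.arg_ofReal_of_nonneg (by linarith)]
    push_cast
    ring
  rw [Complex.cpow_def_of_ne_zero hx0, Complex.cpow_def_of_ne_zero (neg_ne_zero.2 hx0), hlog]
  have hI : ∀ w, Complex.I * Complex.exp w = Complex.exp (Real.pi / 2 * Complex.I + w) := fun w => by
    rw [Complex.exp_add, Complex.exp_pi_div_two_mul_I]
  rw [hI]
  congr 1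
  ring

lemma chi4_mul_eps_inv {D : ℕ} (hD : Odd D) :
    (ZMod.χ₄ D : ℂ) * (eps D)⁻¹ * (-Complex.I) = (eps (-D))⁻¹ := by
  rw [ZMod.χ₄_nat_eq_if_mod_four, if_neg (show ¬ D % 2 = 0 by have := Nat.odd_iff.1 hD; omega)]
  have h4 : D % 4 = 1 ∨ D % 4 = 3 := Nat.odd_mod_four_iff.1 (Nat.odd_iff.1 hD)
  rcases h4 with h | h
  · rw [if_pos h, eps, eps, if_pos (by omega), if_neg (by omega)]
    simp
  · rw [if_neg (by omega), eps, eps, if_neg (by omega), if_pos (by omega)]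
    simp

/-- `η(24 z)` is a modular form of weight `1/2` and Nebentypus `χ₁₂` on `Γ₀(576)`. -/
theorem eta_transform_Gamma0 {a b c d : ℤ} (hdet : a * d - b * c = 1) (hc : (576 : ℤ) ∣ c)
    {z : ℂ} (hz : 0 < z.im) :
    ModularForm.eta (24 * ((a * z + b) / (c * z + d))) =
      extSymbol c d * (eps d)⁻¹ * chi12 (d : ZMod 12) * (c * z + d) ^ (1 / 2 : ℂ) *
        ModularForm.eta (24 * z) := by
  obtain ⟨c, rfl⟩ := hc
  have hcop : IsCoprime (576 * c) d := ⟨-b, a, by linear_combination hdet⟩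
  have hdodd : Odd d := by
    rcases Int.even_or_odd d with h | h
    · obtain ⟨k, rfl⟩ := h
      have h1 : (2 : ℤ) ∣ 1 := ⟨a * k - b * 288 * c, by linear_combination -hdet⟩
      omega
    · exact h
  have hdn : Odd d.natAbs := Int.natAbs_odd.2 hdodd
  have hz24 : 0 < (24 * z).im := by simpa using hz
  have hcop' : IsCoprime (24 * (24 * c)) (d.natAbs : ℤ) := by
    rw [show 24 * (24 * c) = 576 * c by ring]
    rcases Int.natAbs_eq d with h | h
    · rwa [← h]
    · rw [show (d.natAbs : ℤ) = -d by omega]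
      exact hcop.neg_right
  -- For `d < 0` the formula for positive lower right entry is applied to `-(a b; c d)`.
  rcases lt_trichotomy d 0 with hd | rfl | hd
  · obtain ⟨D, hD⟩ : ∃ D : ℕ, d = -(D : ℤ) := ⟨d.natAbs, by omega⟩
    have hDn : d.natAbs = D := by omega
    rw [hDn] at hdn hcop'
    have hu : ((576 * c : ℤ) : ℂ) * z + d ≠ 0 := linear_ne_zero (Or.inr hd.ne) hz
    have h := etaMul_of_pos (a := -a) (b := -(24 * b)) (c := -(24 * c)) hdn
      (by rw [hD] at hdet; linear_combination hdet) ⟨-b, by ring⟩ ⟨-c, by ring⟩ (24 * z) hz24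
    rw [jacobi_mul_e24 hdn (by simpa using hcop'.neg_left)] at h
    have e1 : (((-a : ℤ) : ℂ) * (24 * z) + ((-(24 * b) : ℤ) : ℂ)) /
        (((-(24 * c) : ℤ) : ℂ) * (24 * z) + (D : ℤ)) =
        24 * ((a * z + b) / (((576 * c : ℤ) : ℂ) * z + d)) := by
      rw [hD] at hu ⊢
      rw [← mul_div_assoc, ← neg_div_neg_eq]
      push_cast
      congr 1 <;> ring
    have e2 : (((-(24 * c) : ℤ) : ℂ) * (24 * z) + (D : ℤ)) = -(((576 * c : ℤ) : ℂ) * z + d) := by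
      rw [hD]; push_cast; ring
    have hchi : chi12 ((d : ℤ) : ZMod 12) = chi12 ((D : ℤ) : ZMod 12) := by
      rw [chi12_eq_extSymbol _ hdodd, chi12_eq_extSymbol _ (by exact_mod_cast hdn), extSymbol,
        extSymbol, hDn]
      simp
    have e3 : (jacobiSym (24 * -(24 * c)) D : ℂ) =
        ZMod.χ₄ D * jacobiSym (576 * c) D := by
      rw [show 24 * -(24 * c) = -(576 * c) by ring, jacobiSym.neg _ hdn]
      push_cast
      ring
    rw [e1] at h
    rw [h, e2, e3, hchi, extSymbol, hDn]
    have h4 := chi4_mul_eps_inv hdn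
    rw [← hD] at h4
    rw [← h4]
    by_cases hcneg : c < 0
    · rw [if_pos ⟨by omega, hd⟩, neg_sqrt_of_im_neg (by
        have : (c : ℝ) < 0 := by exact_mod_cast hcneg
        simp
        nlinarith)]
      push_cast
      ring
    · rw [if_neg (by omega)]
      have : (((576 * c : ℤ) : ℂ) * z + d) ^ (1 / 2 : ℂ) =
          Complex.I * (-(((576 * c : ℤ) : ℂ) * z + d)) ^ (1 / 2 : ℂ) := by
        rcases eq_or_lt_of_le (not_lt.1 hcneg) with h0 | h0
        · have := neg_sqrt_of_neg (x := d) (by exact_mod_cast hd)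
          rw [← h0]
          simpa using this.symm
        · refine (neg_sqrt_of_im_pos ?_).symm
          have : (0 : ℝ) < c := by exact_mod_cast h0
          simp
          positivity
      rw [this]
      linear_combination ((ZMod.χ₄ D * jacobiSym (576 * c) D * (eps D)⁻¹ *
        chi12 ((D : ℤ) : ZMod 12) * (-(((576 * c : ℤ) : ℂ) * z + d)) ^ (1 / 2 : ℂ) *
        ModularForm.eta (24 * z)) : ℂ) * Complex.I_sq
  · simp at hdodd
  · obtain ⟨D, hD⟩ : ∃ D : ℕ, d = D := ⟨d.natAbs, by omega⟩
    have hDn : d.natAbs = D := by omega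
    rw [hDn] at hdn hcop'
    have h := etaMul_of_pos (a := a) (b := 24 * b) (c := 24 * c) hdn
      (by rw [hD] at hdet; linear_combination hdet) ⟨b, by ring⟩ ⟨c, by ring⟩ (24 * z) hz24
    rw [jacobi_mul_e24 hdn hcop'] at h
    rw [extSymbol, if_neg (by omega), hDn, hD,
      show (24 : ℂ) * ((a * z + b) / (((576 * c : ℤ) : ℂ) * z + (D : ℤ))) =
        (((a : ℤ) : ℂ) * (24 * z) + ((24 * b : ℤ) : ℂ)) /
        (((24 * c : ℤ) : ℂ) * (24 * z) + (D : ℤ)) by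
        rw [← mul_div_assoc]; push_cast; congr 1 <;> ring, h,
      show ((576 * c : ℤ) : ℂ) * z + (D : ℤ) = ((24 * c : ℤ) : ℂ) * (24 * z) + (D : ℤ) by
        push_cast; ring, show (24 * (24 * c) : ℤ) = 576 * c by ring]

end
end RankMoment

namespace RankMoment
noncomputable section

/-! ### Dyson's map and the symmetry of the rank -/

/-- Pairs `(ν, ℓ)` of a multiset `ν` of at most `ℓ` positive integers, all at most `ℓ + r`, with
`ν.sum + ℓ = n`. Removing the first column of a partition of `n` with `ℓ` parts leaves such a pair,
and so does removing the largest part `ℓ + r` of a partition of `n + r`. -/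
def DysonPair (r : ℤ) (n : ℕ) : Type :=
  {x : Multiset ℕ × ℕ // (0 ∉ x.1) ∧ Multiset.card x.1 ≤ x.2 ∧ (x.1.sup : ℤ) ≤ x.2 + r ∧
    x.1.sum + x.2 = n}

/-- Remove the first column. -/
def removeColumn (s : Multiset ℕ) : Multiset ℕ := (s.map Nat.pred).filter (· ≠ 0)

/-- Add a column of length `ℓ`. -/
def addColumn (s : Multiset ℕ) (ℓ : ℕ) : Multiset ℕ :=
  s.map Nat.succ + Multiset.replicate (ℓ - Multiset.card s) 1

lemma card_removeColumn_le (s : Multiset ℕ) :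
    Multiset.card (removeColumn s) ≤ Multiset.card s := by
  simpa [removeColumn] using Multiset.card_le_card (Multiset.filter_le (· ≠ 0) (s.map Nat.pred))

lemma zero_notMem_removeColumn (s : Multiset ℕ) : 0 ∉ removeColumn s := by
  simp [removeColumn]

lemma removeColumn_cons (a : ℕ) (s : Multiset ℕ) :
    removeColumn (a ::ₘ s) = if a ≤ 1 then removeColumn s else (a - 1) ::ₘ removeColumn s := by
  rw [removeColumn, Multiset.map_cons]
  split_ifs with h
  · rw [Multiset.filter_cons_of_neg _ (by simp; omega)]; rfl
  · rw [Multiset.filter_cons_of_pos _ (by simp; omega)]; rfl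

lemma addColumn_removeColumn {s : Multiset ℕ} (hs : 0 ∉ s) :
    addColumn (removeColumn s) (Multiset.card s) = s := by
  induction s using Multiset.induction_on with
  | empty => simp [addColumn, removeColumn]
  | cons a s ih =>
    have ih := ih (fun h => hs (Multiset.mem_cons_of_mem h))
    have ha : a ≠ 0 := fun h => hs (by simp [h])
    have hle := card_removeColumn_le s
    rw [removeColumn_cons]
    split_ifs with h
    · have ha1 : a = 1 := by omega
      subst ha1
      nth_rw 3 [← ih]
      rw [addColumn, addColumn, Multiset.card_cons, Nat.succ_sub hle, Multiset.replicate_succ]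
      simp
    · nth_rw 3 [← ih]
      rw [addColumn, addColumn, Multiset.card_cons, Multiset.card_cons, Nat.succ_sub_succ,
        Multiset.map_cons, Multiset.cons_add, show (a - 1).succ = a by omega]

lemma removeColumn_addColumn {s : Multiset ℕ} (hs : 0 ∉ s) (ℓ : ℕ) :
    removeColumn (addColumn s ℓ) = s := by
  rw [removeColumn, addColumn, Multiset.map_add, Multiset.filter_add, Multiset.map_map]
  have h1 : (Multiset.map (Nat.pred ∘ Nat.succ) s) = s := by simp
  have h2 : s.filter (· ≠ 0) = s :=
    Multiset.filter_eq_self.2 fun a ha h => hs (by rwa [h] at ha)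
  rw [h1, h2]
  simp [Multiset.filter_eq_nil, Multiset.mem_replicate]

lemma card_addColumn {s : Multiset ℕ} {ℓ : ℕ} (h : Multiset.card s ≤ ℓ) :
    Multiset.card (addColumn s ℓ) = ℓ := by
  simp [addColumn]; omega

lemma sum_addColumn {s : Multiset ℕ} {ℓ : ℕ} (h : Multiset.card s ≤ ℓ) :
    (addColumn s ℓ).sum = s.sum + ℓ := by
  have : (s.map Nat.succ).sum = s.sum + Multiset.card s := by
    induction s using Multiset.induction_on with
    | empty => simp
    | cons a s ih =>
      have := ih (by simp at h; omega)
      simp only [Multiset.map_cons, Multiset.sum_cons, Multiset.card_cons, this]; omega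
  simp only [addColumn, Multiset.sum_add, this, Multiset.sum_replicate, smul_eq_mul, mul_one]
  omega

lemma sup_mem {s : Multiset ℕ} (hs : s ≠ 0) : s.sup ∈ s := by
  induction s using Multiset.induction_on with
  | empty => exact (hs rfl).elim
  | cons b t ih =>
    rw [Multiset.sup_cons]
    rcases eq_or_ne t 0 with rfl | ht
    · simp
    · rcases le_total b t.sup with h | h
      · rw [sup_eq_right.2 h]; exact Multiset.mem_cons_of_mem (ih ht)
      · rw [sup_eq_left.2 h]; exact Multiset.mem_cons_self _ _

lemma sup_addColumn {s : Multiset ℕ} {ℓ : ℕ} (h : Multiset.card s ≤ ℓ) (hℓ : 0 < ℓ) :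
    (addColumn s ℓ).sup = s.sup + 1 := by
  apply le_antisymm
  · rw [Multiset.sup_le]
    intro b hb
    rw [addColumn, Multiset.mem_add] at hb
    rcases hb with hb | hb
    · obtain ⟨a, ha, rfl⟩ := Multiset.mem_map.1 hb
      exact Nat.succ_le_succ (Multiset.le_sup ha)
    · rw [Multiset.eq_of_mem_replicate hb]; omega
  · rcases s.empty_or_exists_mem with rfl | ⟨a, ha⟩
    · refine Multiset.le_sup ?_
      simp [addColumn, Multiset.mem_replicate]
      omega
    · have hmem : s.sup ∈ s := sup_mem fun h0 => by simp [h0] at ha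
      refine Multiset.le_sup (s := addColumn s ℓ) ?_
      rw [addColumn, Multiset.mem_add]
      exact Or.inl (Multiset.mem_map_of_mem _ hmem)

lemma zero_notMem_parts {n : ℕ} (p : n.Partition) : 0 ∉ p.parts :=
  fun h => (p.parts_pos h).ne' rfl

/-- Partitions of `n` of rank at most `r + 1` correspond to Dyson pairs, by removing the first
column. For `|r| ≤ 1` the empty partition, of rank `0`, can be an exception. -/
def rankLeEquiv {r : ℤ} (hr : 2 ≤ r ∨ r ≤ -2) (n : ℕ) :
    {p : n.Partition // rank p ≤ r + 1} ≃ DysonPair r n where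
  toFun p := ⟨(removeColumn p.1.parts, Multiset.card p.1.parts),
    zero_notMem_removeColumn _, card_removeColumn_le _, by
      have h := p.2
      rw [rank] at h
      have hp := zero_notMem_parts p.1
      rcases Nat.eq_zero_or_pos (Multiset.card p.1.parts) with h0 | h0
      · rw [Multiset.card_eq_zero] at h0
        simp only [h0] at h ⊢
        simp [removeColumn] at h ⊢
        omega
      · have := sup_addColumn (card_removeColumn_le p.1.parts) h0
        rw [addColumn_removeColumn hp] at this
        simp only
        omega, by
      have h := sum_addColumn (card_removeColumn_le p.1.parts)
      rw [addColumn_removeColumn (zero_notMem_parts p.1), p.1.parts_sum] at h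
      exact h.symm⟩
  invFun x := ⟨⟨addColumn x.1.1 x.1.2, by
      intro i hi
      rw [addColumn, Multiset.mem_add] at hi
      rcases hi with hi | hi
      · obtain ⟨a, ha, rfl⟩ := Multiset.mem_map.1 hi
        omega
      · rw [Multiset.eq_of_mem_replicate hi]; omega, by
      rw [sum_addColumn x.2.2.1]; exact x.2.2.2.2⟩, by
      obtain ⟨⟨s, ℓ⟩, h0, h1, h2, h3⟩ := x
      simp only [rank] at h1 h2 ⊢
      rw [card_addColumn h1]
      rcases Nat.eq_zero_or_pos ℓ with rfl | hℓ
      · have hs : s = 0 := by simpa using h1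
        subst hs
        simp [addColumn] at h2 ⊢
        omega
      · rw [sup_addColumn h1 hℓ]
        push_cast
        omega⟩
  left_inv p := by
    apply Subtype.ext
    apply Nat.Partition.ext
    exact addColumn_removeColumn (zero_notMem_parts p.1)
  right_inv x := by
    obtain ⟨⟨s, ℓ⟩, h0, h1, h2, h3⟩ := x
    apply Subtype.ext
    simp only
    rw [removeColumn_addColumn h0, card_addColumn h1]

/-- Add a part `k`, unless `k = 0`. -/
def addPart (s : Multiset ℕ) (k : ℕ) : Multiset ℕ := if k = 0 then s else k ::ₘ s

lemma sup_addPart {s : Multiset ℕ} {k : ℕ} (h : s.sup ≤ k) : (addPart s k).sup = k := by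
  rw [addPart]
  split_ifs with hk
  · omega
  · simpa using h

lemma eq_zero_of_sup_eq_zero {s : Multiset ℕ} (h0 : 0 ∉ s) (h : s.sup = 0) : s = 0 := by
  by_contra hs
  exact h0 (h ▸ sup_mem hs)

/-- Partitions of `n + r` of rank at least `r - 1` correspond to Dyson pairs, by removing the
largest part. -/
def rankGeEquiv {r : ℤ} (hr : 2 ≤ r ∨ r ≤ -2) {n m : ℕ} (hm : (m : ℤ) = n + r) :
    {p : m.Partition // r - 1 ≤ rank p} ≃ DysonPair r n where
  toFun p := ⟨(p.1.parts.erase p.1.parts.sup, (p.1.parts.sup - r).toNat), by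
      obtain ⟨p, hp⟩ := p
      rw [rank] at hp
      have h0 := zero_notMem_parts p
      rcases eq_or_ne p.parts 0 with h | h
      · have hm0 : m = 0 := by rw [← p.parts_sum, h]; rfl
        simp [h] at hp ⊢
        omega
      · have hmem := sup_mem h
        have hcard := Multiset.card_erase_add_one hmem
        have hsum := Multiset.sum_erase hmem
        have hs := p.parts_sum
        refine ⟨fun h => h0 (Multiset.mem_of_mem_erase h), ?_, ?_, ?_⟩
        · simp only; omega
        · have : (p.parts.erase p.parts.sup).sup ≤ p.parts.sup :=
            Multiset.sup_mono (Multiset.erase_subset _ _)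
          simp only; omega
        · simp only; omega⟩
  invFun x := ⟨⟨addPart x.1.1 (x.1.2 + r).toNat, by
      obtain ⟨⟨s, ℓ⟩, h0, h1, h2, h3⟩ := x
      intro i hi
      rw [addPart] at hi
      simp only at hi h0
      split_ifs at hi with hk
      · exact Nat.pos_of_ne_zero fun h => h0 (h ▸ hi)
      · rcases Multiset.mem_cons.1 hi with hi | hi
        · omega
        · exact Nat.pos_of_ne_zero fun h => h0 (h ▸ hi), by
      obtain ⟨⟨s, ℓ⟩, h0, h1, h2, h3⟩ := x
      simp only [addPart] at h1 h2 h3 ⊢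
      split_ifs with hk
      · omega
      · rw [Multiset.sum_cons]; omega⟩, by
      obtain ⟨⟨s, ℓ⟩, h0, h1, h2, h3⟩ := x
      simp only [rank] at h0 h1 h2 h3 ⊢
      rw [sup_addPart (by omega), addPart]
      split_ifs with hk
      · have hs : s = 0 := eq_zero_of_sup_eq_zero h0 (by omega)
        simp [hs]
        omega
      · rw [Multiset.card_cons]; push_cast; omega⟩
  left_inv p := by
    obtain ⟨p, hp⟩ := p
    apply Subtype.ext
    apply Nat.Partition.ext
    rw [rank] at hp
    have h0 := zero_notMem_parts p
    simp only
    rcases eq_or_ne p.parts 0 with h | h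
    · simp only [h] at hp ⊢
      simp at hp ⊢
      rw [addPart, if_pos (by omega)]
    · have hmem := sup_mem h
      have hcard : 0 < Multiset.card p.parts := Multiset.card_pos.2 h
      have e : (((p.parts.sup - r).toNat : ℤ) + r).toNat = p.parts.sup := by omega
      rw [e, addPart, if_neg (fun h' : p.parts.sup = 0 => h0 (h' ▸ hmem)), Multiset.cons_erase hmem]
  right_inv x := by
    obtain ⟨⟨s, ℓ⟩, h0, h1, h2, h3⟩ := x
    apply Subtype.ext
    simp only at h0 h1 h2 h3 ⊢
    rw [sup_addPart (by omega)]
    have e : ((((ℓ + r).toNat : ℕ) : ℤ) - r).toNat = ℓ := by omega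
    rw [e, addPart]
    split_ifs with hk
    · have hs : s = 0 := eq_zero_of_sup_eq_zero h0 (by omega)
      simp [hs]
    · rw [Multiset.erase_cons_head]

/-- Dyson's map: it removes the first column, of length `ℓ`, and adds a part `ℓ + r`. -/
lemma card_rank_le_eq {r : ℤ} (hr : 2 ≤ r ∨ r ≤ -2) {n m : ℕ} (hm : (m : ℤ) = n + r) :
    Nat.card {p : n.Partition // rank p ≤ r + 1} = Nat.card {p : m.Partition // r - 1 ≤ rank p} :=
  Nat.card_congr ((rankLeEquiv hr n).trans (rankGeEquiv hr hm).symm)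

/-- The number of partitions of `n` of rank at least `M`. -/
def rankGe (M n : ℕ) : ℕ := Nat.card {p : n.Partition // (M : ℤ) ≤ rank p}

/-- The number of partitions of `n` of rank at most `-M`. -/
def rankLe (M n : ℕ) : ℕ := Nat.card {p : n.Partition // rank p ≤ -(M : ℤ)}

lemma card_subtype_add_compl {n : ℕ} (P Q : n.Partition → Prop) (h : ∀ p, Q p ↔ ¬ P p) :
    Nat.card {p // P p} + Nat.card {p // Q p} = Fintype.card n.Partition := by
  classical
  have : Nat.card {p // Q p} = Nat.card {p // ¬ P p} :=
    Nat.card_congr (Equiv.subtypeEquivRight h)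
  rw [this, Nat.card_eq_fintype_card, Nat.card_eq_fintype_card, ← Fintype.card_sum]
  exact Fintype.card_congr (Equiv.sumCompl P)

/-- Dyson's recursion for partitions of large rank. -/
lemma rankGe_add (M n : ℕ) :
    rankGe (M + 1) (n + (M + 2)) + rankGe (M + 4) n = Fintype.card n.Partition := by
  have h1 := card_rank_le_eq (r := M + 2) (by omega) (n := n) (m := n + (M + 2)) (by push_cast; ring)
  have h2 := card_subtype_add_compl (fun p : n.Partition => rank p ≤ ((M : ℤ) + 2) + 1)
    (fun p => ((M + 4 : ℕ) : ℤ) ≤ rank p) (fun p => by push_cast; omega)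
  rw [h1] at h2
  rw [← h2, rankGe, rankGe]
  simp only [Nat.cast_add, Nat.cast_one, show ((M : ℤ) + 2 - 1) = M + 1 by ring]

/-- Dyson's recursion for partitions of very negative rank. -/
lemma rankLe_add (M n : ℕ) :
    rankLe (M + 1) (n + (M + 2)) + rankLe (M + 4) n = Fintype.card n.Partition := by
  have h1 := card_rank_le_eq (r := -((M : ℤ) + 2)) (by omega) (n := n + (M + 2)) (m := n)
    (by push_cast; ring)
  have h2 := card_subtype_add_compl (fun p : n.Partition => -((M : ℤ) + 2) - 1 ≤ rank p)
    (fun p => rank p ≤ -((M + 4 : ℕ) : ℤ)) (fun p => by push_cast; omega)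
  rw [← h1] at h2
  rw [← h2, rankLe, rankLe]
  simp only [Nat.cast_add, Nat.cast_one, show (-((M : ℤ) + 2) + 1) = -(M + 1) by ring]

lemma abs_rank_lt {n : ℕ} (p : n.Partition) : rank p + 1 ≤ n ∨ rank p = 0 := by
  rw [rank]
  rcases eq_or_ne p.parts 0 with h | h
  · right; simp [h]
  · left
    have h1 : p.parts.sup ≤ n := p.le_of_mem_parts (sup_mem h)
    have h2 : 0 < Multiset.card p.parts := Multiset.card_pos.2 h
    omega

lemma neg_rank_lt {n : ℕ} (p : n.Partition) : -rank p + 1 ≤ n ∨ rank p = 0 := by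
  rw [rank]
  rcases eq_or_ne p.parts 0 with h | h
  · right; simp [h]
  · left
    have h1 : 0 < p.parts.sup := p.parts_pos (sup_mem h)
    have h2 : Multiset.card p.parts ≤ n := by
      have hs := p.parts_sum
      have := Multiset.card_nsmul_le_sum (s := p.parts) (a := 1) fun x hx => p.parts_pos hx
      simp only [smul_eq_mul, mul_one] at this
      omega
    omega

lemma rankGe_eq_zero {M n : ℕ} (h : n < M + 2) : rankGe (M + 1) n = 0 := by
  rw [rankGe, Nat.card_eq_zero]
  left
  constructor
  rintro ⟨p, hp⟩
  have := abs_rank_lt p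
  omega

lemma rankLe_eq_zero {M n : ℕ} (h : n < M + 2) : rankLe (M + 1) n = 0 := by
  rw [rankLe, Nat.card_eq_zero]
  left
  constructor
  rintro ⟨p, hp⟩
  have := neg_rank_lt p
  omega

/-- The rank statistic is symmetric: both counts satisfy the same recursion. -/
lemma rankLe_eq_rankGe (n : ℕ) : ∀ M, rankLe (M + 1) n = rankGe (M + 1) n := by
  induction n using Nat.strong_induction_on with
  | _ n ih =>
    intro M
    rcases lt_or_ge n (M + 2) with h | h
    · rw [rankGe_eq_zero h, rankLe_eq_zero h]
    · obtain ⟨k, rfl⟩ := Nat.exists_eq_add_of_le' h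
      have h1 := rankGe_add M k
      have h2 := rankLe_add M k
      have h3 := ih k (by omega) (M + 3)
      rw [show M + 3 + 1 = M + 4 from rfl] at h3
      omega

end
end RankMoment

namespace RankMoment
noncomputable section

/-! ### Euler's product: pentagonal numbers and partitions -/

open Filter Topology

/-- `∏_{n ≥ 1} (1 - q^n)`. -/
def eulerProd (q : ℂ) : ℂ := ∏' n : ℕ, (1 - q ^ (n + 1))

lemma norm_prod_one_sub_pow_le {q : ℂ} (hq : ‖q‖ < 1) (k n : ℕ) :
    ‖∏ i ∈ Finset.range n, (1 - q ^ (k + i + 1))‖ ≤ Real.exp (1 - ‖q‖)⁻¹ := by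
  rw [norm_prod]
  calc ∏ i ∈ Finset.range n, ‖1 - q ^ (k + i + 1)‖
      ≤ ∏ i ∈ Finset.range n, Real.exp (‖q‖ ^ i) := by
        refine Finset.prod_le_prod (fun _ _ => norm_nonneg _) fun i _ => ?_
        calc ‖1 - q ^ (k + i + 1)‖ ≤ ‖(1 : ℂ)‖ + ‖q ^ (k + i + 1)‖ := norm_sub_le _ _
          _ ≤ ‖q‖ ^ i + 1 := by
            rw [norm_one, norm_pow, add_comm]
            gcongr ?_ + 1
            exact pow_le_pow_of_le_one (norm_nonneg _) hq.le (by omega)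
          _ ≤ _ := Real.add_one_le_exp _
    _ = Real.exp (∑ i ∈ Finset.range n, ‖q‖ ^ i) := (Real.exp_sum _ _).symm
    _ ≤ _ := by
        rw [Real.exp_le_exp, ← tsum_geometric_of_lt_one (norm_nonneg _) hq]
        exact (summable_geometric_of_lt_one (norm_nonneg _) hq).sum_le_tsum _
          fun i _ => by positivity

lemma norm_pow_mul_prod_le {q : ℂ} (hq : ‖q‖ < 1) (k n : ℕ) :
    ‖q ^ ((k + 1) * n) * ∏ i ∈ Finset.range (n + 1), (1 - q ^ (k + i + 1))‖ ≤
      ‖q‖ ^ n * Real.exp (1 - ‖q‖)⁻¹ := by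
  rw [norm_mul, norm_pow]
  gcongr ?_ * ?_
  · exact pow_le_pow_of_le_one (norm_nonneg _) hq.le (by nlinarith)
  · exact norm_prod_one_sub_pow_le hq k _

lemma summable_norm_pow_pentagonal {q : ℂ} (hq : ‖q‖ < 1) :
    Summable fun k : ℤ => ‖q ^ pentagonal k‖ := by
  have := (summable_geometric_of_lt_one (norm_nonneg _) hq).comp_injective pentagonal_injective
  simpa [Function.comp_def] using this

lemma multipliable_one_sub_pow_add {q : ℂ} (hq : ‖q‖ < 1) (k : ℕ) :
    Multipliable fun n : ℕ => 1 - q ^ (n + k + 1) := by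
  simp_rw [sub_eq_add_neg]
  refine multipliable_one_add_of_summable ?_
  simp only [norm_neg, norm_pow]
  have := (summable_nat_add_iff (k + 1)).2 (summable_geometric_of_lt_one (norm_nonneg _) hq)
  simpa [add_assoc] using this

/-- Euler's pentagonal number theorem for complex numbers in the unit disc. -/
theorem hasSum_pentagonal {q : ℂ} (hq : ‖q‖ < 1) :
    HasSum (fun k : ℤ => (Int.negOnePow k : ℂ) * q ^ pentagonal k) (eulerProd q) := by
  have hs : Summable fun k : ℤ => (Int.negOnePow k : ℂ) * q ^ pentagonal k := by
    refine Summable.of_norm ((summable_norm_pow_pentagonal hq).congr fun k => ?_)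
    rw [norm_mul]
    rcases Int.even_or_odd k with h | h
    · simp [Int.negOnePow_even _ h]
    · simp [Int.negOnePow_odd _ h]
  have h2 := hs.hasSum
  rw [← neg_injective.hasSum_iff (fun x hx => by absurd hx; use -x; simp)] at h2
  have h3 := h2.nat_add_neg_add_one
  have h4 : HasSum (fun k : ℕ => (-1) ^ k * (q ^ pentagonal (-k) - q ^ pentagonal (k + 1)))
      (∑' k : ℤ, (Int.negOnePow k : ℂ) * q ^ pentagonal k) := by
    convert h3 using 2 with k
    simp_rw [Function.comp_apply, neg_neg, Int.negOnePow_add]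
    simp
    ring
  have hbound : ∀ k : ℕ, ‖∑' n : ℕ, q ^ ((k + 1) * n) *
      ∏ i ∈ Finset.range (n + 1), (1 - q ^ (k + i + 1))‖ ≤
      (1 - ‖q‖)⁻¹ * Real.exp (1 - ‖q‖)⁻¹ := fun k =>
    tsum_of_norm_bounded ((hasSum_geometric_of_lt_one (norm_nonneg _) hq).mul_right _)
      (norm_pow_mul_prod_le hq k)
  have h5 := Pentagonal.tprod_one_sub_pow (x := q)
    (tendsto_pow_atTop_nhds_zero_of_norm_lt_one hq)
    (fun k => Summable.of_norm_bounded
      ((summable_geometric_of_lt_one (norm_nonneg _) hq).mul_right _) (norm_pow_mul_prod_le hq k))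
    (multipliable_one_sub_pow_add hq) h4.summable (by
      rw [tendsto_zero_iff_norm_tendsto_zero]
      refine squeeze_zero (g := fun k : ℕ => ‖q‖ ^ k * ((1 - ‖q‖)⁻¹ * Real.exp (1 - ‖q‖)⁻¹))
        (fun _ => norm_nonneg _) (fun k => ?_) ?_
      · rw [norm_mul, norm_mul, norm_pow, norm_neg, norm_one, one_pow, one_mul, norm_pow]
        gcongr ?_ * ?_
        · refine pow_le_pow_of_le_one (norm_nonneg _) hq.le ?_
          rw [Nat.le_div_iff_mul_le (by norm_num)]
          nlinarith
        · exact hbound k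
      · simpa using (tendsto_pow_atTop_nhds_zero_of_lt_one (norm_nonneg _) hq).mul_const
          ((1 - ‖q‖)⁻¹ * Real.exp (1 - ‖q‖)⁻¹))
  rw [eulerProd, h5, h4.tsum_eq]
  exact hs.hasSum

lemma hasSum_coeff_pentagonalSeries {q : ℂ} (hq : ‖q‖ < 1) :
    HasSum (fun n : ℕ => (PowerSeries.pentagonalSeries ℂ).coeff n * q ^ n) (eulerProd q) := by
  rw [← pentagonal_injective.hasSum_iff fun n hn => by
    simp [PowerSeries.coeff_pentagonalSeries_eq_zero ℂ hn]]
  convert hasSum_pentagonal hq using 2 with k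
  simp

/-- Coefficients of a power series are determined by its sum in the unit disc. -/
lemma coeff_unique {a b : ℕ → ℂ} {f : ℂ → ℂ}
    (ha : ∀ q : ℂ, ‖q‖ < 1 → HasSum (fun n => a n * q ^ n) (f q))
    (hb : ∀ q : ℂ, ‖q‖ < 1 → HasSum (fun n => b n * q ^ n) (f q)) : a = b := by
  have key : ∀ c : ℕ → ℂ, (∀ q : ℂ, ‖q‖ < 1 → HasSum (fun n => c n * q ^ n) (f q)) →
      HasFPowerSeriesAt f (FormalMultilinearSeries.ofScalars ℂ c) 0 := by
    intro c hc
    refine ⟨((1 / 2 : NNReal) : ENNReal), ?_, by simp, ?_⟩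
    · apply FormalMultilinearSeries.le_radius_of_summable_norm
      have h := (hc (1 / 2) (by norm_num)).summable.norm
      refine h.congr fun n => ?_
      rw [FormalMultilinearSeries.ofScalars_norm, norm_mul, norm_pow]
      norm_num
    · intro y hy
      have hy' : ‖y‖ < 1 := by
        have := mem_eball_zero_iff.1 hy
        rw [← ofReal_norm, ENNReal.ofReal_lt_iff_lt_toReal (norm_nonneg _) (by simp)] at this
        have h2 : ((1 / 2 : NNReal) : ENNReal).toReal = 1 / 2 := by simp
        linarith
      have h := hc y hy'
      rw [zero_add]
      simpa [FormalMultilinearSeries.ofScalars_apply_eq, mul_comm] using h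
  have h := (key a ha).eq_formalMultilinearSeries (key b hb)
  exact FormalMultilinearSeries.ofScalars_series_injective ℂ ℂ h

/-- The partition numbers. -/
def partCount (n : ℕ) : ℕ := Fintype.card n.Partition

open PowerSeries PowerSeries.WithPiTopology in
lemma mk_partCount_mul :
    (PowerSeries.mk fun n => (partCount n : ℂ)) * PowerSeries.pentagonalSeries ℂ = 1 := by
  let _ : TopologicalSpace ℂ := ⊥
  have : DiscreteTopology ℂ := ⟨rfl⟩
  have h1 := Nat.Partition.hasProd_powerSeriesMk_card_restricted ℂ (fun _ => True)
  have h2 := PowerSeries.WithPiTopology.hasProd_one_sub_X_pow ℂ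
  have h3 := h1.mul h2
  have h4 : (fun i : ℕ => (if True then ∑' j : ℕ, (X : PowerSeries ℂ) ^ ((i + 1) * j) else 1) *
      (1 - X ^ (i + 1))) = fun _ => 1 := by
    funext i
    rw [if_pos trivial]
    simp_rw [pow_mul]
    exact tsum_pow_mul_one_sub_of_constantCoeff_eq_zero (by simp)
  rw [h4] at h3
  have h5 := h3.unique hasProd_one
  rw [← h5]
  congr 2
  funext n
  simp [partCount, Nat.Partition.restricted]

lemma eulerProd_ne_zero {q : ℂ} (hq : ‖q‖ < 1) : eulerProd q ≠ 0 := by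
  rw [eulerProd]
  simp_rw [sub_eq_add_neg]
  refine tprod_one_add_ne_zero_of_summable (f := fun n : ℕ => -q ^ (n + 1)) (fun n h => ?_) ?_
  · have h1 : q ^ (n + 1) = 1 := by linear_combination -h
    have h2 := congrArg norm h1
    rw [norm_pow, norm_one] at h2
    exact (pow_lt_one₀ (norm_nonneg q) hq (Nat.succ_ne_zero n)).ne h2
  · simpa using (summable_nat_add_iff 1).2 (summable_geometric_of_lt_one (norm_nonneg _) hq)

/-- The generating function of the partition numbers in the unit disc. -/
theorem hasSum_partCount {q : ℂ} (hq : ‖q‖ < 1) :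
    HasSum (fun n => (partCount n : ℂ) * q ^ n) (eulerProd q)⁻¹ := by
  have hdiff : DifferentiableOn ℂ (fun q => (eulerProd q)⁻¹) (Metric.ball 0 1) :=
    ModularForm.differentiableOn_tprod_one_sub_pow.inv fun x hx =>
      eulerProd_ne_zero (by simpa using hx)
  set c : ℕ → ℂ := fun n => (n.factorial : ℂ)⁻¹ * iteratedDeriv n (fun q => (eulerProd q)⁻¹) 0
    with hc
  have hsum : ∀ q : ℂ, ‖q‖ < 1 → HasSum (fun n => c n * q ^ n) (eulerProd q)⁻¹ := by
    intro q hq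
    have := Complex.hasSum_taylorSeries_on_ball hdiff (z := q) (by simpa using hq)
    have e : (fun n => c n * q ^ n) = fun n : ℕ => (n.factorial : ℂ)⁻¹ • (q - 0) ^ n •
        iteratedDeriv n (fun q => (eulerProd q)⁻¹) 0 := by
      funext n
      simp only [sub_zero, smul_eq_mul, hc]
      ring
    rw [e]
    exact this
  have hmul : PowerSeries.mk c * PowerSeries.pentagonalSeries ℂ = 1 := by
    have := coeff_unique (f := fun _ => 1)
      (a := fun n => (PowerSeries.mk c * PowerSeries.pentagonalSeries ℂ).coeff n)
      (b := fun n => (1 : PowerSeries ℂ).coeff n) (fun q hq => ?_) (fun q hq => ?_)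
    · ext n
      exact congrFun this n
    · have h1 := (hsum q hq).summable.norm
      have h2 := (hasSum_coeff_pentagonalSeries hq).summable.norm
      have h3 := tsum_mul_tsum_eq_tsum_sum_antidiagonal_of_summable_norm h1 h2
      rw [(hsum q hq).tsum_eq, (hasSum_coeff_pentagonalSeries hq).tsum_eq,
        inv_mul_cancel₀ (eulerProd_ne_zero hq)] at h3
      have h4 := (summable_norm_sum_mul_antidiagonal_of_summable_norm h1 h2).of_norm.hasSum
      rw [← h3] at h4
      have e : (fun n => (PowerSeries.mk c * PowerSeries.pentagonalSeries ℂ).coeff n * q ^ n) =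
          fun n => ∑ kl ∈ Finset.HasAntidiagonal.antidiagonal n, c kl.1 * q ^ kl.1 *
            ((PowerSeries.pentagonalSeries ℂ).coeff kl.2 * q ^ kl.2) := by
        funext n
        rw [PowerSeries.coeff_mul, Finset.sum_mul]
        refine Finset.sum_congr rfl fun ij hij => ?_
        rw [PowerSeries.coeff_mk, ← Finset.HasAntidiagonal.mem_antidiagonal.1 hij, pow_add]
        ring
      rw [e]
      exact h4
    · convert hasSum_ite_eq (0 : ℕ) (1 : ℂ) using 2 with n
      rw [PowerSeries.coeff_one]
      split_ifs with h <;> simp [h]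
  have heq : PowerSeries.mk c = PowerSeries.mk fun n => (partCount n : ℂ) := by
    have h1 := mk_partCount_mul
    rw [mul_comm] at h1
    exact left_inv_eq_right_inv hmul h1
  have h := hsum q hq
  have hcn : c = fun n => (partCount n : ℂ) := by
    funext n
    simpa using congrArg (PowerSeries.coeff n) heq
  rwa [hcn] at h

lemma summable_partCount {x : ℝ} (h0 : 0 ≤ x) (hx : x < 1) :
    Summable fun n => (partCount n : ℝ) * x ^ n := by
  have := (hasSum_partCount (q := (x : ℂ)) (by simpa [abs_of_nonneg h0] using hx)).summable.norm
  simpa [abs_of_nonneg h0] using this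

/-! ### The generating function of the second rank moment -/

lemma rankGe_le (M n : ℕ) : rankGe M n ≤ partCount n := by
  rw [rankGe, partCount, ← Nat.card_eq_fintype_card]
  exact Nat.card_le_card_of_injective Subtype.val Subtype.val_injective

/-- The exponents `∑_{i < J} (M + 3 i + 2)` obtained by iterating Dyson's recursion. -/
def rankExp (J M : ℕ) : ℕ := ∑ i ∈ Finset.range J, (M + 3 * i + 2)

lemma rankExp_succ (J M : ℕ) : rankExp (J + 1) M = rankExp J M + (M + 3 * J + 2) := by
  rw [rankExp, Finset.sum_range_succ, rankExp]

lemma two_mul_rankExp (J M : ℕ) : 2 * rankExp J M = J * (2 * M + 1 + 3 * J) := by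
  induction J with
  | zero => simp [rankExp]
  | succ J ih =>
    rw [rankExp_succ, mul_add, ih]
    ring

/-- The generating function of the partitions of rank at least `M + 1`. -/
def rankGF (M : ℕ) (q : ℂ) : ℂ := ∑' n, (rankGe (M + 1) n : ℂ) * q ^ n

lemma summable_rankGe {q : ℂ} (hq : ‖q‖ < 1) (M : ℕ) :
    Summable fun n => ‖(rankGe M n : ℂ) * q ^ n‖ := by
  refine Summable.of_nonneg_of_le (fun _ => norm_nonneg _) (fun n => ?_)
    (summable_partCount (norm_nonneg q) hq)
  rw [norm_mul, norm_pow, Complex.norm_natCast]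
  gcongr
  exact_mod_cast rankGe_le M n

lemma rankGF_shift {q : ℂ} (hq : ‖q‖ < 1) (M : ℕ) :
    rankGF M q = q ^ (M + 2) * ∑' n, (rankGe (M + 1) (n + (M + 2)) : ℂ) * q ^ n := by
  rw [rankGF, ← (summable_rankGe hq (M + 1)).of_norm.sum_add_tsum_nat_add (M + 2),
    Finset.sum_eq_zero (fun n hn => by rw [rankGe_eq_zero (Finset.mem_range.1 hn)]; simp),
    zero_add, ← tsum_mul_left]
  refine tsum_congr fun n => ?_
  rw [pow_add]
  ring

/-- Dyson's recursion for the generating functions; `rankGe_eq_zero` removes the terms of degree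
less than `M + 2`. -/
lemma rankGF_rec {q : ℂ} (hq : ‖q‖ < 1) (M : ℕ) :
    rankGF M q = q ^ (M + 2) * ((eulerProd q)⁻¹ - rankGF (M + 3) q) := by
  rw [rankGF_shift hq, ← (hasSum_partCount hq).tsum_eq, rankGF,
    ← (hasSum_partCount hq).summable.tsum_sub (summable_rankGe hq _).of_norm]
  congr 1
  refine tsum_congr fun n => ?_
  have h := rankGe_add M n
  rw [partCount, ← h]
  push_cast
  ring

/-- A common bound for the generating functions of partitions. -/
def partBound (q : ℂ) : ℝ := ∑' n, (partCount n : ℝ) * ‖q‖ ^ n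

lemma tsum_norm_rankGe_le {q : ℂ} (hq : ‖q‖ < 1) (M : ℕ) :
    ∑' n, ‖(rankGe (M + 1) n : ℂ) * q ^ n‖ ≤ ‖q‖ ^ (M + 2) * partBound q := by
  rw [← (summable_rankGe hq (M + 1)).sum_add_tsum_nat_add (M + 2),
    Finset.sum_eq_zero (fun n hn => by rw [rankGe_eq_zero (Finset.mem_range.1 hn)]; simp),
    zero_add, partBound, ← tsum_mul_left]
  refine Summable.tsum_le_tsum (fun n => ?_)
    ((summable_nat_add_iff (M + 2)).2 (summable_rankGe hq (M + 1)))
    ((summable_partCount (norm_nonneg q) hq).mul_left _)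
  have h : (rankGe (M + 1) (n + (M + 2)) : ℝ) ≤ partCount n := by
    exact_mod_cast (rankGe_add M n) ▸ Nat.le_add_right _ _
  rw [norm_mul, norm_pow, Complex.norm_natCast, pow_add]
  calc _ ≤ (partCount n : ℝ) * (‖q‖ ^ n * ‖q‖ ^ (M + 2)) := by gcongr
    _ = _ := by ring

lemma norm_rankGF_le {q : ℂ} (hq : ‖q‖ < 1) (M : ℕ) :
    ‖rankGF M q‖ ≤ ‖q‖ ^ (M + 2) * partBound q :=
  (norm_tsum_le_tsum_norm (summable_rankGe hq _)).trans (tsum_norm_rankGe_le hq M)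

lemma rankGF_partial {q : ℂ} (hq : ‖q‖ < 1) (M J : ℕ) :
    rankGF M q = (eulerProd q)⁻¹ * ∑ j ∈ Finset.range J, (-1) ^ j * q ^ rankExp (j + 1) M +
      (-1) ^ J * q ^ rankExp J M * rankGF (M + 3 * J) q := by
  induction J with
  | zero => simp [rankExp]
  | succ J ih =>
    rw [ih, rankGF_rec hq (M + 3 * J), Finset.sum_range_succ, rankExp_succ J, pow_add _ (rankExp J M),
      show M + 3 * (J + 1) = M + 3 * J + 3 by ring]
    ring

lemma le_rankExp (J M : ℕ) : J + M ≤ rankExp (J + 1) M := by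
  have := two_mul_rankExp (J + 1) M
  nlinarith

/-- Iterating Dyson's recursion expresses the generating function of the partitions of rank at
least `M + 1` by a partial theta series. -/
lemma hasSum_rankGF {q : ℂ} (hq : ‖q‖ < 1) (M : ℕ) :
    HasSum (fun j => (-1) ^ j * q ^ rankExp (j + 1) M) (eulerProd q * rankGF M q) := by
  have hs : Summable fun j : ℕ => (-1) ^ j * q ^ rankExp (j + 1) M := by
    refine Summable.of_norm_bounded (summable_geometric_of_lt_one (norm_nonneg _) hq) fun j => ?_
    rw [norm_mul, norm_pow, norm_neg, norm_one, one_pow, one_mul, norm_pow]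
    exact pow_le_pow_of_le_one (norm_nonneg _) hq.le (le_trans (by omega) (le_rankExp j M))
  rw [hs.hasSum_iff_tendsto_nat]
  have h0 := eulerProd_ne_zero hq
  have h1 : (fun J => ∑ j ∈ Finset.range J, (-1) ^ j * q ^ rankExp (j + 1) M) =
      fun J => eulerProd q * rankGF M q -
        eulerProd q * ((-1) ^ J * q ^ rankExp J M * rankGF (M + 3 * J) q) := by
    funext J
    rw [rankGF_partial hq M J]
    field_simp
    ring
  rw [h1]
  have h2 : Tendsto (fun J => (-1) ^ J * q ^ rankExp J M * rankGF (M + 3 * J) q) atTop (𝓝 0) := by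
    rw [tendsto_zero_iff_norm_tendsto_zero]
    refine squeeze_zero (g := fun J : ℕ => ‖q‖ ^ J * partBound q) (fun _ => norm_nonneg _)
      (fun J => ?_) ?_
    · rw [norm_mul, norm_mul, norm_pow, norm_neg, norm_one, one_pow, one_mul, norm_pow]
      have hpb : 0 ≤ partBound q := tsum_nonneg fun n => by positivity
      calc ‖q‖ ^ rankExp J M * ‖rankGF (M + 3 * J) q‖ ≤ 1 * (‖q‖ ^ J * partBound q) := by
            gcongr
            · exact pow_le_one₀ (norm_nonneg _) hq.le
            · refine (norm_rankGF_le hq _).trans ?_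
              gcongr ?_ * _
              exact pow_le_pow_of_le_one (norm_nonneg _) hq.le (by omega)
        _ = _ := one_mul _
    · simpa using (tendsto_pow_atTop_nhds_zero_of_lt_one (norm_nonneg _) hq).mul_const (partBound q)
  simpa using tendsto_const_nhds.sub (h2.const_mul (eulerProd q))

lemma two_mul_choose (m : ℤ) : 2 * Ring.choose m 2 = m * (m - 1) := by
  have h := Ring.descPochhammer_eq_factorial_smul_choose m 2
  simp [descPochhammer, Polynomial.smeval_mul, Polynomial.smeval_sub, Polynomial.smeval_X,
    Polynomial.smeval_one] at h
  linarith

lemma two_mul_sum_ite (n : ℕ) (r : ℤ) (hr : r ≤ n) :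
    2 * ∑ M ∈ Finset.range n, (if (M : ℤ) + 1 ≤ r then (M : ℤ) else 0) =
      if 0 ≤ r then r * (r - 1) else 0 := by
  rw [← Finset.sum_filter]
  have : Finset.filter (fun M : ℕ => (M : ℤ) + 1 ≤ r) (Finset.range n) =
      Finset.range r.toNat := by
    ext M; simp; omega
  rw [this]
  have h := Finset.sum_range_id_mul_two r.toNat
  split_ifs with h0
  · obtain ⟨k, rfl⟩ := Int.eq_ofNat_of_zero_le h0
    simp only [Int.toNat_natCast] at h ⊢
    have h' : ((∑ i ∈ Finset.range k, i : ℕ) : ℤ) * 2 = ((k * (k - 1) : ℕ) : ℤ) := by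
      exact_mod_cast h
    rcases k with _ | k
    · simp
    · rw [Nat.add_sub_cancel] at h'
      push_cast at h' ⊢
      linarith
  · have : r.toNat = 0 := by omega
    simp [this]

/-- Summation by parts for `(r choose 2)`: each threshold `M + 1 ≤ r` has weight `M`, and each
threshold `r ≤ -(M + 1)` has weight `M + 1`. -/
lemma choose_two_eq_sum (n : ℕ) (r : ℤ) (h1 : r ≤ n) (h2 : -r ≤ n) :
    Ring.choose r 2 = ∑ M ∈ Finset.range n, ((if (M : ℤ) + 1 ≤ r then (M : ℤ) else 0) +
      (if r ≤ -((M : ℤ) + 1) then (M : ℤ) + 1 else 0)) := by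
  have e1 := two_mul_sum_ite n r h1
  have e2 : 2 * ∑ M ∈ Finset.range n, (if r ≤ -((M : ℤ) + 1) then (M : ℤ) + 1 else 0) =
      if 0 ≤ r then 0 else r * (r - 1) := by
    have h3 := two_mul_sum_ite (n + 1) (-r + 1) (by push_cast; linarith)
    rw [Finset.sum_range_succ'] at h3
    simp only [Nat.cast_zero, ite_self, add_zero, Nat.cast_add, Nat.cast_one] at h3
    have h4 : ∀ M : ℕ, (if r ≤ -((M : ℤ) + 1) then (M : ℤ) + 1 else 0) =
        if (M : ℤ) + 1 + 1 ≤ -r + 1 then (M : ℤ) + 1 else 0 := by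
      intro M
      congr 1
      exact propext ⟨fun h => by linarith, fun h => by linarith⟩
    simp_rw [h4]
    rw [h3]
    rcases lt_trichotomy r 0 with h | rfl | h
    · rw [if_pos (by linarith), if_neg (by linarith)]; ring
    · simp
    · by_cases hr1 : r = 1
      · subst hr1; simp
      · rw [if_neg (by omega), if_pos (by linarith)]
  rw [Finset.sum_add_distrib]
  have := two_mul_choose r
  split_ifs at e1 e2 <;> linarith

/-- By the symmetry of the rank, the weights `M` and `M + 1` of the two tails add up to
`2 M + 1`. -/
lemma secondMoment_eq_sum (n : ℕ) :
    secondMoment n = ∑ M ∈ Finset.range n, (2 * (M : ℤ) + 1) * rankGe (M + 1) n := by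
  classical
  have hbd : ∀ p : n.Partition, rank p ≤ n ∧ -rank p ≤ n := fun p => by
    have h1 := abs_rank_lt p
    have h2 := neg_rank_lt p
    omega
  have hcard : ∀ P : n.Partition → Prop, (Nat.card {p // P p} : ℤ) =
      ∑ p : n.Partition, if P p then 1 else 0 := by
    intro P
    rw [Nat.card_eq_fintype_card, Fintype.card_subtype, Finset.sum_boole]
  have h1 : secondMoment n = ∑ m ∈ Finset.Icc (-(n : ℤ)) n, Ring.choose m 2 * rankCount m n := by
    refine finsum_eq_sum_of_support_subset _ fun m hm => ?_
    have hne : rankCount m n ≠ 0 := fun h => hm (by simp [h])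
    rw [rankCount, Nat.card_ne_zero] at hne
    obtain ⟨⟨p, rfl⟩⟩ := hne.1
    have := hbd p
    rw [Finset.coe_Icc, Set.mem_Icc]
    omega
  have h2 : secondMoment n = ∑ p : n.Partition, Ring.choose (rank p) 2 := by
    rw [h1]
    simp_rw [rankCount, hcard, Finset.mul_sum]
    rw [Finset.sum_comm]
    refine Finset.sum_congr rfl fun p _ => ?_
    simp_rw [mul_ite, mul_one, mul_zero]
    rw [Finset.sum_ite_eq, if_pos]
    have := hbd p
    rw [Finset.mem_Icc]
    omega
  rw [h2, Finset.sum_congr rfl fun p _ => choose_two_eq_sum n (rank p) (hbd p).1 (hbd p).2,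
    Finset.sum_comm]
  refine Finset.sum_congr rfl fun M _ => ?_
  have e1 : ∑ p : n.Partition, (if (M : ℤ) + 1 ≤ rank p then (M : ℤ) else 0) =
      M * rankGe (M + 1) n := by
    rw [rankGe, hcard, Finset.mul_sum]
    simp
  have e2 : ∑ p : n.Partition, (if rank p ≤ -((M : ℤ) + 1) then (M : ℤ) + 1 else 0) =
      (M + 1) * rankGe (M + 1) n := by
    rw [← rankLe_eq_rankGe, rankLe, hcard, Finset.mul_sum]
    simp
  rw [Finset.sum_add_distrib, e1, e2]
  ring

lemma secondMoment_eq_tsum (n : ℕ) :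
    (secondMoment n : ℂ) = ∑' M : ℕ, (2 * (M : ℂ) + 1) * rankGe (M + 1) n := by
  rw [secondMoment_eq_sum, tsum_eq_sum (s := Finset.range n)]
  · push_cast; rfl
  · intro M hM
    rw [rankGe_eq_zero (by simp at hM; omega)]
    simp

lemma summable_linear_mul_pow {x : ℝ} (h0 : 0 ≤ x) (hx : x < 1) :
    Summable fun M : ℕ => (2 * (M : ℝ) + 1) * x ^ M := by
  have h1 := summable_pow_mul_geometric_of_norm_lt_one 1 (r := x)
    (by rwa [Real.norm_of_nonneg h0])
  have h2 := summable_geometric_of_lt_one h0 hx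
  refine ((h1.mul_left 2).add h2).congr fun M => ?_
  simp
  ring

lemma norm_two_mul_add_one (M : ℕ) : ‖(2 * (M : ℂ) + 1)‖ = 2 * M + 1 := by
  rw [show (2 * (M : ℂ) + 1) = ((2 * M + 1 : ℕ) : ℂ) by push_cast; rfl, Complex.norm_natCast]
  push_cast
  rfl

/-- The double series `(2M + 1) N(rank ≥ M + 1, n) qⁿ` converges absolutely. -/
lemma summable_rank_double {q : ℂ} (hq : ‖q‖ < 1) :
    Summable fun x : ℕ × ℕ => (2 * (x.1 : ℂ) + 1) * (rankGe (x.1 + 1) x.2 * q ^ x.2) := by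
  refine Summable.of_norm ?_
  rw [summable_prod_of_nonneg fun _ => norm_nonneg _]
  refine ⟨fun M => ?_, ?_⟩
  · simp_rw [norm_mul (2 * (M : ℂ) + 1)]
    exact (summable_rankGe hq (M + 1)).mul_left _
  · refine Summable.of_nonneg_of_le (fun _ => tsum_nonneg fun _ => norm_nonneg _) (fun M => ?_)
      ((summable_linear_mul_pow (norm_nonneg q) hq).mul_right (partBound q))
    simp_rw [norm_mul (2 * (M : ℂ) + 1), tsum_mul_left, norm_two_mul_add_one, mul_assoc]
    gcongr
    refine (tsum_norm_rankGe_le hq M).trans ?_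
    have hpb : 0 ≤ partBound q := tsum_nonneg fun n => by positivity
    gcongr ?_ * _
    exact pow_le_pow_of_le_one (norm_nonneg _) hq.le (by omega)

lemma hasSum_R2 {q : ℂ} (hq : ‖q‖ < 1) :
    HasSum (fun n => (secondMoment n : ℂ) * q ^ n) (R2 q) := by
  have h : Summable fun n : ℕ => ∑' M : ℕ, (2 * (M : ℂ) + 1) * (rankGe (M + 1) n * q ^ n) :=
    Summable.prod (f := fun x : ℕ × ℕ => (2 * (x.2 : ℂ) + 1) * (rankGe (x.2 + 1) x.1 * q ^ x.1))
      (summable_rank_double hq).prod_symm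
  have e : (fun n : ℕ => ∑' M : ℕ, (2 * (M : ℂ) + 1) * (rankGe (M + 1) n * q ^ n)) =
      fun n => (secondMoment n : ℂ) * q ^ n := by
    funext n
    simp_rw [← mul_assoc]
    rw [secondMoment_eq_tsum, tsum_mul_right]
  rw [e] at h
  exact h.hasSum

lemma R2_eq_tsum {q : ℂ} (hq : ‖q‖ < 1) :
    R2 q = ∑' M : ℕ, (2 * (M : ℂ) + 1) * rankGF M q := by
  have h := (summable_rank_double hq)
  have h1 : R2 q = ∑' n, ∑' M : ℕ, (2 * (M : ℂ) + 1) * (rankGe (M + 1) n * q ^ n) := by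
    rw [R2]
    refine tsum_congr fun n => ?_
    simp_rw [← mul_assoc]
    rw [secondMoment_eq_tsum, tsum_mul_right]
  rw [h1, Summable.tsum_comm (f := fun M n : ℕ => (2 * (M : ℂ) + 1) * (rankGe (M + 1) n * q ^ n)) h]
  refine tsum_congr fun M => ?_
  rw [tsum_mul_left, rankGF]

/-- The second rank moment as a Lambert-type series. -/
theorem eulerProd_mul_R2 {q : ℂ} (hq : ‖q‖ < 1) :
    eulerProd q * R2 q =
      ∑' j : ℕ, (-1) ^ j * ∑' M : ℕ, (2 * (M : ℂ) + 1) * q ^ rankExp (j + 1) M := by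
  have hs : Summable fun x : ℕ × ℕ => (2 * (x.1 : ℂ) + 1) *
      ((-1) ^ x.2 * q ^ rankExp (x.2 + 1) x.1) := by
    have hb : Summable fun x : ℕ × ℕ => ((2 * (x.1 : ℝ) + 1) * ‖q‖ ^ x.1) * ‖q‖ ^ x.2 :=
      Summable.mul_of_nonneg (f := fun M : ℕ => (2 * (M : ℝ) + 1) * ‖q‖ ^ M)
        (g := fun j : ℕ => ‖q‖ ^ j) (summable_linear_mul_pow (norm_nonneg q) hq)
        (summable_geometric_of_lt_one (norm_nonneg q) hq) (fun M => by positivity)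
        (fun j => by positivity)
    refine Summable.of_norm_bounded hb fun x => ?_
    rw [norm_mul, norm_two_mul_add_one, norm_mul, norm_pow, norm_neg, norm_one, one_pow, one_mul,
      norm_pow, mul_assoc, ← pow_add]
    gcongr ?_ * ?_
    exact pow_le_pow_of_le_one (norm_nonneg _) hq.le (by have := le_rankExp x.2 x.1; omega)
  rw [R2_eq_tsum hq, ← tsum_mul_left]
  have h1 : ∀ M : ℕ, eulerProd q * ((2 * (M : ℂ) + 1) * rankGF M q) =
      ∑' j : ℕ, (2 * (M : ℂ) + 1) * ((-1) ^ j * q ^ rankExp (j + 1) M) := by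
    intro M
    rw [tsum_mul_left, (hasSum_rankGF hq M).tsum_eq]
    ring
  simp_rw [h1]
  rw [← Summable.tsum_comm (f := fun M j : ℕ => (2 * (M : ℂ) + 1) *
      ((-1) ^ j * q ^ rankExp (j + 1) M)) hs]
  refine tsum_congr fun j => ?_
  rw [← tsum_mul_left]
  exact tsum_congr fun M => by ring

end
end RankMoment

namespace RankMoment
noncomputable section

/-! ### Products of two eta functions as theta series of the lattice `ℤ²` -/

open Filter Topology

lemma eta_eq_eulerProd (τ : ℂ) : ModularForm.eta τ =
    Complex.exp (2 * Real.pi * Complex.I * τ / 24) *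
      eulerProd (Complex.exp (2 * Real.pi * Complex.I * τ)) := by
  simp only [ModularForm.eta, ModularForm.eta_q_eq_pow, eulerProd, Function.Periodic.qParam]
  norm_num

lemma norm_exp_lt_one {τ : ℂ} (hτ : 0 < τ.im) :
    ‖Complex.exp (2 * Real.pi * Complex.I * τ)‖ < 1 := by
  rw [Complex.norm_exp, Real.exp_lt_one_iff]
  have : (2 * Real.pi * Complex.I * τ).re = -(2 * Real.pi * τ.im) := by simp
  rw [this]
  have := Real.pi_pos
  nlinarith [mul_pos this hτ]

/-- The exponential series of the eta function, which is Euler's pentagonal number theorem. -/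
lemma hasSum_eta {τ : ℂ} (hτ : 0 < τ.im) :
    HasSum (fun k : ℤ => (Int.negOnePow k : ℂ) *
      Complex.exp (Real.pi * Complex.I / 12 * τ * (6 * k - 1) ^ 2)) (ModularForm.eta τ) := by
  rw [eta_eq_eulerProd]
  have e : (fun k : ℤ => (Int.negOnePow k : ℂ) *
      Complex.exp (Real.pi * Complex.I / 12 * τ * (6 * k - 1) ^ 2)) = fun k : ℤ =>
      Complex.exp (2 * Real.pi * Complex.I * τ / 24) * ((Int.negOnePow k : ℂ) *
        Complex.exp (2 * Real.pi * Complex.I * τ) ^ pentagonal k) := by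
    funext k
    rw [mul_left_comm, ← Complex.exp_nat_mul, ← Complex.exp_add]
    congr 2
    have h : (2 * (pentagonal k : ℤ)) = k * (3 * k - 1) := by
      exact_mod_cast two_mul_natCast_pentagonal k
    have h' : (2 * (pentagonal k : ℂ)) = k * (3 * k - 1) := by exact_mod_cast h
    linear_combination (-(Real.pi * Complex.I * τ)) * h'
  rw [e]
  exact (hasSum_pentagonal (norm_exp_lt_one hτ)).mul_left _

lemma summable_int_gaussian {δ : ℝ} (hδ : 0 < δ) :
    Summable fun n : ℤ => Real.exp (-δ * n ^ 2) := by
  have h := ((summable_jacobiTheta₂_term_iff 0 (Complex.I * (δ / Real.pi : ℝ))).2 (by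
    simp only [Complex.mul_im, Complex.I_re, Complex.I_im, Complex.ofReal_re, Complex.ofReal_im]
    have := Real.pi_pos
    ring_nf
    positivity)).norm
  refine h.congr fun n => ?_
  rw [norm_jacobiTheta₂_term]
  congr 1
  simp
  field_simp

lemma summable_int_gaussian₂ {δ : ℝ} (hδ : 0 < δ) :
    Summable fun p : ℤ × ℤ => Real.exp (-δ * ((p.1 : ℝ) ^ 2 + (p.2 : ℝ) ^ 2)) := by
  have h := (summable_int_gaussian hδ).mul_of_nonneg (summable_int_gaussian hδ)
    (fun _ => (Real.exp_pos _).le) (fun _ => (Real.exp_pos _).le)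
  refine h.congr fun p => ?_
  rw [← Real.exp_add]
  ring_nf

/-- The term `q₁^{(r+s)²/24} q₂^{(r-s)²/24}` with `q_j = e^{2πiτ_j}`. -/
def pairTerm (τ₁ τ₂ : ℂ) (p : ℤ × ℤ) : ℂ :=
  Complex.exp (Real.pi * Complex.I / 12 * (τ₁ * (p.1 + p.2) ^ 2 + τ₂ * (p.1 - p.2) ^ 2))

lemma pairTerm_swap (τ₁ τ₂ : ℂ) (p : ℤ × ℤ) : pairTerm τ₁ τ₂ p.swap = pairTerm τ₁ τ₂ p := by
  simp only [pairTerm, Prod.fst_swap, Prod.snd_swap]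
  ring_nf

lemma pairTerm_neg (τ₁ τ₂ : ℂ) (p : ℤ × ℤ) : pairTerm τ₁ τ₂ (-p) = pairTerm τ₁ τ₂ p := by
  simp only [pairTerm, Prod.fst_neg, Prod.snd_neg]
  push_cast
  ring_nf

lemma summable_norm_pairTerm {τ₁ τ₂ : ℂ} (h₁ : 0 < τ₁.im) (h₂ : 0 < τ₂.im) :
    Summable fun p : ℤ × ℤ => ‖pairTerm τ₁ τ₂ p‖ := by
  have hpi := Real.pi_pos
  set δ := min τ₁.im τ₂.im with hδ
  have hδ0 : 0 < δ := lt_min h₁ h₂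
  refine Summable.of_nonneg_of_le (fun _ => norm_nonneg _) (fun p => ?_)
    (summable_int_gaussian₂ (δ := Real.pi / 6 * δ) (by positivity))
  rw [pairTerm, Complex.norm_exp, Real.exp_le_exp]
  have e : (Real.pi * Complex.I / 12 * (τ₁ * (p.1 + p.2) ^ 2 + τ₂ * (p.1 - p.2) ^ 2)).re =
      -(Real.pi / 12) * (τ₁.im * ((p.1 : ℝ) + p.2) ^ 2 + τ₂.im * ((p.1 : ℝ) - p.2) ^ 2) := by
    have : (Real.pi * Complex.I / 12 * (τ₁ * (p.1 + p.2) ^ 2 + τ₂ * (p.1 - p.2) ^ 2)) =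
      ((Real.pi / 12 : ℝ) : ℂ) * (Complex.I * (τ₁ * ((((p.1 : ℝ) + p.2) ^ 2 : ℝ) : ℂ) +
        τ₂ * ((((p.1 : ℝ) - p.2) ^ 2 : ℝ) : ℂ))) := by push_cast; ring
    rw [this, Complex.re_ofReal_mul, Complex.I_mul_re, Complex.add_im, Complex.im_mul_ofReal,
      Complex.im_mul_ofReal]
    ring
  rw [e]
  have a1 : δ * ((p.1 : ℝ) + p.2) ^ 2 ≤ τ₁.im * ((p.1 : ℝ) + p.2) ^ 2 := by
    gcongr; exact min_le_left _ _
  have a2 : δ * ((p.1 : ℝ) - p.2) ^ 2 ≤ τ₂.im * ((p.1 : ℝ) - p.2) ^ 2 := by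
    gcongr; exact min_le_right _ _
  nlinarith [mul_le_mul_of_nonneg_left (add_le_add a1 a2) (by positivity : 0 ≤ Real.pi / 12)]

/-- The weight of the pair `(r, s)` in the double series of `η(τ₁) η(τ₂)`. The summation indices
`k, l` of the two factors correspond to `r = 3 (k + l) - 1` and `s = 3 (k - l)`. -/
def weightEta (p : ℤ × ℤ) : ℤ :=
  if p.1 % 3 = 2 ∧ p.2 % 3 = 0 ∧ (p.1 + p.2) % 2 = 1 then (if p.2 % 2 = 0 then 1 else -1) else 0

/-- The difference of the indicator functions of `6ℤ × ℤ` and `3ℤ × 2ℤ`. Unlike `weightEta` it is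
suited to Poisson summation in the second variable. -/
def weightLattice (p : ℤ × ℤ) : ℤ :=
  (if p.1 % 6 = 0 then 1 else 0) - (if p.1 % 3 = 0 ∧ p.2 % 2 = 0 then 1 else 0)

lemma weightEta_congr {r s r' s' : ℤ} (hr : r % 6 = r' % 6) (hs : s % 6 = s' % 6) :
    weightEta (r, s) = weightEta (r', s') := by
  have h1 : r % 3 = r' % 3 := by omega
  have h2 : s % 3 = s' % 3 := by omega
  have h3 : (r + s) % 2 = (r' + s') % 2 := by omega
  have h4 : s % 2 = s' % 2 := by omega
  simp only [weightEta, h1, h2, h3, h4]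

lemma weightLattice_congr {r s r' s' : ℤ} (hr : r % 6 = r' % 6) (hs : s % 6 = s' % 6) :
    weightLattice (r, s) = weightLattice (r', s') := by
  have h1 : r % 3 = r' % 3 := by omega
  have h4 : s % 2 = s' % 2 := by omega
  simp only [weightLattice, h1, hr, h4]

/-- After averaging over the symmetries `(r, s) ↦ (s, r)` and `(r, s) ↦ (-r, -s)`, the two weights
agree up to the factor `2`. -/
lemma weight_symm (p : ℤ × ℤ) :
    weightEta p + weightEta p.swap + weightEta (-p) + weightEta (-p.swap) =
      weightLattice p + weightLattice p.swap := by
  obtain ⟨r, s⟩ := p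
  simp only [Prod.swap_prod_mk, Prod.neg_mk]
  have hr : r % 6 = r % 6 % 6 := by omega
  have hs : s % 6 = s % 6 % 6 := by omega
  have hr' : (-r) % 6 = (-(r % 6)) % 6 := by omega
  have hs' : (-s) % 6 = (-(s % 6)) % 6 := by omega
  rw [weightEta_congr hr hs, weightEta_congr hs hr, weightEta_congr hr' hs',
    weightEta_congr hs' hr', weightLattice_congr hr hs, weightLattice_congr hs hr]
  have r0 := Int.emod_nonneg r (show (6 : ℤ) ≠ 0 by norm_num)
  have r6 := Int.emod_lt_of_pos r (show (0 : ℤ) < 6 by norm_num)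
  have s0 := Int.emod_nonneg s (show (6 : ℤ) ≠ 0 by norm_num)
  have s6 := Int.emod_lt_of_pos s (show (0 : ℤ) < 6 by norm_num)
  clear hr hs hr' hs'
  generalize r % 6 = u at *
  generalize s % 6 = v at *
  interval_cases u <;> interval_cases v <;> decide

lemma summable_mul_of_bounded {ι : Type*} {f : ι → ℂ} (hf : Summable fun i => ‖f i‖) (w : ι → ℤ)
    (hw : ∀ i, |w i| ≤ 1) : Summable fun i => (w i : ℂ) * f i := by
  refine Summable.of_norm_bounded hf fun i => ?_
  rw [norm_mul]
  have : ‖(w i : ℂ)‖ ≤ 1 := by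
    rw [Complex.norm_intCast]
    exact_mod_cast hw i
  exact mul_le_of_le_one_left (norm_nonneg _) this

lemma tsum_weightEta_eq {f : ℤ × ℤ → ℂ} (hf : Summable fun p => ‖f p‖)
    (hswap : ∀ p : ℤ × ℤ, f p.swap = f p) (hneg : ∀ p : ℤ × ℤ, f (-p) = f p) :
    ∑' p, (weightEta p : ℂ) * f p = 1 / 2 * ∑' p, (weightLattice p : ℂ) * f p := by
  have b1 : ∀ p, |weightEta p| ≤ 1 := fun p => by
    rw [weightEta]; split_ifs <;> simp
  have b2 : ∀ p, |weightLattice p| ≤ 1 := fun p => by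
    rw [weightLattice]; split_ifs <;> simp
  have s1 := summable_mul_of_bounded hf weightEta b1
  have s2 := summable_mul_of_bounded hf _ fun p : ℤ × ℤ => b1 p.swap
  have s3 := summable_mul_of_bounded hf _ fun p : ℤ × ℤ => b1 (-p)
  have s4 := summable_mul_of_bounded hf _ fun p : ℤ × ℤ => b1 (-p.swap)
  have l1 := summable_mul_of_bounded hf weightLattice b2
  have l2 := summable_mul_of_bounded hf _ fun p : ℤ × ℤ => b2 p.swap
  have e2 : ∑' p : ℤ × ℤ, (weightEta p.swap : ℂ) * f p = ∑' p, (weightEta p : ℂ) * f p := by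
    rw [← (Equiv.prodComm ℤ ℤ).tsum_eq]
    exact tsum_congr fun p => by simp [hswap]
  have e3 : ∑' p : ℤ × ℤ, (weightEta (-p) : ℂ) * f p = ∑' p, (weightEta p : ℂ) * f p := by
    rw [← (Equiv.neg (ℤ × ℤ)).tsum_eq]
    exact tsum_congr fun p => by simp [hneg]
  have e4 : ∑' p : ℤ × ℤ, (weightEta (-p.swap) : ℂ) * f p = ∑' p, (weightEta p : ℂ) * f p := by
    rw [← ((Equiv.prodComm ℤ ℤ).trans (Equiv.neg (ℤ × ℤ))).tsum_eq]
    refine tsum_congr fun p => ?_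
    simp [hneg, hswap]
  have k2 : ∑' p : ℤ × ℤ, (weightLattice p.swap : ℂ) * f p = ∑' p, (weightLattice p : ℂ) * f p := by
    rw [← (Equiv.prodComm ℤ ℤ).tsum_eq]
    exact tsum_congr fun p => by simp [hswap]
  have h := ((s1.hasSum.add s2.hasSum).add s3.hasSum).add s4.hasSum
  have h' := l1.hasSum.add l2.hasSum
  have e : (fun p : ℤ × ℤ => (weightEta p : ℂ) * f p + (weightEta p.swap : ℂ) * f p +
      (weightEta (-p) : ℂ) * f p + (weightEta (-p.swap) : ℂ) * f p) =
      fun p => (weightLattice p : ℂ) * f p + (weightLattice p.swap : ℂ) * f p := by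
    funext p
    rw [← add_mul, ← add_mul, ← add_mul, ← add_mul]
    congr 1
    exact_mod_cast weight_symm p
  rw [e] at h
  have := h.unique h'
  rw [e2, e3, e4, k2] at this
  linear_combination this / 4

/-- `η(τ₁) η(τ₂)` as a sum over the lattice. -/
lemma eta_mul_eta_eq_tsum {τ₁ τ₂ : ℂ} (h₁ : 0 < τ₁.im) (h₂ : 0 < τ₂.im) :
    ModularForm.eta τ₁ * ModularForm.eta τ₂ =
      ∑' p, (weightEta p : ℂ) * pairTerm τ₁ τ₂ p := by
  have a1 := hasSum_eta h₁
  have a2 := hasSum_eta h₂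
  rw [← a1.tsum_eq, ← a2.tsum_eq, tsum_mul_tsum_of_summable_norm a1.summable.norm a2.summable.norm]
  let φ : ℤ × ℤ → ℤ × ℤ := fun p => (3 * (p.1 + p.2) - 1, 3 * (p.1 - p.2))
  have hφ : Function.Injective φ := by
    rintro ⟨a, b⟩ ⟨c, d⟩ h
    simp only [φ, Prod.mk.injEq] at h ⊢
    omega
  have hsupp : Function.support (fun p => (weightEta p : ℂ) * pairTerm τ₁ τ₂ p) ⊆ Set.range φ := by
    rintro ⟨r, s⟩ h
    have hw : weightEta (r, s) ≠ 0 := fun h0 => by simp [h0] at h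
    simp only [weightEta, ne_eq, ite_eq_right_iff, not_forall] at hw
    obtain ⟨hc, -⟩ := hw
    refine ⟨((r + 1 + s) / 6, (r + 1 - s) / 6), ?_⟩
    simp only [φ, Prod.mk.injEq]
    omega
  rw [← hφ.tsum_eq hsupp]
  refine tsum_congr fun ⟨k, l⟩ => ?_
  have hw : weightEta (φ (k, l)) = (Int.negOnePow k : ℤ) * (Int.negOnePow l : ℤ) := by
    simp only [weightEta, φ]
    rw [if_pos (by omega), ← Units.val_mul, ← Int.negOnePow_add]
    rcases Int.even_or_odd (k + l) with h | h
    · rw [Int.negOnePow_even _ h, if_pos (by obtain ⟨m, hm⟩ := h; omega)]; rfl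
    · rw [Int.negOnePow_odd _ h, if_neg (by obtain ⟨m, hm⟩ := h; omega)]; rfl
  rw [hw, mul_mul_mul_comm, ← Complex.exp_add, pairTerm]
  simp only [φ]
  push_cast
  ring_nf

end
end RankMoment

namespace RankMoment
noncomputable section

/-! ### Poisson summation for the product of two eta functions -/

open Filter Topology

/-- Poisson summation for a Gaussian with a complex shift. -/
lemma poisson_gaussian {A : ℝ} (hA : 0 < A) (z : ℂ) :
    ∑' n : ℤ, Complex.exp (2 * Real.pi * Complex.I * n * z - Real.pi * A * n ^ 2) =
      1 / (Real.sqrt A : ℂ) * ∑' d : ℤ, Complex.exp (-Real.pi * (z + d) ^ 2 / A) := by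
  have hA' : (A : ℂ) ≠ 0 := by exact_mod_cast hA.ne'
  have him : 0 < (Complex.I * A).im := by simpa using hA
  have him' : 0 < (-1 / (Complex.I * A)).im := im_neg_one_div_pos him
  have h := jacobiTheta₂_functional_equation z (Complex.I * A)
  rw [← (hasSum_jacobiTheta₂_term _ him).tsum_eq, ← (hasSum_jacobiTheta₂_term _ him').tsum_eq] at h
  have e1 : -Complex.I * (Complex.I * A) = (A : ℂ) := by
    rw [← mul_assoc]; simp
  have e2 : ((A : ℂ)) ^ (1 / 2 : ℂ) = (Real.sqrt A : ℂ) := by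
    rw [Real.sqrt_eq_rpow, Complex.ofReal_cpow hA.le]; norm_num
  rw [e1, e2, mul_assoc, ← tsum_mul_left] at h
  refine Eq.trans (tsum_congr fun n => ?_) (h.trans ?_)
  · rw [jacobiTheta₂_term]
    congr 1
    linear_combination (-(Real.pi * A * n ^ 2)) * Complex.I_sq
  · congr 1
    rw [← (Equiv.neg ℤ).tsum_eq]
    refine tsum_congr fun d => ?_
    rw [jacobiTheta₂_term, ← Complex.exp_add]
    congr 1
    simp only [Equiv.neg_apply, Int.cast_neg]
    field_simp
    ring

/-- `1` if both entries are even, and `-1` otherwise. It is invariant under `SL₂(ℤ)`. -/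
def latticeSign (p : ℤ × ℤ) : ℤ := if p.1 % 2 = 0 ∧ p.2 % 2 = 0 then 1 else -1

/-- The Gaussian `e^{-(3π/2) w w' / Y}` with `w = c τ + d` and `w' = c (τ - 2 i Y) + d`. -/
def gaussTerm (τ : ℂ) (Y : ℝ) (p : ℤ × ℤ) : ℂ :=
  Complex.exp (-(3 * Real.pi / 2) * ((p.1 * τ + p.2) *
    (p.1 * (τ - 2 * Complex.I * Y) + p.2)) / Y)

lemma norm_gaussTerm (τ : ℂ) (Y : ℝ) (p : ℤ × ℤ) : ‖gaussTerm τ Y p‖ =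
    Real.exp (-(3 * Real.pi / 2) * ((p.1 * τ.re + p.2) ^ 2 +
      p.1 ^ 2 * (τ.im * (2 * Y - τ.im))) / Y) := by
  rw [gaussTerm, Complex.norm_exp]
  congr 1
  rw [Complex.div_ofReal_re]
  congr 1
  have : (-(3 * (Real.pi : ℂ) / 2)) = ((-(3 * Real.pi / 2) : ℝ) : ℂ) := by push_cast; ring
  rw [this, Complex.re_ofReal_mul]
  congr 1
  simp [Complex.mul_re]
  ring

/-- A positive definite form in `c x + d` and `c` dominates a multiple of `c² + d²`. -/
lemma exists_le_form (x : ℝ) {A : ℝ} (hA : 0 < A) : ∃ κ : ℝ, 0 < κ ∧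
    ∀ c d : ℝ, κ * (c ^ 2 + d ^ 2) ≤ (c * x + d) ^ 2 + c ^ 2 * A := by
  refine ⟨1 / (2 + (1 + 2 * x ^ 2) / A), by positivity, fun c d => ?_⟩
  rw [div_mul_eq_mul_div, one_mul, div_le_iff₀ (by positivity)]
  have h1 : d ^ 2 ≤ 2 * (c * x + d) ^ 2 + 2 * (c * x) ^ 2 := by
    nlinarith [sq_nonneg (c * x + d + c * x)]
  have h2 : ((c * x + d) ^ 2 + c ^ 2 * A) * (2 + (1 + 2 * x ^ 2) / A) =
      2 * (c * x + d) ^ 2 + c ^ 2 * (1 + 2 * x ^ 2) + (2 * c ^ 2 * A +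
        (c * x + d) ^ 2 * ((1 + 2 * x ^ 2) / A)) := by
    field_simp
    ring
  rw [h2]
  have h3 : 0 ≤ 2 * c ^ 2 * A + (c * x + d) ^ 2 * ((1 + 2 * x ^ 2) / A) := by positivity
  nlinarith

lemma summable_norm_gaussTerm {τ : ℂ} {Y : ℝ} (hτ : 0 < τ.im) (hY : τ.im ≤ Y) :
    Summable fun p => ‖gaussTerm τ Y p‖ := by
  have hY0 : 0 < Y := hτ.trans_le hY
  obtain ⟨κ, hκ, h⟩ := exists_le_form τ.re (A := τ.im * (2 * Y - τ.im))
    (mul_pos hτ (by linarith))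
  refine Summable.of_nonneg_of_le (fun _ => norm_nonneg _) (fun p => ?_)
    (summable_int_gaussian₂ (δ := (3 * Real.pi / 2) * κ / Y) (by have := Real.pi_pos; positivity))
  rw [norm_gaussTerm, Real.exp_le_exp]
  have := h p.1 p.2
  have h2 : 0 ≤ 3 * Real.pi / 2 / Y := by have := Real.pi_pos; positivity
  have h3 := mul_le_mul_of_nonneg_left this h2
  calc _ = -(3 * Real.pi / 2 / Y * (((p.1 : ℝ) * τ.re + p.2) ^ 2 +
            (p.1 : ℝ) ^ 2 * (τ.im * (2 * Y - τ.im)))) := by ring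
    _ ≤ -(3 * Real.pi / 2 / Y * (κ * ((p.1 : ℝ) ^ 2 + (p.2 : ℝ) ^ 2))) := neg_le_neg h3
    _ = _ := by ring

lemma tsum_weightLattice {f : ℤ × ℤ → ℂ} (hf : Summable fun p => ‖f p‖) :
    ∑' p, (weightLattice p : ℂ) * f p =
      (∑' c : ℤ, ∑' s : ℤ, f (6 * c, s)) - ∑' c : ℤ, ∑' s : ℤ, f (3 * c, 2 * s) := by
  let φ : ℤ × ℤ → ℤ × ℤ := fun p => (6 * p.1, p.2)
  let ψ : ℤ × ℤ → ℤ × ℤ := fun p => (3 * p.1, 2 * p.2)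
  have hφ : Function.Injective φ := by
    rintro ⟨a, b⟩ ⟨c, d⟩ h
    simp only [φ, Prod.mk.injEq] at h ⊢
    omega
  have hψ : Function.Injective ψ := by
    rintro ⟨a, b⟩ ⟨c, d⟩ h
    simp only [ψ, Prod.mk.injEq] at h ⊢
    omega
  have s1 := summable_mul_of_bounded hf (fun p => if p.1 % 6 = 0 then 1 else 0)
    (fun p => by split_ifs <;> simp)
  have s2 := summable_mul_of_bounded hf (fun p => if p.1 % 3 = 0 ∧ p.2 % 2 = 0 then 1 else 0)
    (fun p => by split_ifs <;> simp)
  have e : (fun p => (weightLattice p : ℂ) * f p) = fun p =>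
      ((if p.1 % 6 = 0 then 1 else 0 : ℤ) : ℂ) * f p -
      ((if p.1 % 3 = 0 ∧ p.2 % 2 = 0 then 1 else 0 : ℤ) : ℂ) * f p := by
    funext p
    rw [weightLattice, Int.cast_sub, sub_mul]
  rw [e, s1.tsum_sub s2]
  congr 1
  · rw [← Summable.tsum_prod (f := fun p : ℤ × ℤ => f (6 * p.1, p.2))
      ((hf.of_norm).comp_injective hφ), ← hφ.tsum_eq]
    · refine tsum_congr fun p => ?_
      simp [φ]
    · rintro ⟨r, s⟩ h
      have hc : r % 6 = 0 := by
        by_contra hc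
        exact h (by simp only [if_neg hc, Int.cast_zero, zero_mul])
      exact ⟨(r / 6, s), Prod.ext (by simp only [φ]; omega) (by simp only [φ])⟩
  · rw [← Summable.tsum_prod (f := fun p : ℤ × ℤ => f (3 * p.1, 2 * p.2))
      ((hf.of_norm).comp_injective hψ), ← hψ.tsum_eq]
    · refine tsum_congr fun p => ?_
      simp [ψ]
    · rintro ⟨r, s⟩ h
      have hc : r % 3 = 0 ∧ s % 2 = 0 := by
        by_contra hc
        exact h (by simp only [if_neg hc, Int.cast_zero, zero_mul])
      exact ⟨(r / 3, s / 2), Prod.ext (by simp only [ψ]; omega) (by simp only [ψ]; omega)⟩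

lemma tsum_latticeSign {f : ℤ × ℤ → ℂ} (hf : Summable fun p => ‖f p‖) :
    ∑' p, (latticeSign p : ℂ) * f p =
      2 * (∑' c : ℤ, ∑' d : ℤ, f (2 * c, 2 * d)) - ∑' c : ℤ, ∑' d : ℤ, f (c, d) := by
  let φ : ℤ × ℤ → ℤ × ℤ := fun p => (2 * p.1, 2 * p.2)
  have hφ : Function.Injective φ := by
    rintro ⟨a, b⟩ ⟨c, d⟩ h
    simp only [φ, Prod.mk.injEq] at h ⊢
    omega
  have s1 := summable_mul_of_bounded hf (fun p => if p.1 % 2 = 0 ∧ p.2 % 2 = 0 then 1 else 0)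
    (fun p => by split_ifs <;> simp)
  have e : (fun p => (latticeSign p : ℂ) * f p) = fun p =>
      2 * (((if p.1 % 2 = 0 ∧ p.2 % 2 = 0 then 1 else 0 : ℤ) : ℂ) * f p) - f p := by
    funext p
    rw [latticeSign]
    split_ifs <;> push_cast <;> ring
  rw [e, (s1.mul_left 2).tsum_sub hf.of_norm, tsum_mul_left, ← hf.of_norm.tsum_prod]
  congr 2
  rw [← Summable.tsum_prod (f := fun p : ℤ × ℤ => f (2 * p.1, 2 * p.2))
    ((hf.of_norm).comp_injective hφ), ← hφ.tsum_eq]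
  · refine tsum_congr fun p => ?_
    simp [φ]
  · rintro ⟨r, s⟩ h
    have hc : r % 2 = 0 ∧ s % 2 = 0 := by
      by_contra hc
      exact h (by simp only [if_neg hc, Int.cast_zero, zero_mul])
    exact ⟨(r / 2, s / 2), Prod.ext (by simp only [φ]; omega) (by simp only [φ]; omega)⟩

/-- The product of eta at `τ` and at a point of the vertical half-line above `-τ̄`, as a signed
Gaussian sum over `ℤ²`. The sublattice `6ℤ × ℤ` of the double series yields the even pairs `(c, d)`,
and `3ℤ × 2ℤ` yields all pairs. -/
theorem eta_mul_eta {τ : ℂ} {Y : ℝ} (hτ : 0 < τ.im) (hY : τ.im ≤ Y) :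
    4 * (Real.sqrt (Y / 6) : ℂ) * (ModularForm.eta τ *
      ModularForm.eta (-(starRingEnd ℂ τ) + 2 * Complex.I * (Y - τ.im))) =
    ∑' p, (latticeSign p : ℂ) * gaussTerm τ Y p := by
  have hY0 : 0 < Y := hτ.trans_le hY
  have hYC : (Y : ℂ) ≠ 0 := by exact_mod_cast hY0.ne'
  set τ₂ := -(starRingEnd ℂ τ) + 2 * Complex.I * (Y - τ.im) with hτ₂
  have him : 0 < τ₂.im := by
    have : τ₂.im = 2 * Y - τ.im := by simp [hτ₂]; ring
    rw [this]; linarith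
  have hU : τ + τ₂ = 2 * Complex.I * Y := by
    apply Complex.ext <;> simp [hτ₂]
    ring
  have hX : (τ - τ₂) / 2 = τ - Complex.I * Y := by
    linear_combination -hU / 2
  have hf := summable_norm_pairTerm hτ him
  rw [eta_mul_eta_eq_tsum hτ him, tsum_weightEta_eq hf (pairTerm_swap _ _) (pairTerm_neg _ _),
    tsum_weightLattice hf, tsum_latticeSign (summable_norm_gaussTerm hτ hY)]
  set s := Real.sqrt (Y / 6) with hs
  have hs0 : (s : ℂ) ≠ 0 := by
    exact_mod_cast (Real.sqrt_pos.2 (by positivity)).ne'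
  have h4 : Real.sqrt (2 * Y / 3) = 2 * s := by
    rw [show 2 * Y / 3 = 2 ^ 2 * (Y / 6) by ring, Real.sqrt_mul (by norm_num),
      Real.sqrt_sq (by norm_num)]
  have hexp : ∀ r t : ℂ, τ * (r + t) ^ 2 + τ₂ * (r - t) ^ 2 =
      2 * Complex.I * Y * (r ^ 2 + t ^ 2) + 4 * r * t * (τ - Complex.I * Y) := by
    intro r t
    linear_combination (r ^ 2 + t ^ 2) * hU + 4 * r * t * hX
  have hI := Complex.I_sq
  -- Poisson summation in the second variable, for the two sublattices.
  have p1 : ∀ c : ℤ, ∑' t : ℤ, pairTerm τ τ₂ (6 * c, t) =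
      1 / (s : ℂ) * ∑' d : ℤ, gaussTerm τ Y (2 * c, 2 * d) := by
    intro c
    have h := poisson_gaussian (A := Y / 6) (by positivity) (c * (τ - Complex.I * Y))
    have h' := congrArg (fun u => Complex.exp (-6 * Real.pi * Y * c ^ 2) * u) h
    rw [mul_left_comm, ← tsum_mul_left, ← tsum_mul_left] at h'
    refine Eq.trans (tsum_congr fun t => ?_) (h'.trans ?_)
    · rw [pairTerm, ← Complex.exp_add, hexp]
      congr 1
      push_cast
      linear_combination (Real.pi * Y * (6 * c ^ 2 + t ^ 2 / 6)) * hI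
    · congr 1
      refine tsum_congr fun d => ?_
      rw [gaussTerm, ← Complex.exp_add]
      congr 1
      push_cast
      field_simp
      linear_combination (-6 * c ^ 2 * Y ^ 2) * hI
  have p2 : ∀ c : ℤ, ∑' t : ℤ, pairTerm τ τ₂ (3 * c, 2 * t) =
      1 / (2 * (s : ℂ)) * ∑' d : ℤ, gaussTerm τ Y (c, d) := by
    intro c
    have h := poisson_gaussian (A := 2 * Y / 3) (by positivity) (c * (τ - Complex.I * Y))
    rw [h4] at h
    have h' := congrArg (fun u => Complex.exp (-(3 / 2) * Real.pi * Y * c ^ 2) * u) h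
    rw [mul_left_comm, ← tsum_mul_left, ← tsum_mul_left] at h'
    refine Eq.trans (tsum_congr fun t => ?_) (h'.trans ?_)
    · rw [pairTerm, ← Complex.exp_add, hexp]
      congr 1
      push_cast
      linear_combination (Real.pi * Y * (3 / 2 * c ^ 2 + 2 / 3 * t ^ 2)) * hI
    · congr 1
      · push_cast; ring
      refine tsum_congr fun d => ?_
      rw [gaussTerm, ← Complex.exp_add]
      congr 1
      push_cast
      field_simp
      linear_combination (-c ^ 2 * Y ^ 2) * hI
  simp only [p1, p2, tsum_mul_left]
  field_simp
  ring

end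
end RankMoment

namespace RankMoment
noncomputable section

/-! ### The nonholomorphic part as a lattice sum -/

open Filter Topology MeasureTheory

lemma rpow_three_half {s : ℝ} (hs : 0 < s) :
    (s ^ 2 / 2) ^ (3 / 2 : ℝ) = s ^ 3 / (2 * Real.sqrt 2) := by
  have h0 : 0 < s ^ 2 / 2 := by positivity
  rw [show (3 / 2 : ℝ) = 1 + 1 / 2 by norm_num, Real.rpow_add h0, Real.rpow_one,
    ← Real.sqrt_eq_rpow, Real.sqrt_div (by positivity), Real.sqrt_sq hs.le]
  ring

lemma im_mul_coe (z : UpperHalfPlane) : (24 * (z : ℂ)).im = 24 * z.im := by simp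

/-- The substitution `t = (1/v - y)/12`, together with `eta_mul_eta`, turns the period integral
into an integral over `0 < v < 1/y`. -/
lemma calN_mul_eta (z : UpperHalfPlane) {τ : ℂ} (hτ : τ = 24 * (z : ℂ)) :
    calN z * ModularForm.eta τ = 3 / (8 * Real.pi) *
      ∫ v in Set.Ioo (0 : ℝ) (τ.im)⁻¹, ∑' p, (latticeSign p : ℂ) * gaussTerm τ v⁻¹ p := by
  have hy : τ.im = 24 * z.im := by rw [hτ, im_mul_coe]
  have hy0 : 0 < τ.im := by rw [hy]; have := z.im_pos; positivity
  set y := τ.im with hydef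
  let f : ℝ → ℝ := fun v => (v⁻¹ - y) / 12
  have himg : f '' Set.Ioo 0 y⁻¹ = Set.Ioi 0 := by
    ext t
    simp only [Set.mem_image, Set.mem_Ioo, Set.mem_Ioi, f]
    constructor
    · rintro ⟨v, ⟨h0, h1⟩, rfl⟩
      have : y < v⁻¹ := (lt_inv_comm₀ h0 hy0).1 h1
      linarith
    · intro ht
      refine ⟨(12 * t + y)⁻¹, ⟨by positivity, ?_⟩, by rw [inv_inv]; ring⟩
      exact (inv_lt_inv₀ (by positivity) hy0).2 (by linarith)
  have hder : ∀ v ∈ Set.Ioo 0 y⁻¹,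
      HasDerivWithinAt f (-(v ^ 2)⁻¹ / 12) (Set.Ioo 0 y⁻¹) v := fun v hv =>
    (((hasDerivAt_inv hv.1.ne').sub_const y).div_const 12).hasDerivWithinAt
  have hinj : Set.InjOn f (Set.Ioo 0 y⁻¹) := by
    intro a _ b _ h
    simp only [f] at h
    exact inv_injective (by linarith)
  rw [calN, verticalIntegral, ← himg,
    integral_image_eq_integral_abs_deriv_smul measurableSet_Ioo hder hinj, mul_right_comm,
    ← integral_const_mul, ← integral_const_mul]
  refine setIntegral_congr_fun measurableSet_Ioo fun v hv => ?_
  have hv0 : 0 < v := hv.1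
  have hY : y ≤ v⁻¹ := ((lt_inv_comm₀ hv.1 hy0).1 hv.2).le
  rw [← eta_mul_eta hy0 hY]
  set s := Real.sqrt (v⁻¹ / 6) with hs
  have hs0 : 0 < s := Real.sqrt_pos.2 (by positivity)
  have hs2 : v⁻¹ = 6 * s ^ 2 := by
    rw [hs, Real.sq_sqrt (by positivity)]; ring
  have hz : (z : ℂ) - starRingEnd ℂ (z : ℂ) = 2 * Complex.I * ((y : ℂ) / 24) := by
    rw [hy]
    apply Complex.ext <;> simp
    ring
  have hbase : -Complex.I * (-(starRingEnd ℂ) (z : ℂ) + Complex.I * (f v : ℝ) + (z : ℂ)) =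
      ((s ^ 2 / 2 : ℝ) : ℂ) := by
    have hf : f v = s ^ 2 / 2 - y / 12 := by simp only [f]; rw [hs2]; ring
    rw [hf]
    push_cast
    linear_combination (-Complex.I) * hz - (s ^ 2 / 2 : ℂ) * Complex.I_sq
  have harg : 24 * (-(starRingEnd ℂ) (z : ℂ) + Complex.I * (f v : ℝ)) =
      -(starRingEnd ℂ) τ + 2 * Complex.I * (((v⁻¹ : ℝ) : ℂ) - y) := by
    rw [hτ, map_mul, Complex.conj_ofNat]
    simp only [f]
    push_cast
    ring
  have hpow : (((s ^ 2 / 2 : ℝ) : ℂ)) ^ ((3 : ℂ) / 2) = ((s ^ 3 / (2 * Real.sqrt 2) : ℝ) : ℂ) := by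
    rw [← rpow_three_half hs0, Complex.ofReal_cpow (by positivity)]
    norm_num
  have habs : |-(v ^ 2)⁻¹ / 12| = 3 * s ^ 4 := by
    rw [← inv_pow, hs2, neg_div, abs_neg, abs_of_nonneg (by positivity)]
    ring
  rw [hbase, harg, hpow, habs, Complex.real_smul]
  have h2 : ((Real.sqrt 2 : ℝ) : ℂ) ≠ 0 := by
    exact_mod_cast (Real.sqrt_pos.2 (by norm_num : (0 : ℝ) < 2)).ne'
  have hpi : (Real.pi : ℂ) ≠ 0 := by exact_mod_cast Real.pi_ne_zero
  have hsC : (s : ℂ) ≠ 0 := by exact_mod_cast hs0.ne'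
  push_cast
  field_simp
  linear_combination (-16 * ModularForm.eta τ * ModularForm.eta
    (-(starRingEnd ℂ) τ + Complex.I * 2 * (1 / v - y))) * Complex.I_sq

lemma gaussTerm_inv (τ : ℂ) (v : ℝ) (p : ℤ × ℤ) (hv : v ≠ 0) : gaussTerm τ v⁻¹ p =
    Complex.exp (-(3 * Real.pi / 2) * (p.1 * τ + p.2) ^ 2 * v +
      3 * Real.pi * Complex.I * p.1 * (p.1 * τ + p.2)) := by
  rw [gaussTerm]
  congr 1
  have : (v : ℂ) ≠ 0 := by exact_mod_cast hv
  push_cast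
  field_simp
  ring

/-- `∫₀^L e^{-Bv} dv ≤ (L + 1) / (1 + B)`. -/
lemma integral_exp_le {B L : ℝ} (hB : 0 ≤ B) (hL : 0 ≤ L) :
    ∫ v in Set.Ioo 0 L, Real.exp (-B * v) ≤ (L + 1) / (1 + B) := by
  rw [← integral_Ioc_eq_integral_Ioo, ← intervalIntegral.integral_of_le hL]
  have h1 : ∫ v in (0 : ℝ)..L, Real.exp (-B * v) ≤ L := by
    have := intervalIntegral.integral_mono_on (f := fun v => Real.exp (-B * v)) (g := fun _ => 1)
      (a := 0) (b := L) (μ := volume) hL (by apply Continuous.intervalIntegrable; fun_prop)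
      (by simp) (fun v hv => by
        rw [Real.exp_le_one_iff]; nlinarith [hv.1, mul_nonneg hB hv.1])
    simpa using this
  have h2 : B * ∫ v in (0 : ℝ)..L, Real.exp (-B * v) ≤ 1 := by
    rcases hB.eq_or_lt with rfl | hB
    · simp
    · rw [intervalIntegral.integral_comp_mul_left (fun u => Real.exp u) (by linarith), integral_exp]
      have : B * ((-B)⁻¹ • (Real.exp (-B * L) - Real.exp (-B * 0))) =
          1 - Real.exp (-B * L) := by
        simp only [smul_eq_mul, mul_zero, Real.exp_zero]
        field_simp
        ring
      rw [this]
      linarith [Real.exp_pos (-B * L)]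
  rw [le_div_iff₀ (by positivity)]
  linarith

lemma summable_sq_mul_gaussian {α : ℝ} (hα : 0 < α) (x : ℝ) :
    Summable fun c : ℤ => (1 + (c : ℝ) ^ 2 * x ^ 2) * Real.exp (-α * c ^ 2) := by
  refine Summable.of_nonneg_of_le (fun c => by positivity) (fun c => ?_)
    ((summable_int_gaussian (half_pos hα)).mul_left (1 + 2 / α * x ^ 2))
  have h1 : α / 2 * (c : ℝ) ^ 2 ≤ Real.exp (α / 2 * c ^ 2) := by
    linarith [Real.add_one_le_exp (α / 2 * (c : ℝ) ^ 2)]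
  have h0 : 1 ≤ Real.exp (α / 2 * (c : ℝ) ^ 2) := Real.one_le_exp (by positivity)
  have h2 : (c : ℝ) ^ 2 ≤ 2 / α * Real.exp (α / 2 * c ^ 2) := by
    rw [div_mul_eq_mul_div, le_div_iff₀ hα]; linarith
  have h3 : 1 + (c : ℝ) ^ 2 * x ^ 2 ≤ (1 + 2 / α * x ^ 2) * Real.exp (α / 2 * c ^ 2) := by
    nlinarith [mul_le_mul_of_nonneg_right h2 (sq_nonneg x)]
  have h4 : Real.exp (-(α / 2) * (c : ℝ) ^ 2) =
      Real.exp (α / 2 * (c : ℝ) ^ 2) * Real.exp (-α * c ^ 2) := by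
    rw [← Real.exp_add]; ring_nf
  rw [h4, ← mul_assoc]
  gcongr

lemma summable_int_one_div : Summable fun d : ℤ => 1 / (1 + (d : ℝ) ^ 2) := by
  have h := (Real.summable_one_div_int_pow (p := 2)).2 (by norm_num)
  refine Summable.of_norm_bounded_eventually (g := fun d : ℤ => 1 / (d : ℝ) ^ 2) h ?_
  filter_upwards [(Set.finite_singleton (0 : ℤ)).compl_mem_cofinite] with d hd
  have hd' : (0 : ℝ) < (d : ℝ) ^ 2 := by
    have : d ≠ 0 := hd
    positivity
  rw [Real.norm_of_nonneg (by positivity)]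
  exact one_div_le_one_div_of_le hd' (by linarith)

/-- The integrand belonging to `(c, d)` after the substitution. -/
def periodTerm (τ : ℂ) (p : ℤ × ℤ) (v : ℝ) : ℂ :=
  Complex.exp (-(3 * Real.pi / 2) * (p.1 * τ + p.2) ^ 2 * v +
      3 * Real.pi * Complex.I * p.1 * (p.1 * τ + p.2))

lemma continuous_periodTerm (τ : ℂ) (p : ℤ × ℤ) : Continuous (periodTerm τ p) := by
  unfold periodTerm
  fun_prop

lemma integrable_periodTerm (τ : ℂ) (p : ℤ × ℤ) (L : ℝ) :
    IntegrableOn (periodTerm τ p) (Set.Ioo 0 L) :=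
  ((continuous_periodTerm τ p).integrableOn_Icc).mono_set Set.Ioo_subset_Icc_self

lemma norm_periodTerm_le {τ : ℂ} (hτ : 0 < τ.im) (p : ℤ × ℤ) {v : ℝ}
    (hv : v ∈ Set.Ioo 0 (τ.im)⁻¹) : ‖periodTerm τ p v‖ ≤
      Real.exp (-(3 * Real.pi / 2 * τ.im) * p.1 ^ 2) *
        Real.exp (-(3 * Real.pi / 2 * (p.1 * τ.re + p.2) ^ 2) * v) := by
  have hv0 := hv.1
  rw [periodTerm, ← gaussTerm_inv _ _ _ hv0.ne', norm_gaussTerm, ← Real.exp_add, Real.exp_le_exp]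
  have h1 : τ.im * v ≤ 1 := by
    have := mul_le_mul_of_nonneg_left hv.2.le hτ.le
    rwa [mul_inv_cancel₀ hτ.ne'] at this
  have h2 : -(3 * Real.pi / 2) * (((p.1 : ℝ) * τ.re + p.2) ^ 2 +
      (p.1 : ℝ) ^ 2 * (τ.im * (2 * v⁻¹ - τ.im))) / v⁻¹ = -(3 * Real.pi / 2) *
        (((p.1 : ℝ) * τ.re + p.2) ^ 2 * v + (p.1 : ℝ) ^ 2 * τ.im * (2 - τ.im * v)) := by
    field_simp
  rw [h2]
  have h3 : (p.1 : ℝ) ^ 2 * τ.im * 1 ≤ (p.1 : ℝ) ^ 2 * τ.im * (2 - τ.im * v) := by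
    gcongr
    linarith
  have hpi := Real.pi_pos
  nlinarith [mul_le_mul_of_nonneg_left h3 (by positivity : 0 ≤ 3 * Real.pi / 2)]

lemma summable_integral_norm_periodTerm {τ : ℂ} (hτ : 0 < τ.im) :
    Summable fun p : ℤ × ℤ =>
      ∫ v in Set.Ioo (0 : ℝ) (τ.im)⁻¹, ‖(latticeSign p : ℂ) * periodTerm τ p v‖ := by
  have hpi := Real.pi_pos
  have hpi3 := Real.pi_gt_three
  set L := (τ.im)⁻¹ with hLdef
  have hL : 0 ≤ L := by positivity
  have hs := ((summable_sq_mul_gaussian (α := 3 * Real.pi / 2 * τ.im) (by positivity)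
    τ.re).mul_of_nonneg summable_int_one_div (fun c => by positivity)
      (fun d => by positivity)).mul_left (2 * (L + 1))
  refine Summable.of_nonneg_of_le (fun p => integral_nonneg fun v => norm_nonneg _)
    (fun p => ?_) hs
  obtain ⟨c, d⟩ := p
  have hsign : ∀ p, ‖(latticeSign p : ℂ)‖ = 1 := fun p => by
    rw [latticeSign]; split_ifs <;> simp
  set E := Real.exp (-(3 * Real.pi / 2 * τ.im) * (c : ℝ) ^ 2) with hE
  set B := 3 * Real.pi / 2 * ((c : ℝ) * τ.re + d) ^ 2 with hB
  have hB0 : 0 ≤ B := by positivity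
  calc _ ≤ ∫ v in Set.Ioo (0 : ℝ) L, E * Real.exp (-B * v) := by
        refine setIntegral_mono_on ?_ ?_ measurableSet_Ioo fun v hv => ?_
        · exact ((integrable_periodTerm τ (c, d) L).const_mul _).norm
        · exact (Continuous.integrableOn_Icc (by fun_prop)).mono_set Set.Ioo_subset_Icc_self
        · rw [norm_mul, hsign, one_mul]
          exact norm_periodTerm_le hτ (c, d) hv
    _ ≤ E * ((L + 1) / (1 + B)) := by
        rw [integral_const_mul]
        gcongr
        exact integral_exp_le hB0 hL
    _ ≤ E * (2 * (L + 1) * ((1 + (c : ℝ) ^ 2 * τ.re ^ 2) * (1 / (1 + (d : ℝ) ^ 2)))) := by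
        gcongr
        rw [mul_one_div, mul_div_assoc', div_le_div_iff₀ (by positivity) (by positivity)]
        have h1 : 1 + (d : ℝ) ^ 2 ≤ 2 * (1 + (c : ℝ) ^ 2 * τ.re ^ 2) * (1 + B) := by
          have h2 : ((c : ℝ) * τ.re + d) ^ 2 ≤ B := by
            rw [hB]; nlinarith [sq_nonneg ((c : ℝ) * τ.re + d)]
          have h3 : (d : ℝ) ^ 2 ≤ 2 * ((c : ℝ) * τ.re + d) ^ 2 + 2 * ((c : ℝ) * τ.re) ^ 2 := by
            nlinarith [sq_nonneg ((c : ℝ) * τ.re + d + c * τ.re)]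
          have h4 : 0 ≤ (c : ℝ) ^ 2 * τ.re ^ 2 * B := by positivity
          nlinarith
        calc (L + 1) * (1 + (d : ℝ) ^ 2)
            ≤ (L + 1) * (2 * (1 + (c : ℝ) ^ 2 * τ.re ^ 2) * (1 + B)) := by gcongr
          _ = _ := by ring
    _ = _ := by ring

/-- For `(c, d) ≠ (0, 0)` the upper limit `v = 1/y` produces the nonholomorphic Gaussian and the
lower limit `v = 0` the holomorphic term. -/
lemma integral_periodTerm {τ : ℂ} (hτ : 0 < τ.im) (p : ℤ × ℤ) :
    ∫ v in Set.Ioo (0 : ℝ) (τ.im)⁻¹, periodTerm τ p v =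
      (if p = 0 then ((τ.im)⁻¹ : ℂ) else 0) + 2 / (3 * Real.pi) * (((p.1 * τ + p.2) ^ 2)⁻¹ *
        (Complex.exp (3 * Real.pi * Complex.I * p.1 * (p.1 * τ + p.2)) -
          Complex.exp (-(3 * Real.pi / 2) * ‖p.1 * τ + p.2‖ ^ 2 / τ.im))) := by
  obtain ⟨c, d⟩ := p
  have hL : 0 ≤ (τ.im)⁻¹ := by positivity
  have hpi : (Real.pi : ℂ) ≠ 0 := by exact_mod_cast Real.pi_ne_zero
  rw [← integral_Ioc_eq_integral_Ioo, ← intervalIntegral.integral_of_le hL]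
  by_cases h : (c, d) = (0 : ℤ × ℤ)
  · rw [if_pos h]
    simp only [Prod.mk_eq_zero] at h
    simp [periodTerm, h.1, h.2]
  · rw [if_neg h, zero_add]
    have hw : (c : ℂ) * τ + d ≠ 0 := linear_ne_zero (by
      simp only [Prod.mk_eq_zero] at h; tauto) hτ
    have hyC : (τ.im : ℂ) ≠ 0 := by exact_mod_cast hτ.ne'
    simp only [periodTerm, Complex.exp_add]
    rw [intervalIntegral.integral_mul_const, integral_exp_mul_complex (by
      refine mul_ne_zero ?_ (pow_ne_zero 2 hw)
      simp [hpi])]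
    have hconj : ((‖(c : ℂ) * τ + d‖ ^ 2 : ℝ) : ℂ) =
        (c * τ + d) * (c * τ + d - 2 * Complex.I * c * τ.im) := by
      rw [← Complex.normSq_eq_norm_sq, Complex.normSq_eq_conj_mul_self, mul_comm]
      congr 1
      apply Complex.ext <;> simp
      ring
    have hexp : -(3 * Real.pi / 2) * (‖(c : ℂ) * τ + d‖ : ℂ) ^ 2 / τ.im =
        -(3 * Real.pi / 2) * (c * τ + d) ^ 2 * ((τ.im)⁻¹ : ℝ) +
          3 * Real.pi * Complex.I * c * (c * τ + d) := by
      rw [← Complex.ofReal_pow, hconj]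
      push_cast
      field_simp
      ring
    rw [hexp, Complex.exp_add]
    simp only [Complex.ofReal_zero, mul_zero, Complex.exp_zero]
    field_simp
    ring

/-- The nonholomorphic lattice sum `Φ(τ) = ∑ ± (cτ+d)^{-2} e^{-(3π/2)|cτ+d|²/y}`; the sign is
`latticeSign`, and the term of `(0, 0)` vanishes because `0⁻¹ = 0`. -/
def gaussEisensteinTerm (τ : ℂ) (p : ℤ × ℤ) : ℂ :=
  (latticeSign p : ℂ) * (((p.1 * τ + p.2) ^ 2)⁻¹ *
    Complex.exp (-(3 * Real.pi / 2) * ‖p.1 * τ + p.2‖ ^ 2 / τ.im))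

/-- The term of the holomorphic lattice sum; again it vanishes at `(0, 0)`. -/
def holEisensteinTerm (τ : ℂ) (p : ℤ × ℤ) : ℂ :=
  (latticeSign p : ℂ) * (((p.1 * τ + p.2) ^ 2)⁻¹ *
    Complex.exp (3 * Real.pi * Complex.I * p.1 * (p.1 * τ + p.2)))

lemma norm_latticeSign (p : ℤ × ℤ) : ‖(latticeSign p : ℂ)‖ = 1 := by
  rw [latticeSign]; split_ifs <;> simp

lemma norm_linear_sq (τ : ℂ) (c d : ℤ) :
    ‖(c : ℂ) * τ + d‖ ^ 2 = (c * τ.re + d) ^ 2 + c ^ 2 * τ.im ^ 2 := by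
  rw [← Complex.normSq_eq_norm_sq, Complex.normSq_apply]
  simp
  ring

lemma norm_gaussEisensteinTerm (τ : ℂ) (p : ℤ × ℤ) : ‖gaussEisensteinTerm τ p‖ =
    (‖p.1 * τ + p.2‖ ^ 2)⁻¹ * Real.exp (-(3 * Real.pi / 2) * ‖p.1 * τ + p.2‖ ^ 2 / τ.im) := by
  rw [gaussEisensteinTerm, norm_mul, norm_latticeSign, one_mul, norm_mul, norm_inv, norm_pow,
    Complex.norm_exp]
  congr 2
  have : -(3 * Real.pi / 2) * (‖(p.1 : ℂ) * τ + p.2‖ : ℂ) ^ 2 / τ.im =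
    ((-(3 * Real.pi / 2) * ‖(p.1 : ℂ) * τ + p.2‖ ^ 2 / τ.im : ℝ) : ℂ) := by push_cast; ring
  rw [this, Complex.ofReal_re]

lemma summable_gaussEisensteinTerm {τ : ℂ} (hτ : 0 < τ.im) :
    Summable fun p => ‖gaussEisensteinTerm τ p‖ := by
  have hpi := Real.pi_pos
  obtain ⟨κ, hκ, h⟩ := exists_le_form τ.re (A := τ.im ^ 2) (by positivity)
  refine Summable.of_nonneg_of_le (fun _ => norm_nonneg _) (fun p => ?_)
    ((summable_int_gaussian₂ (δ := (3 * Real.pi / 2) * κ / τ.im) (by positivity)).mul_left κ⁻¹)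
  obtain ⟨c, d⟩ := p
  rw [norm_gaussEisensteinTerm]
  have h1 := h c d
  rw [← norm_linear_sq] at h1
  by_cases h0 : (c, d) = (0 : ℤ × ℤ)
  · simp only [Prod.mk_eq_zero] at h0
    simp [h0.1, h0.2, hκ.le]
  gcongr
  · have : (1 : ℝ) ≤ (c : ℝ) ^ 2 + (d : ℝ) ^ 2 := by
      have : c ≠ 0 ∨ d ≠ 0 := by simp only [Prod.mk_eq_zero] at h0; tauto
      have h3 : 1 ≤ c ^ 2 + d ^ 2 := by
        rcases this with h | h
        · nlinarith [sq_nonneg d, Int.one_le_abs h, sq_abs c, abs_nonneg c]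
        · nlinarith [sq_nonneg c, Int.one_le_abs h, sq_abs d, abs_nonneg d]
      exact_mod_cast h3
    simp only
    nlinarith
  · have h2 : 0 ≤ 3 * Real.pi / 2 / τ.im := by positivity
    have h3 := mul_le_mul_of_nonneg_left h1 h2
    calc _ = -(3 * Real.pi / 2 / τ.im * ‖(c : ℂ) * τ + d‖ ^ 2) := by ring
      _ ≤ -(3 * Real.pi / 2 / τ.im * (κ * ((c : ℝ) ^ 2 + (d : ℝ) ^ 2))) := neg_le_neg h3
      _ = _ := by ring

/-- The nonholomorphic part times `η`, by integrating the lattice sum term by term. The pair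
`(0, 0)` contributes the term in `1/y`. -/
theorem calN_mul_eta_eq (z : UpperHalfPlane) {τ : ℂ} (hτ : τ = 24 * (z : ℂ)) :
    Summable (holEisensteinTerm τ) ∧
    calN z * ModularForm.eta τ = 3 / (8 * Real.pi * τ.im) +
      ((∑' p, holEisensteinTerm τ p) - ∑' p, gaussEisensteinTerm τ p) / (4 * Real.pi ^ 2) := by
  have hy0 : 0 < τ.im := by rw [hτ, im_mul_coe]; have := z.im_pos; positivity
  have hpi : (Real.pi : ℂ) ≠ 0 := by exact_mod_cast Real.pi_ne_zero
  have hyC : (τ.im : ℂ) ≠ 0 := by exact_mod_cast hy0.ne'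
  have hmain := hasSum_integral_of_summable_integral_norm
    (F := fun p v => (latticeSign p : ℂ) * periodTerm τ p v)
    (fun p => (integrable_periodTerm τ p (τ.im)⁻¹).const_mul _)
    (summable_integral_norm_periodTerm hy0)
  simp only [integral_const_mul, integral_periodTerm hy0] at hmain
  have hg := (summable_gaussEisensteinTerm hy0).of_norm
  have h0 : HasSum (fun p : ℤ × ℤ => if p = 0 then ((τ.im)⁻¹ : ℂ) else 0) (τ.im)⁻¹ :=
    hasSum_ite_eq _ _
  have e : (fun p : ℤ × ℤ => (3 * Real.pi / 2 : ℂ) * ((latticeSign p : ℂ) *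
      ((if p = 0 then ((τ.im)⁻¹ : ℂ) else 0) + 2 / (3 * Real.pi) * (((p.1 * τ + p.2) ^ 2)⁻¹ *
        (Complex.exp (3 * Real.pi * Complex.I * p.1 * (p.1 * τ + p.2)) -
          Complex.exp (-(3 * Real.pi / 2) * ‖p.1 * τ + p.2‖ ^ 2 / τ.im)))) -
      (if p = 0 then ((τ.im)⁻¹ : ℂ) else 0)) + gaussEisensteinTerm τ p) = holEisensteinTerm τ := by
    funext p
    have hs : (latticeSign p : ℂ) * (if p = 0 then ((τ.im)⁻¹ : ℂ) else 0) =
        if p = 0 then ((τ.im)⁻¹ : ℂ) else 0 := by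
      split_ifs with h
      · rw [h]; simp [latticeSign]
      · simp
    rw [mul_add, hs, gaussEisensteinTerm, holEisensteinTerm]
    field_simp
    ring
  have hH := ((hmain.sub h0).mul_left (3 * Real.pi / 2 : ℂ)).add hg.hasSum
  rw [e] at hH
  refine ⟨hH.summable, ?_⟩
  have hI : ∫ v in Set.Ioo (0 : ℝ) (τ.im)⁻¹, ∑' p, (latticeSign p : ℂ) * gaussTerm τ v⁻¹ p =
      ∫ v in Set.Ioo (0 : ℝ) (τ.im)⁻¹, ∑' p, (latticeSign p : ℂ) * periodTerm τ p v :=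
    setIntegral_congr_fun measurableSet_Ioo fun v hv =>
      tsum_congr fun p => by rw [gaussTerm_inv _ _ _ hv.1.ne', periodTerm]
  rw [calN_mul_eta z hτ, hI, hH.tsum_eq]
  field_simp
  ring

end
end RankMoment

namespace RankMoment
noncomputable section

/-! ### The holomorphic lattice sum -/

open Filter Topology

lemma summable_inv_sq (z : ℂ) : Summable fun d : ℤ => ((z + d) ^ 2)⁻¹ := by
  have h := EisensteinSeries.linear_right_summable z 1 (k := 2) (by norm_num)
  refine h.congr fun d => ?_
  rw [Int.cast_one, one_mul]
  norm_cast

/-- An alternating sum over `ℤ` in terms of the even part and the full sum. -/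
lemma tsum_negOnePow {g : ℤ → ℂ} (hg : Summable g) (hg2 : Summable fun m : ℤ => g (2 * m)) :
    ∑' d : ℤ, ((Int.negOnePow d : ℤ) : ℂ) * g d = 2 * ∑' m : ℤ, g (2 * m) - ∑' d : ℤ, g d := by
  have hφ : Function.Injective fun m : ℤ => 2 * m := fun a b h => by
    simp only at h; omega
  have h2 : HasSum (fun d : ℤ => if d % 2 = 0 then g d else 0) (∑' m : ℤ, g (2 * m)) := by
    rw [← hφ.hasSum_iff]
    · have e : (fun d : ℤ => if d % 2 = 0 then g d else 0) ∘ (fun m : ℤ => 2 * m) =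
          fun m => g (2 * m) := by funext m; simp
      rw [e]
      exact hg2.hasSum
    · intro d hd
      rw [if_neg]
      exact fun h => hd ⟨d / 2, by simp only; omega⟩
  have h := (h2.mul_left 2).sub hg.hasSum
  rw [← h.tsum_eq]
  refine tsum_congr fun d => ?_
  rcases Int.even_or_odd d with hd | hd
  · rw [if_pos (Int.even_iff.1 hd), Int.negOnePow_even _ hd]; simp; ring
  · rw [if_neg (by rw [Int.odd_iff.1 hd]; norm_num), Int.negOnePow_odd _ hd]; simp

/-- The alternating Lipschitz formula. -/
lemma tsum_negOnePow_inv_sq {z : ℂ} (hz : 0 < z.im) :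
    ∑' d : ℤ, ((Int.negOnePow d : ℤ) : ℂ) * ((z + d) ^ 2)⁻¹ =
      -2 * Real.pi ^ 2 * ∑' M : ℕ, (2 * (M : ℂ) + 1) *
        Complex.exp (Real.pi * Complex.I * z) ^ (2 * M + 1) := by
  have hz2 : 0 < (z / 2).im := by simpa using hz
  have L : ∀ w : ℂ, 0 < w.im → ∑' d : ℤ, ((w + d) ^ 2)⁻¹ =
      -4 * Real.pi ^ 2 * ∑' n : ℕ, (n : ℂ) * Complex.exp (2 * Real.pi * Complex.I * w) ^ n := by
    intro w hw
    have h := EisensteinSeries.qExpansion_identity (k := 1) le_rfl ⟨w, hw⟩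
    simp only [one_div, Nat.factorial_one, Nat.cast_one, div_one, pow_one,
      Nat.reduceAdd] at h
    rw [h]
    linear_combination (4 * Real.pi ^ 2 * ∑' n : ℕ, (n : ℂ) *
      Complex.exp (2 * Real.pi * Complex.I * w) ^ n) * Complex.I_sq
  set x := Complex.exp (Real.pi * Complex.I * z) with hx
  have hxn : ‖x‖ < 1 := by
    have := norm_exp_lt_one hz2
    rwa [show 2 * Real.pi * Complex.I * (z / 2) = Real.pi * Complex.I * z by ring] at this
  have hs : Summable fun n : ℕ => (n : ℂ) * x ^ n := by
    simpa using summable_pow_mul_geometric_of_norm_lt_one 1 hxn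
  have hinj : Function.Injective fun m : ℕ => 2 * m := fun a b h => by
    simp only at h; omega
  have hinj' : Function.Injective fun m : ℕ => 2 * m + 1 := fun a b h => by
    simp only at h; omega
  have hsplit := tsum_even_add_odd (f := fun n : ℕ => (n : ℂ) * x ^ n)
    (hs.comp_injective hinj) (hs.comp_injective hinj')
  have hx2 : Complex.exp (2 * Real.pi * Complex.I * z) = x ^ 2 := by
    rw [hx, ← Complex.exp_nat_mul]; congr 1; push_cast; ring
  have hg : ∀ m : ℤ, ((z + (2 * m : ℤ)) ^ 2)⁻¹ = 1 / 4 * ((z / 2 + m) ^ 2)⁻¹ := by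
    intro m
    rw [show z + ((2 * m : ℤ) : ℂ) = 2 * (z / 2 + m) by push_cast; ring, mul_pow, mul_inv]
    norm_num
  rw [tsum_negOnePow (summable_inv_sq z)
    (by simp only [hg]; exact (summable_inv_sq (z / 2)).mul_left _)]
  simp only [hg]
  rw [tsum_mul_left, L z hz, L _ hz2, show 2 * Real.pi * Complex.I * (z / 2) =
    Real.pi * Complex.I * z by ring, ← hx, ← hsplit, hx2]
  have e : ∑' k : ℕ, ((2 * k : ℕ) : ℂ) * x ^ (2 * k) = 2 * ∑' n : ℕ, (n : ℂ) * (x ^ 2) ^ n := by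
    rw [← tsum_mul_left]
    refine tsum_congr fun n => ?_
    rw [pow_mul]; push_cast; ring
  rw [e]
  push_cast
  ring

lemma tsum_negOnePow_inv_sq_zero :
    ∑' d : ℤ, ((Int.negOnePow d : ℤ) : ℂ) * ((d : ℂ) ^ 2)⁻¹ = -(Real.pi ^ 2 / 6) := by
  have hs : Summable fun d : ℤ => ((d : ℂ) ^ 2)⁻¹ := by
    simpa using summable_inv_sq 0
  have hg : ∀ m : ℤ, (((2 * m : ℤ) : ℂ) ^ 2)⁻¹ = 1 / 4 * ((m : ℂ) ^ 2)⁻¹ := by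
    intro m
    push_cast
    rw [mul_pow, mul_inv]
    norm_num
  have hz := two_mul_riemannZeta_eq_tsum_int_inv_pow_of_even (k := 2) le_rfl even_two
  rw [Nat.cast_two, riemannZeta_two] at hz
  rw [tsum_negOnePow hs (by simp only [hg]; exact hs.mul_left _)]
  simp only [hg]
  rw [tsum_mul_left, ← hz]
  ring

/-- The sign separates into a sign of `c` and one of `d`, so that the sum over `d` is alternating. -/
lemma latticeSign_mul_exp (c d : ℤ) : (latticeSign (c, d) : ℂ) *
    Complex.exp (3 * Real.pi * Complex.I * c * d) =
      ((Int.negOnePow c : ℤ) : ℂ) * ((Int.negOnePow d : ℤ) : ℂ) := by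
  have key : Complex.exp (3 * Real.pi * Complex.I * c * d) =
      ((Int.negOnePow (c * d) : ℤ) : ℂ) := by
    have h3 : ((3 * (c * d) : ℤ) : ℂ) * (Real.pi * Complex.I) = 3 * Real.pi * Complex.I * c * d := by
      push_cast; ring
    rw [← h3, Complex.exp_int_mul, Complex.exp_pi_mul_I]
    rcases Int.even_or_odd (c * d) with h | h
    · rw [Int.negOnePow_even _ h, (h.mul_left 3).neg_one_zpow]; simp
    · rw [Int.negOnePow_odd _ h, ((by decide : Odd (3 : ℤ)).mul h).neg_one_zpow]; simp
  rw [key, latticeSign]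
  rcases Int.even_or_odd c with hc | hc <;> rcases Int.even_or_odd d with hd | hd
  · rw [if_pos ⟨Int.even_iff.1 hc, Int.even_iff.1 hd⟩, Int.negOnePow_even _ hc,
      Int.negOnePow_even _ hd, Int.negOnePow_even _ (hc.mul_right d)]
    simp
  · rw [if_neg (fun h => by have := Int.odd_iff.1 hd; omega), Int.negOnePow_even _ hc,
      Int.negOnePow_odd _ hd, Int.negOnePow_even _ (hc.mul_right d)]
    simp
  · rw [if_neg (fun h => by have := Int.odd_iff.1 hc; omega), Int.negOnePow_odd _ hc,
      Int.negOnePow_even _ hd, Int.negOnePow_even _ (hd.mul_left c)]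
    simp
  · rw [if_neg (fun h => by have := Int.odd_iff.1 hc; omega), Int.negOnePow_odd _ hc,
      Int.negOnePow_odd _ hd, Int.negOnePow_odd _ (hc.mul hd)]
    simp

lemma holEisensteinTerm_eq (τ : ℂ) (c d : ℤ) : holEisensteinTerm τ (c, d) =
    ((Int.negOnePow c : ℤ) : ℂ) * Complex.exp (3 * Real.pi * Complex.I * c ^ 2 * τ) *
      (((Int.negOnePow d : ℤ) : ℂ) * ((c * τ + d) ^ 2)⁻¹) := by
  have h := latticeSign_mul_exp c d
  rw [holEisensteinTerm, show 3 * Real.pi * Complex.I * c * (c * τ + d) =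
    3 * Real.pi * Complex.I * c * d + 3 * Real.pi * Complex.I * c ^ 2 * τ by ring, Complex.exp_add]
  linear_combination (((c * τ + d) ^ 2)⁻¹ * Complex.exp (3 * Real.pi * Complex.I * c ^ 2 * τ)) * h

lemma holEisensteinTerm_neg (τ : ℂ) (p : ℤ × ℤ) :
    holEisensteinTerm τ (-p) = holEisensteinTerm τ p := by
  obtain ⟨c, d⟩ := p
  rw [Prod.neg_mk, holEisensteinTerm_eq, holEisensteinTerm_eq, Int.negOnePow_neg, Int.negOnePow_neg]
  push_cast
  rw [← neg_sq (c * τ + d)]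
  ring_nf

/-- The holomorphic lattice sum is, up to an affine transformation, the Lambert-type series of the
second rank moment. -/
theorem tsum_holEisensteinTerm {τ : ℂ} (hτ : 0 < τ.im) (hs : Summable (holEisensteinTerm τ)) :
    ∑' p, holEisensteinTerm τ p = 4 * Real.pi ^ 2 *
      (eulerProd (Complex.exp (2 * Real.pi * Complex.I * τ)) *
        R2 (Complex.exp (2 * Real.pi * Complex.I * τ))) - Real.pi ^ 2 / 6 := by
  set x := Complex.exp (Real.pi * Complex.I * τ) with hx
  have hq : Complex.exp (2 * Real.pi * Complex.I * τ) = x ^ 2 := by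
    rw [hx, ← Complex.exp_nat_mul]; congr 1; push_cast; ring
  have hrow : ∀ j : ℕ, ∑' d : ℤ, holEisensteinTerm τ ((j : ℤ) + 1, d) =
      2 * Real.pi ^ 2 * ((-1) ^ j * ∑' M : ℕ, (2 * (M : ℂ) + 1) * (x ^ 2) ^ rankExp (j + 1) M) := by
    intro j
    have him : 0 < ((((j : ℤ) + 1 : ℤ) : ℂ) * τ).im := by
      rw [← Complex.ofReal_intCast, Complex.im_ofReal_mul]
      have : (0 : ℝ) < (((j : ℤ) + 1 : ℤ) : ℝ) := by push_cast; positivity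
      positivity
    simp only [holEisensteinTerm_eq]
    rw [tsum_mul_left, tsum_negOnePow_inv_sq him]
    have hsgn : ((Int.negOnePow ((j : ℤ) + 1) : ℤ) : ℂ) = -(-1) ^ j := by
      rw [Int.negOnePow_succ]
      simp [Int.negOnePow_def]
    have e : ∀ M : ℕ, (x ^ 2) ^ rankExp (j + 1) M =
        Complex.exp (3 * Real.pi * Complex.I * (((j : ℤ) + 1 : ℤ) : ℂ) ^ 2 * τ) *
        Complex.exp (Real.pi * Complex.I * ((((j : ℤ) + 1 : ℤ) : ℂ) * τ)) ^ (2 * M + 1) := by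
      intro M
      rw [← pow_mul, two_mul_rankExp, hx, ← Complex.exp_nat_mul, ← Complex.exp_nat_mul,
        ← Complex.exp_add]
      congr 1
      push_cast
      ring
    simp only [e]
    rw [hsgn]
    simp only [mul_left_comm _ (Complex.exp (3 * Real.pi * Complex.I *
      (((j : ℤ) + 1 : ℤ) : ℂ) ^ 2 * τ)), tsum_mul_left]
    ring
  have hzero : ∑' d : ℤ, holEisensteinTerm τ (0, d) = -(Real.pi ^ 2 / 6) := by
    rw [← tsum_negOnePow_inv_sq_zero]
    refine tsum_congr fun d => ?_
    rw [holEisensteinTerm_eq]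
    simp
  have heven : Function.Even fun c : ℤ => ∑' d : ℤ, holEisensteinTerm τ (c, d) := by
    intro c
    simp only
    rw [← (Equiv.neg ℤ).tsum_eq]
    refine tsum_congr fun d => ?_
    exact holEisensteinTerm_neg τ (c, d)
  rw [hs.tsum_prod, tsum_int_eq_zero_add_two_mul_tsum_pnat heven hs.prod, hzero,
    tsum_pnat_eq_tsum_succ (f := fun n : ℕ => ∑' d : ℤ, holEisensteinTerm τ ((n : ℤ), d))]
  push_cast
  simp only [hrow]
  rw [tsum_mul_left, hq, eulerProd_mul_R2 (by rw [← hq]; exact norm_exp_lt_one hτ)]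
  ring

/-- The completed generating function times `η` is a combination of the Gaussian lattice sum, of
`E₂` and of `1/y`. -/
theorem calM_mul_eta (z : UpperHalfPlane) {τ : ℂ} (hτ : τ = 24 * (z : ℂ)) :
    calM z * ModularForm.eta τ = (∑' p, gaussEisensteinTerm τ p) / (4 * Real.pi ^ 2) +
      E2 τ / 8 - 3 / (8 * Real.pi * τ.im) := by
  have hy0 : 0 < τ.im := by rw [hτ, im_mul_coe]; have := z.im_pos; positivity
  have hpi : (Real.pi : ℂ) ≠ 0 := by exact_mod_cast Real.pi_ne_zero
  have hyC : (τ.im : ℂ) ≠ 0 := by exact_mod_cast hy0.ne'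
  have heta : ModularForm.eta τ ≠ 0 := ModularForm.eta_ne_zero hy0
  obtain ⟨hs, hN⟩ := calN_mul_eta_eq z hτ
  have hR : calR z * ModularForm.eta τ = eulerProd (Complex.exp (2 * Real.pi * Complex.I * τ)) *
      R2 (Complex.exp (2 * Real.pi * Complex.I * τ)) := by
    rw [calR, eta_eq_eulerProd, ← hτ]
    have : Complex.exp (-(2 * Real.pi * Complex.I * z)) *
        Complex.exp (2 * Real.pi * Complex.I * τ / 24) = 1 := by
      rw [← Complex.exp_add, hτ, Complex.exp_eq_one_iff]
      exact ⟨0, by push_cast; ring⟩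
    linear_combination (eulerProd (Complex.exp (2 * Real.pi * Complex.I * τ)) *
      R2 (Complex.exp (2 * Real.pi * Complex.I * τ))) * this
  rw [tsum_holEisensteinTerm hy0 hs] at hN
  have : calM z * ModularForm.eta τ = calR z * ModularForm.eta τ - calN z * ModularForm.eta τ -
      1 / 24 + E2 τ / 8 := by
    rw [calM, ← hτ]
    field_simp
  rw [this, hR, hN]
  field_simp
  ring

end
end RankMoment

namespace RankMoment
noncomputable section

/-! ### Modular transformations -/

open Filter Topology

/-- The weight `2` nonholomorphic modular form for `SL₂(ℤ)` obtained by multiplying the completed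
generating function by `η`. -/
def weightTwoForm (τ : ℂ) : ℂ :=
  (∑' p, gaussEisensteinTerm τ p) / (4 * Real.pi ^ 2) + E2 τ / 8 - 3 / (8 * Real.pi * τ.im)

lemma det_int (γ : SL(2, ℤ)) : γ 0 0 * γ 1 1 - γ 0 1 * γ 1 0 = 1 := by
  have := γ.det_coe
  rwa [Matrix.det_fin_two] at this

lemma coe_smul_int (γ : SL(2, ℤ)) (z : UpperHalfPlane) : ((γ • z : UpperHalfPlane) : ℂ) =
    ((γ 0 0 : ℂ) * z + (γ 0 1 : ℂ)) / ((γ 1 0 : ℂ) * z + (γ 1 1 : ℂ)) := by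
  rw [UpperHalfPlane.coe_specialLinearGroup_apply]
  simp

lemma denom_int (γ : SL(2, ℤ)) (z : UpperHalfPlane) :
    UpperHalfPlane.denom γ z = (γ 1 0 : ℂ) * z + (γ 1 1 : ℂ) :=
  ModularGroup.denom_apply γ z

lemma denom_int_ne_zero (γ : SL(2, ℤ)) {z : ℂ} (hz : 0 < z.im) :
    (γ 1 0 : ℂ) * z + (γ 1 1 : ℂ) ≠ 0 := by
  refine linear_ne_zero ?_ hz
  by_contra! h
  have := det_int γ
  rw [h.1, h.2] at this
  simp at this

lemma im_smul_int (γ : SL(2, ℤ)) (z : UpperHalfPlane) : ((γ • z : UpperHalfPlane) : ℂ).im =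
    z.im / ‖(γ 1 0 : ℂ) * z + (γ 1 1 : ℂ)‖ ^ 2 := by
  rw [UpperHalfPlane.coe_im, ModularGroup.im_smul_eq_div_normSq, denom_int,
    Complex.normSq_eq_norm_sq]

/-- Right multiplication by an element of `SL₂(ℤ)` on integral row vectors. -/
def rowEquiv (γ : SL(2, ℤ)) : ℤ × ℤ ≃ ℤ × ℤ where
  toFun p := (p.1 * γ 0 0 + p.2 * γ 1 0, p.1 * γ 0 1 + p.2 * γ 1 1)
  invFun p := (p.1 * γ 1 1 - p.2 * γ 1 0, -(p.1 * γ 0 1) + p.2 * γ 0 0)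
  left_inv p := by
    have := det_int γ
    refine Prod.ext ?_ ?_ <;> simp only
    · linear_combination p.1 * this
    · linear_combination p.2 * this
  right_inv p := by
    have := det_int γ
    refine Prod.ext ?_ ?_ <;> simp only
    · linear_combination p.1 * this
    · linear_combination p.2 * this

lemma latticeSign_rowEquiv (γ : SL(2, ℤ)) (p : ℤ × ℤ) :
    latticeSign (rowEquiv γ p) = latticeSign p := by
  have key : ∀ (e : ℤ × ℤ ≃ ℤ × ℤ) (a b c d : ℤ), (∀ p, e p = (p.1 * a + p.2 * b,
      p.1 * c + p.2 * d)) → ∀ p : ℤ × ℤ, p.1 % 2 = 0 ∧ p.2 % 2 = 0 →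
      (e p).1 % 2 = 0 ∧ (e p).2 % 2 = 0 := by
    intro e a b c d he p hp
    obtain ⟨m, hm⟩ := Int.dvd_of_emod_eq_zero hp.1
    obtain ⟨n, hn⟩ := Int.dvd_of_emod_eq_zero hp.2
    rw [he, hm, hn]
    constructor <;> apply Int.emod_eq_zero_of_dvd
    · exact ⟨m * a + n * b, by ring⟩
    · exact ⟨m * c + n * d, by ring⟩
  have h : ((rowEquiv γ p).1 % 2 = 0 ∧ (rowEquiv γ p).2 % 2 = 0) ↔ (p.1 % 2 = 0 ∧ p.2 % 2 = 0) := by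
    constructor
    · intro h
      have := key (rowEquiv γ).symm (γ 1 1) (-γ 1 0) (-γ 0 1) (γ 0 0) (fun p => by
        refine Prod.ext ?_ ?_ <;> simp only [rowEquiv, Equiv.coe_fn_symm_mk] <;> ring) _ h
      simpa using this
    · exact key (rowEquiv γ) _ _ _ _ (fun p => rfl) p
  simp only [latticeSign, h]

lemma gaussEisensteinTerm_smul (γ : SL(2, ℤ)) (z : UpperHalfPlane) (p : ℤ × ℤ) :
    gaussEisensteinTerm ((γ • z : UpperHalfPlane) : ℂ) p =
      ((γ 1 0 : ℂ) * z + (γ 1 1 : ℂ)) ^ 2 * gaussEisensteinTerm (z : ℂ) (rowEquiv γ p) := by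
  have hj := denom_int_ne_zero γ z.im_pos
  have hw : (p.1 : ℂ) * ((γ • z : UpperHalfPlane) : ℂ) + p.2 =
      (((rowEquiv γ p).1 : ℂ) * z + (rowEquiv γ p).2) / ((γ 1 0 : ℂ) * z + (γ 1 1 : ℂ)) := by
    rw [coe_smul_int, eq_div_iff hj, add_mul, mul_assoc, div_mul_cancel₀ _ hj]
    simp only [rowEquiv, Equiv.coe_fn_mk]
    push_cast
    ring
  rw [gaussEisensteinTerm, gaussEisensteinTerm, latticeSign_rowEquiv, hw, im_smul_int]
  have hn : ((‖(γ 1 0 : ℂ) * z + (γ 1 1 : ℂ)‖ : ℝ) : ℂ) ≠ 0 := by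
    exact_mod_cast (norm_pos_iff.2 hj).ne'
  have hy : ((z.im : ℝ) : ℂ) ≠ 0 := by exact_mod_cast z.im_pos.ne'
  have hexp : -(3 * Real.pi / 2) *
      ((‖(((rowEquiv γ p).1 : ℂ) * z + (rowEquiv γ p).2) /
        ((γ 1 0 : ℂ) * z + (γ 1 1 : ℂ))‖ : ℝ) : ℂ) ^ 2 /
        ((z.im / ‖(γ 1 0 : ℂ) * z + (γ 1 1 : ℂ)‖ ^ 2 : ℝ) : ℂ) =
      -(3 * Real.pi / 2) * ((‖((rowEquiv γ p).1 : ℂ) * z + (rowEquiv γ p).2‖ : ℝ) : ℂ) ^ 2 /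
        ((z : ℂ).im : ℂ) := by
    rw [norm_div, UpperHalfPlane.coe_im]
    generalize ‖(γ 1 0 : ℂ) * z + (γ 1 1 : ℂ)‖ = N at hn ⊢
    push_cast
    field_simp
  rw [hexp, div_pow, inv_div]
  ring

lemma E2_smul (γ : SL(2, ℤ)) (z : UpperHalfPlane) : E2 ((γ • z : UpperHalfPlane) : ℂ) =
    ((γ 1 0 : ℂ) * z + (γ 1 1 : ℂ)) ^ 2 * E2 (z : ℂ) -
      6 * Complex.I * (γ 1 0 : ℂ) / Real.pi * ((γ 1 0 : ℂ) * z + (γ 1 1 : ℂ)) := by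
  have hj := denom_int_ne_zero γ z.im_pos
  have hpi : (Real.pi : ℂ) ≠ 0 := by exact_mod_cast Real.pi_ne_zero
  have h := congrFun (EisensteinSeries.E2_slash_action γ) z
  rw [ModularForm.SL_slash_apply, Pi.sub_apply, Pi.smul_apply, EisensteinSeries.D2, denom_int,
    riemannZeta_two, smul_eq_mul, ← E2_coe, ← E2_coe] at h
  set j := (γ 1 0 : ℂ) * z + (γ 1 1 : ℂ)
  have h2 : E2 ((γ • z : UpperHalfPlane) : ℂ) = (E2 (z : ℂ) -
      1 / (2 * (Real.pi ^ 2 / 6)) * (2 * Real.pi * Complex.I * (γ 1 0 : ℂ) / j)) * j ^ 2 := by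
    rw [← h, zpow_neg, mul_assoc]
    norm_cast
    rw [inv_mul_cancel₀ (pow_ne_zero 2 hj), mul_one]
  rw [h2]
  field_simp

/-- The lattice sum is invariant because `SL₂(ℤ)` permutes the pairs `(c, d)`, and the
combination `E₂ - 3/(πy)` is the modular completion of `E₂`. -/
theorem weightTwoForm_smul (γ : SL(2, ℤ)) (z : UpperHalfPlane) :
    weightTwoForm ((γ • z : UpperHalfPlane) : ℂ) =
      ((γ 1 0 : ℂ) * z + (γ 1 1 : ℂ)) ^ 2 * weightTwoForm (z : ℂ) := by
  have hj := denom_int_ne_zero γ z.im_pos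
  have hpi : (Real.pi : ℂ) ≠ 0 := by exact_mod_cast Real.pi_ne_zero
  have hy : ((z.im : ℝ) : ℂ) ≠ 0 := by exact_mod_cast z.im_pos.ne'
  have hsum : ∑' p, gaussEisensteinTerm ((γ • z : UpperHalfPlane) : ℂ) p =
      ((γ 1 0 : ℂ) * z + (γ 1 1 : ℂ)) ^ 2 * ∑' p, gaussEisensteinTerm (z : ℂ) p := by
    simp only [gaussEisensteinTerm_smul]
    rw [tsum_mul_left, (rowEquiv γ).tsum_eq]
  have hnorm : ((‖(γ 1 0 : ℂ) * z + (γ 1 1 : ℂ)‖ ^ 2 : ℝ) : ℂ) =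
      ((γ 1 0 : ℂ) * z + (γ 1 1 : ℂ)) *
        ((γ 1 0 : ℂ) * z + (γ 1 1 : ℂ) - 2 * Complex.I * (γ 1 0 : ℂ) * z.im) := by
    rw [← Complex.normSq_eq_norm_sq, Complex.normSq_eq_conj_mul_self, mul_comm]
    congr 1
    apply Complex.ext <;> simp
    ring
  rw [weightTwoForm, weightTwoForm, hsum, E2_smul, im_smul_int, UpperHalfPlane.coe_im,
    Complex.ofReal_div, hnorm]
  field_simp
  ring

lemma weightTwoForm_eq (z : UpperHalfPlane) {τ : ℂ} (hτ : τ = 24 * (z : ℂ)) :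
    calM z * ModularForm.eta τ = weightTwoForm τ :=
  calM_mul_eta z hτ

lemma extSymbol_mul_self {c d : ℤ} (h : IsCoprime c d) : (extSymbol c d : ℂ) * extSymbol c d = 1 := by
  have hg : c.gcd (d.natAbs : ℕ) = 1 := by
    have := Int.isCoprime_iff_gcd_eq_one.1 h
    rwa [Int.gcd, Int.natAbs_natCast]
  have h1 : extSymbol c d ^ 2 = 1 := by
    rw [extSymbol]
    split_ifs
    · rw [neg_sq, jacobiSym.sq_one hg]
    · exact jacobiSym.sq_one hg
  have : ((extSymbol c d : ℂ)) ^ 2 = 1 := by exact_mod_cast h1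
  rw [← sq, this]

lemma eps_pow_four (d : ℤ) : eps d ^ 4 = 1 := by
  rw [eps]; split_ifs <;> simp

lemma chi12_mul_self {d : ℤ} (h : IsUnit (d : ZMod 12)) :
    chi12 (d : ZMod 12) * chi12 (d : ZMod 12) = 1 := by
  have key : ∀ a : ZMod 12, IsUnit a → chi12Int a * chi12Int a = 1 := by decide
  have := key _ h
  rw [chi12, MulChar.ringHomComp_apply, ← map_mul, this, map_one]

/-- The transformation law of the completed generating function: weight `2` divided by the weight
`1/2` law of `η(24 z)`, whose multiplier is a fourth root of unity built from self-inverse symbols. -/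
theorem calM_transform (A : SL(2, ℤ)) (hA : A ∈ CongruenceSubgroup.Gamma0 576)
    (z : UpperHalfPlane) :
    calM (A • z) = (extSymbol (A 1 0) (A 1 1) : ℂ) ^ (3 : ℤ) * eps (A 1 1) ^ (-3 : ℤ) *
      chi12 ((A 1 1 : ℤ) : ZMod 12) *
      (((A 1 0 : ℤ) : ℂ) * (z : ℂ) + ((A 1 1 : ℤ) : ℂ)) ^ ((3 : ℂ) / 2) * calM z := by
  have hdet := det_int A
  have hc : (576 : ℤ) ∣ A 1 0 := by
    rw [CongruenceSubgroup.Gamma0_mem] at hA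
    exact (ZMod.intCast_zmod_eq_zero_iff_dvd _ 576).1 hA
  obtain ⟨k, hk⟩ := hc
  set c := A 1 0 with hcdef
  set d := A 1 1 with hddef
  have hj := denom_int_ne_zero A z.im_pos
  rw [← hcdef, ← hddef] at hj
  have him : 0 < (24 * (z : ℂ)).im := by rw [im_mul_coe]; have := z.im_pos; positivity
  -- `γ` is the conjugate of `A` by `z ↦ 24 z`; it is integral since `24 ∣ c`.
  let γ : SL(2, ℤ) := ⟨!![A 0 0, 24 * A 0 1; 24 * k, d], by
    rw [Matrix.det_fin_two_of]
    linear_combination hdet + A 0 1 * hk⟩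
  let w : UpperHalfPlane := ⟨24 * (z : ℂ), him⟩
  have hγj : (γ 1 0 : ℂ) * (w : ℂ) + (γ 1 1 : ℂ) = (c : ℂ) * z + d := by
    simp only [γ, w, Matrix.of_apply, Matrix.cons_val', Matrix.cons_val_zero,
      Matrix.cons_val_one, Matrix.cons_val_fin_one]
    rw [hk]
    push_cast
    ring
  have hγ : ((γ • w : UpperHalfPlane) : ℂ) = 24 * ((A • z : UpperHalfPlane) : ℂ) := by
    rw [coe_smul_int, hγj, coe_smul_int, ← hcdef, ← hddef]
    simp only [γ, w, Matrix.of_apply, Matrix.cons_val', Matrix.cons_val_zero,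
      Matrix.cons_val_one, Matrix.cons_val_fin_one]
    push_cast
    ring
  have heta0 : ModularForm.eta (24 * (z : ℂ)) ≠ 0 := ModularForm.eta_ne_zero him
  have him' : 0 < (24 * ((A • z : UpperHalfPlane) : ℂ)).im := by
    rw [im_mul_coe]; have := (A • z).im_pos; positivity
  have heta1 : ModularForm.eta (24 * ((A • z : UpperHalfPlane) : ℂ)) ≠ 0 :=
    ModularForm.eta_ne_zero him'
  have h1 := weightTwoForm_eq (A • z) (τ := ((γ • w : UpperHalfPlane) : ℂ)) hγ
  rw [weightTwoForm_smul, hγj, ← weightTwoForm_eq z (τ := (w : ℂ)) rfl, hγ] at h1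
  have hw : (w : ℂ) = 24 * z := rfl
  rw [hw] at h1
  have hE : ModularForm.eta (24 * ((A • z : UpperHalfPlane) : ℂ)) = extSymbol c d * (eps d)⁻¹ *
      chi12 (d : ZMod 12) * ((c : ℂ) * z + d) ^ (1 / 2 : ℂ) * ModularForm.eta (24 * (z : ℂ)) := by
    rw [coe_smul_int]
    exact eta_transform_Gamma0 (a := A 0 0) (b := A 0 1) hdet ⟨k, hk⟩ z.im_pos
  have hcop : IsCoprime c d := ⟨-A 0 1, A 0 0, by linear_combination hdet⟩
  have hunit : IsUnit (d : ZMod 12) := by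
    refine IsUnit.of_mul_eq_one ((A 0 0 : ℤ) : ZMod 12) ?_
    have h0 : ((c : ℤ) : ZMod 12) = 0 :=
      (ZMod.intCast_zmod_eq_zero_iff_dvd _ 12).2 ⟨48 * k, by rw [hk]; push_cast; ring⟩
    have := congrArg (Int.cast : ℤ → ZMod 12) hdet
    push_cast at this
    rw [h0] at this
    linear_combination this
  have he1 := extSymbol_mul_self hcop
  have he2 := eps_pow_four d
  have he3 := chi12_mul_self hunit
  have he0 : eps d ≠ 0 := fun h => by rw [h] at he2; norm_num at he2
  have hp : ((c : ℂ) * z + d) ^ ((3 : ℂ) / 2) * ((c : ℂ) * z + d) ^ (1 / 2 : ℂ) =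
      ((c : ℂ) * z + d) ^ 2 := by
    rw [← Complex.cpow_add _ _ hj, show (3 : ℂ) / 2 + 1 / 2 = (2 : ℕ) by norm_num,
      Complex.cpow_natCast]
  apply mul_right_cancel₀ heta1
  rw [h1, hE, ← hp]
  have hz3 : eps d ^ (-3 : ℤ) = eps d := by
    rw [zpow_neg, inv_eq_iff_eq_inv]
    norm_cast
    exact eq_inv_of_mul_eq_one_left (by linear_combination he2)
  have he4 : eps d * (eps d)⁻¹ = 1 := mul_inv_cancel₀ he0
  have hx3 : (extSymbol c d : ℂ) ^ (3 : ℤ) = extSymbol c d := by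
    norm_cast
    have : (extSymbol c d) ^ 3 = extSymbol c d := by
      have h : (extSymbol c d) * (extSymbol c d) = 1 := by exact_mod_cast he1
      linear_combination extSymbol c d * h
    exact this
  rw [hz3, hx3]
  set P := ((c : ℂ) * z + d) ^ ((3 : ℂ) / 2)
  set Q := ((c : ℂ) * z + d) ^ (1 / 2 : ℂ)
  set X := chi12 (d : ZMod 12)
  set s := (extSymbol c d : ℂ)
  set e := eps d
  set E := ModularForm.eta (24 * (z : ℂ))
  calc P * Q * (calM z * E) = (s * s) * (e * e⁻¹) * (X * X) * P * Q * (calM z * E) := by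
        rw [he1, he3, he4]; ring
    _ = _ := by ring

end
end RankMoment

namespace RankMoment
noncomputable section

/-! ### Growth at the cusps -/

open Filter Topology

lemma weightTwoForm_int_add (z : UpperHalfPlane) (n : ℤ) :
    weightTwoForm ((z : ℂ) + n) = weightTwoForm (z : ℂ) := by
  have h := weightTwoForm_smul (ModularGroup.T ^ n) z
  rw [coe_smul_int, ModularGroup.coe_T_zpow] at h
  simpa using h

lemma norm_gaussEisensteinTerm_le {τ : ℂ} (hx : |τ.re| ≤ 1 / 2) (hy : 1 ≤ τ.im) (p : ℤ × ℤ) :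
    ‖gaussEisensteinTerm τ p‖ ≤
      τ.im * (16 * (1 / (1 + (p.1 : ℝ) ^ 2) * (1 / (1 + (p.2 : ℝ) ^ 2)))) := by
  obtain ⟨c, d⟩ := p
  have hy0 : 0 < τ.im := by linarith
  have hpi := Real.pi_gt_three
  rw [norm_gaussEisensteinTerm]
  simp only
  by_cases h0 : (c, d) = (0 : ℤ × ℤ)
  · simp only [Prod.mk_eq_zero] at h0
    simp [h0.1, h0.2, hy0.le]
  set N := ‖(c : ℂ) * τ + d‖ ^ 2 with hN
  set s := (c : ℝ) ^ 2 + (d : ℝ) ^ 2 with hs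
  have hs1 : (1 : ℝ) ≤ s := by
    have : c ≠ 0 ∨ d ≠ 0 := by simp only [Prod.mk_eq_zero] at h0; tauto
    have h3 : 1 ≤ c ^ 2 + d ^ 2 := by
      rcases this with h | h
      · nlinarith [sq_nonneg d, Int.one_le_abs h, sq_abs c, abs_nonneg c]
      · nlinarith [sq_nonneg c, Int.one_le_abs h, sq_abs d, abs_nonneg d]
    rw [hs]
    exact_mod_cast h3
  have hNs : s ≤ 2 * N := by
    rw [hN, norm_linear_sq]
    have h1 : (d : ℝ) ^ 2 ≤ 2 * ((c : ℝ) * τ.re + d) ^ 2 + 2 * ((c : ℝ) * τ.re) ^ 2 := by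
      nlinarith [sq_nonneg ((c : ℝ) * τ.re + d + c * τ.re)]
    have h2 : τ.re ^ 2 ≤ 1 / 4 := by
      rw [← sq_abs]; nlinarith [abs_nonneg τ.re]
    have h3 : ((c : ℝ) * τ.re) ^ 2 ≤ (c : ℝ) ^ 2 * (1 / 4) := by
      rw [mul_pow]; gcongr
    have h4 : (c : ℝ) ^ 2 * 1 ≤ (c : ℝ) ^ 2 * τ.im ^ 2 := by
      gcongr; nlinarith
    nlinarith
  have hN0 : 0 < N := by linarith
  -- `e^{-t} ≤ 1/t` makes the sum over the lattice converge
  have hexp : Real.exp (-(3 * Real.pi / 2) * N / τ.im) ≤ τ.im / N := by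
    set t := 3 * Real.pi / 2 * N / τ.im with ht
    have h1 : N / τ.im ≤ t := by
      rw [ht]; gcongr; nlinarith
    have h2 : t ≤ Real.exp t := by linarith [Real.add_one_le_exp t]
    rw [show -(3 * Real.pi / 2) * N / τ.im = -t by rw [ht]; ring, Real.exp_neg, inv_le_comm₀
      (Real.exp_pos _) (by positivity), inv_div]
    exact h1.trans h2
  have hprod : (1 + (c : ℝ) ^ 2) * (1 + (d : ℝ) ^ 2) ≤ 16 * N ^ 2 := by
    have h1 : (1 + (c : ℝ) ^ 2) * (1 + (d : ℝ) ^ 2) ≤ (1 + s) * (1 + s) := by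
      gcongr <;> rw [hs] <;> nlinarith [sq_nonneg (c : ℝ), sq_nonneg (d : ℝ)]
    nlinarith
  calc N⁻¹ * Real.exp (-(3 * Real.pi / 2) * N / τ.im) ≤ N⁻¹ * (τ.im / N) := by gcongr
    _ = τ.im * (1 / N ^ 2) := by field_simp
    _ ≤ τ.im * (16 / ((1 + (c : ℝ) ^ 2) * (1 + (d : ℝ) ^ 2))) := by
        refine mul_le_mul_of_nonneg_left ?_ hy0.le
        rw [div_le_div_iff₀ (by positivity) (by positivity)]
        linarith
    _ = _ := by field_simp

/-- The weight `2` form is of exponential growth at infinity (in fact it grows at most linearly),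
uniformly in the real part. -/
lemma exists_weightTwoForm_le : ∃ A C : ℝ, 0 ≤ C ∧ ∀ z : UpperHalfPlane, A ≤ z.im →
    ‖weightTwoForm (z : ℂ)‖ ≤ C * Real.exp z.im := by
  have hs : Summable fun p : ℤ × ℤ => 16 * (1 / (1 + (p.1 : ℝ) ^ 2) * (1 / (1 + (p.2 : ℝ) ^ 2))) :=
    (summable_int_one_div.mul_of_nonneg summable_int_one_div (fun c => by positivity)
      (fun d => by positivity)).mul_left 16
  set K := ∑' p : ℤ × ℤ, 16 * (1 / (1 + (p.1 : ℝ) ^ 2) * (1 / (1 + (p.2 : ℝ) ^ 2))) with hK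
  have hK0 : 0 ≤ K := tsum_nonneg fun p => by positivity
  obtain ⟨M, A, hE⟩ := UpperHalfPlane.isBoundedAtImInfty_iff.1 EisensteinSeries.isBoundedAtImInfty_E2
  have hM0 : 0 ≤ |M| := abs_nonneg M
  refine ⟨max A 1, K + |M| + 1, by positivity, fun z hz => ?_⟩
  -- translate the real part into `[-1/2, 1/2]`
  set n : ℤ := -round z.re with hn
  have him : 0 < ((z : ℂ) + n).im := by simpa using z.im_pos
  let w : UpperHalfPlane := ⟨(z : ℂ) + n, him⟩
  have hwim : w.im = z.im := by
    change ((z : ℂ) + n).im = z.im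
    simp
  have hwre : |((w : ℂ)).re| ≤ 1 / 2 := by
    have : ((w : ℂ)).re = z.re - round z.re := by
      change ((z : ℂ) + n).re = _
      rw [hn]; simp; ring
    rw [this]
    exact abs_sub_round z.re
  have hw1 : 1 ≤ ((w : ℂ)).im := by
    rw [UpperHalfPlane.coe_im, hwim]; exact (le_max_right _ _).trans hz
  have hwA : A ≤ w.im := by rw [hwim]; exact (le_max_left _ _).trans hz
  rw [← weightTwoForm_int_add z n]
  change ‖weightTwoForm (w : ℂ)‖ ≤ _
  rw [← hwim]
  have h1 : ‖∑' p, gaussEisensteinTerm (w : ℂ) p‖ ≤ w.im * K := by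
    rw [hK, ← tsum_mul_left]
    exact tsum_of_norm_bounded (hs.mul_left _).hasSum
      (fun p => norm_gaussEisensteinTerm_le hwre hw1 p)
  have h2 : ‖E2 (w : ℂ)‖ ≤ |M| := by
    rw [E2_coe]; exact (hE w hwA).trans (le_abs_self M)
  have hpi := Real.pi_gt_three
  rw [UpperHalfPlane.coe_im] at hw1
  have h3 : ‖(3 : ℂ) / (8 * Real.pi * ((w : ℂ).im : ℂ))‖ ≤ 1 := by
    rw [norm_div, norm_mul, norm_mul, Complex.norm_real, Complex.norm_real, UpperHalfPlane.coe_im,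
      Real.norm_of_nonneg (by positivity), Real.norm_of_nonneg (by positivity)]
    norm_num
    rw [div_le_one (by positivity)]
    nlinarith
  have h4 : ‖(∑' p, gaussEisensteinTerm (w : ℂ) p) / (4 * Real.pi ^ 2)‖ ≤ w.im * K := by
    rw [norm_div]
    refine (div_le_self (norm_nonneg _) ?_).trans h1
    rw [norm_mul, norm_pow, Complex.norm_real, Real.norm_of_nonneg (by positivity)]
    norm_num
    nlinarith
  have h5 : ‖E2 (w : ℂ) / 8‖ ≤ |M| := by
    rw [norm_div]
    exact (div_le_self (norm_nonneg _) (by norm_num)).trans h2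
  have h6 : w.im ≤ Real.exp w.im := by linarith [Real.add_one_le_exp w.im]
  have h7 : 1 ≤ Real.exp w.im := by linarith
  rw [weightTwoForm]
  calc _ ≤ w.im * K + |M| + 1 := by
        refine (norm_sub_le _ _).trans (add_le_add ((norm_add_le _ _).trans (add_le_add h4 h5)) h3)
    _ ≤ Real.exp w.im * K + |M| * Real.exp w.im + Real.exp w.im := by
        gcongr
        nlinarith
    _ = _ := by ring

/-- From the growth of the discriminant `Δ = η²⁴`. The exponent is not sharp. -/
lemma exists_norm_inv_eta_le : ∃ A C : ℝ, 0 ≤ C ∧ ∀ z : UpperHalfPlane, A ≤ z.im →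
    ‖(ModularForm.eta (z : ℂ))⁻¹‖ ≤ C * Real.exp (2 * Real.pi * z.im) := by
  obtain ⟨C, hC⟩ := ModularForm.exp_isBigO_discriminant.bound
  obtain ⟨A, hA⟩ := (UpperHalfPlane.atImInfty_mem _).1 hC
  refine ⟨A, max C 1, by positivity, fun z hz => ?_⟩
  have h := hA z hz
  simp only [Set.mem_ofPred_eq] at h
  have h0 : ModularForm.eta (z : ℂ) ≠ 0 := ModularForm.eta_ne_zero z.im_pos
  have hn : 0 < ‖ModularForm.eta (z : ℂ)‖ := norm_pos_iff.2 h0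
  rw [ModularForm.discriminant, norm_pow, Real.norm_of_nonneg (Real.exp_pos _).le] at h
  rw [norm_inv]
  set u := ‖ModularForm.eta (z : ℂ)‖
  set M := max C 1 * Real.exp (2 * Real.pi * z.im) with hM
  have hM1 : 1 ≤ M := by
    have h1 : (1 : ℝ) ≤ Real.exp (2 * Real.pi * z.im) :=
      Real.one_le_exp (by have := Real.pi_pos; have := z.im_pos; positivity)
    rw [hM]
    nlinarith [le_max_right C 1]
  by_contra! hlt
  have h1 : M ^ 24 < (u⁻¹) ^ 24 := pow_lt_pow_left₀ hlt (by linarith) (by norm_num)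
  have h2 : M ≤ M ^ 24 := le_self_pow₀ hM1 (by norm_num)
  have h3 : (u⁻¹) ^ 24 ≤ M := by
    rw [inv_pow, inv_le_iff_one_le_mul₀ (by positivity), hM]
    have h4 : Real.exp (-2 * Real.pi * z.im) * Real.exp (2 * Real.pi * z.im) = 1 := by
      rw [← Real.exp_add]; simp
    have h5 : Real.exp (-2 * Real.pi * z.im) ≤ max C 1 * u ^ 24 := h.trans (by gcongr; exact le_max_left _ _)
    have h6 := mul_le_mul_of_nonneg_right h5 (Real.exp_pos (2 * Real.pi * z.im)).le
    rw [h4] at h6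
    linarith
  linarith

/-- From the modularity of `Δ = η²⁴`, without reference to the multiplier of `η`. -/
lemma norm_eta_smul (γ : SL(2, ℤ)) (z : UpperHalfPlane) :
    ‖ModularForm.eta ((γ • z : UpperHalfPlane) : ℂ)‖ ^ 2 =
      ‖(γ 1 0 : ℂ) * z + (γ 1 1 : ℂ)‖ * ‖ModularForm.eta (z : ℂ)‖ ^ 2 := by
  have h := congrFun (SlashInvariantForm.slash_action_generators_SL2Z
    ModularForm.discriminant_S_invariant ModularForm.discriminant_T_invariant γ) z
  have hj := denom_int_ne_zero γ z.im_pos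
  rw [ModularForm.SL_slash_apply, denom_int, ModularForm.discriminant, ModularForm.discriminant,
    zpow_neg, ← div_eq_mul_inv, div_eq_iff (zpow_ne_zero _ hj)] at h
  have h2 := congrArg norm h
  rw [norm_mul, norm_pow, norm_pow, norm_zpow] at h2
  refine (pow_left_inj₀ (by positivity) (by positivity) (show 12 ≠ 0 by norm_num)).1 ?_
  rw [mul_pow, ← pow_mul, ← pow_mul, h2]
  norm_cast
  ring

/-- An integral matrix of determinant `24` is an element of `SL₂(ℤ)` times an upper triangular
matrix. Here this is applied to `24 B z`, so that the behaviour of a function at the cusp `B ∞`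
is reduced to that of a modular form at `∞`. -/
lemma exists_smul_eq (B : SL(2, ℤ)) : ∃ (γ : SL(2, ℤ)) (g : ℝ), 0 < g ∧
    ∀ z : UpperHalfPlane, ∃ w : UpperHalfPlane, w.im = g ^ 2 * z.im / 24 ∧
      ((γ • w : UpperHalfPlane) : ℂ) = 24 * ((B • z : UpperHalfPlane) : ℂ) ∧
      (γ 1 0 : ℂ) * w + (γ 1 1 : ℂ) = ((B 1 0 : ℂ) * z + (B 1 1 : ℂ)) * (g / 24) := by
  have hdet := det_int B
  set a := B 0 0 with ha
  set b := B 0 1 with hb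
  set c := B 1 0 with hc
  set d := B 1 1 with hd
  have h0 : 24 * a ≠ 0 ∨ c ≠ 0 := by
    by_contra! h
    have ha0 : a = 0 := by omega
    rw [ha0, h.2] at hdet
    simp at hdet
  set g : ℤ := (Int.gcd (24 * a) c : ℤ) with hg
  have hgpos : 0 < g := by
    rw [hg]
    exact_mod_cast Int.gcd_pos_iff.2 h0
  obtain ⟨a', ha'⟩ : g ∣ 24 * a := Int.gcd_dvd_left ..
  obtain ⟨c', hc'⟩ : g ∣ c := Int.gcd_dvd_right ..
  have hbez := Int.gcd_eq_gcd_ab (24 * a) c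
  rw [← hg] at hbez
  set u := Int.gcdA (24 * a) c
  set v := Int.gcdB (24 * a) c
  have hdet' : a' * u + c' * v = 1 := by
    apply mul_left_cancel₀ hgpos.ne'
    linear_combination -hbez - u * ha' - v * hc'
  let γ : SL(2, ℤ) := ⟨!![a', -v; c', u], by
    rw [Matrix.det_fin_two_of]; linear_combination hdet'⟩
  set β : ℤ := 24 * u * b + v * d with hβ
  have hgR : (0 : ℝ) < g := by exact_mod_cast hgpos
  have hgC : (g : ℂ) ≠ 0 := by exact_mod_cast hgpos.ne'
  refine ⟨γ, g, hgR, fun z => ?_⟩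
  have hexp : ((g : ℂ) * ((g : ℂ) * z + β) / 24) = ((g ^ 2 / 24 : ℝ) : ℂ) * z +
      ((g * β / 24 : ℝ) : ℂ) := by push_cast; ring
  have him : ((g : ℂ) * ((g : ℂ) * z + β) / 24).im = g ^ 2 * z.im / 24 := by
    rw [hexp, Complex.add_im, Complex.im_ofReal_mul, Complex.ofReal_im, UpperHalfPlane.coe_im]
    ring
  have hpos : 0 < ((g : ℂ) * ((g : ℂ) * z + β) / 24).im := by
    rw [him]; have := z.im_pos; positivity
  let w : UpperHalfPlane := ⟨_, hpos⟩
  have hw : (w : ℂ) = (g : ℂ) * ((g : ℂ) * z + β) / 24 := rfl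
  have hdetC : (a : ℂ) * d - b * c = 1 := by exact_mod_cast hdet
  have hbezC : (g : ℂ) = 24 * a * u + c * v := by exact_mod_cast hbez
  have haC : (24 : ℂ) * a = g * a' := by exact_mod_cast ha'
  have hcC : (c : ℂ) = g * c' := by exact_mod_cast hc'
  have hβC : (β : ℂ) = 24 * u * b + v * d := by rw [hβ]; push_cast; ring
  have hden : (γ 1 0 : ℂ) * w + (γ 1 1 : ℂ) = ((c : ℂ) * z + d) * (g / 24) := by
    simp only [γ, Matrix.of_apply, Matrix.cons_val', Matrix.cons_val_zero,
      Matrix.cons_val_one, Matrix.cons_val_fin_one]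
    rw [hw]
    linear_combination (-(g * z + β) / 24 : ℂ) * hcC + c / 24 * hβC - d / 24 * hbezC - u * hdetC
  have hnum : (γ 0 0 : ℂ) * w + (γ 0 1 : ℂ) = 24 * ((a : ℂ) * z + b) * (g / 24) := by
    simp only [γ, Matrix.of_apply, Matrix.cons_val', Matrix.cons_val_zero,
      Matrix.cons_val_one, Matrix.cons_val_fin_one]
    rw [hw]
    push_cast
    linear_combination (-(g * z + β) / 24 : ℂ) * haC + a * hβC - b * hbezC + v * hdetC
  have hj := denom_int_ne_zero B z.im_pos
  refine ⟨w, him, ?_, ?_⟩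
  · rw [coe_smul_int, hden, hnum, coe_smul_int, ← ha, ← hb, ← hc, ← hd]
    rw [← hc, ← hd] at hj
    field_simp
  · rw [hden]
    push_cast
    rfl

/-- With `24 B z = γ w` as in `exists_smul_eq`, the function is, up to factors of known modulus,
the quotient of the weight `2` form by `η` at `w`. -/
theorem calM_growth (B : SL(2, ℤ)) : ∃ C : ℝ,
    (fun z : UpperHalfPlane =>
      (((B 1 0 : ℤ) : ℂ) * (z : ℂ) + ((B 1 1 : ℤ) : ℂ)) ^ (-((3 : ℂ) / 2)) * calM (B • z))
    =O[UpperHalfPlane.atImInfty] (fun z : UpperHalfPlane => Real.exp (C * z.im)) := by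
  obtain ⟨γ, g, hg, hB⟩ := exists_smul_eq B
  obtain ⟨A₁, C₁, hC₁, hF⟩ := exists_weightTwoForm_le
  obtain ⟨A₂, C₂, hC₂, hE⟩ := exists_norm_inv_eta_le
  refine ⟨(1 + 2 * Real.pi) * (g ^ 2 / 24), ?_⟩
  set r := Real.sqrt (g / 24) with hr
  have hr0 : 0 < r := Real.sqrt_pos.2 (by positivity)
  have hr2 : g / 24 = r ^ 2 := by rw [hr, Real.sq_sqrt (by positivity)]
  refine Asymptotics.IsBigO.of_bound (r ^ 3 * (C₁ * C₂)) ?_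
  refine (UpperHalfPlane.atImInfty_mem _).2 ⟨max A₁ A₂ * (24 / g ^ 2), fun z hz => ?_⟩
  rw [Set.mem_ofPred_eq]
  obtain ⟨w, hwim, hw, hwj⟩ := hB z
  have hwA : max A₁ A₂ ≤ w.im := by
    rw [hwim]
    rw [mul_div_assoc', div_le_iff₀ (by positivity)] at hz
    linarith
  have hj := denom_int_ne_zero B z.im_pos
  set j := (B 1 0 : ℂ) * z + (B 1 1 : ℂ) with hjdef
  set t := Real.sqrt ‖j‖ with ht
  have ht0 : 0 < t := Real.sqrt_pos.2 (norm_pos_iff.2 hj)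
  have ht2 : ‖j‖ = t ^ 2 := by rw [ht, Real.sq_sqrt (norm_nonneg _)]
  have hpow : ‖j ^ (-((3 : ℂ) / 2))‖ = (t ^ 3)⁻¹ := by
    rw [show (-((3 : ℂ) / 2)) = ((-(3 / 2) : ℝ) : ℂ) by push_cast; ring, Complex.norm_cpow_real,
      ht2, Real.rpow_neg (by positivity), ← Real.rpow_natCast t 2, ← Real.rpow_mul ht0.le,
      ← Real.rpow_natCast t 3]
    norm_num
  have hJ : ‖j * (g / 24)‖ = t ^ 2 * r ^ 2 := by
    rw [norm_mul, ht2, ← hr2, ← Complex.ofReal_ofNat, ← Complex.ofReal_div, Complex.norm_real,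
      Real.norm_of_nonneg (by positivity)]
  have heta := norm_eta_smul γ w
  rw [hwj, hJ, hw] at heta
  have heta' : ‖ModularForm.eta (24 * ((B • z : UpperHalfPlane) : ℂ))‖ =
      t * r * ‖ModularForm.eta (w : ℂ)‖ := by
    refine (pow_left_inj₀ (by positivity) (by positivity) (show 2 ≠ 0 by norm_num)).1 ?_
    rw [heta]; ring
  have hM := weightTwoForm_eq (B • z) hw
  rw [weightTwoForm_smul, hwj, hw] at hM
  have hM' := congrArg norm hM
  rw [norm_mul, norm_mul, norm_pow, hJ, heta'] at hM'
  have he0 : 0 < ‖ModularForm.eta (w : ℂ)‖ := norm_pos_iff.2 (ModularForm.eta_ne_zero w.im_pos)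
  have hval : (t ^ 3)⁻¹ * ‖calM (B • z)‖ =
      r ^ 3 * (‖weightTwoForm (w : ℂ)‖ * ‖(ModularForm.eta (w : ℂ))⁻¹‖) := by
    have : ‖calM (B • z)‖ =
        (t ^ 2 * r ^ 2) ^ 2 * ‖weightTwoForm (w : ℂ)‖ / (t * r * ‖ModularForm.eta (w : ℂ)‖) := by
      rw [← hM']; field_simp
    rw [this, norm_inv]
    field_simp
  rw [norm_mul, hpow, hval, Real.norm_of_nonneg (Real.exp_pos _).le, mul_assoc (r ^ 3)]
  refine mul_le_mul_of_nonneg_left ?_ (by positivity)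
  calc _ ≤ (C₁ * Real.exp w.im) * (C₂ * Real.exp (2 * Real.pi * w.im)) :=
        mul_le_mul (hF w ((le_max_left _ _).trans hwA)) (hE w ((le_max_right _ _).trans hwA))
          (norm_nonneg _) (by positivity)
    _ = C₁ * C₂ * Real.exp ((1 + 2 * Real.pi) * (g ^ 2 / 24) * z.im) := by
        rw [mul_mul_mul_comm, ← Real.exp_add, hwim]
        ring_nf

end
end RankMoment

namespace RankMoment
noncomputable section

/-! ### Smoothness of period integrals -/

open Filter Topology MeasureTheory Set

/-- Holomorphic functions on the upper half-plane that are bounded on each `{Im ≥ ε}`. -/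
structure HolBounded (G : ℂ → ℂ) : Prop where
  diff : DifferentiableOn ℂ G {z : ℂ | 0 < z.im}
  bound : ∀ ε > 0, ∃ M : ℝ, 0 ≤ M ∧ ∀ z : ℂ, ε ≤ z.im → ‖G z‖ ≤ M

lemma isOpen_im_pos : IsOpen {z : ℂ | 0 < z.im} := isOpen_lt continuous_const Complex.continuous_im

/-- By Cauchy's estimate, the class is closed under differentiation. -/
lemma HolBounded.deriv {G : ℂ → ℂ} (hG : HolBounded G) : HolBounded (deriv G) where
  diff := hG.diff.deriv isOpen_im_pos
  bound ε hε := by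
    obtain ⟨M, hM0, hM⟩ := hG.bound (ε / 2) (by positivity)
    refine ⟨M / (ε / 2), by positivity, fun z hz => ?_⟩
    have him : ∀ w ∈ Metric.closedBall z (ε / 2), ε / 2 ≤ w.im := by
      intro w hw
      have h1 : |(w - z).im| ≤ ε / 2 :=
        (Complex.abs_im_le_norm _).trans (by rwa [← dist_eq_norm, ← Metric.mem_closedBall])
      rw [Complex.sub_im] at h1
      linarith [(abs_le.1 h1).1]
    refine Complex.norm_deriv_le_of_forall_mem_sphere_norm_le (by positivity) ?_ fun w hw =>
      hM w (him w (Metric.sphere_subset_closedBall hw))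
    refine (hG.diff.mono fun w hw => ?_).diffContOnCl_ball (U := {w : ℂ | 0 < w.im}) fun w hw => ?_
    · exact hw
    · exact lt_of_lt_of_le (by positivity) (him w hw)

/-- The domain `{Im u > 0, Re s > 0}` of the period integrals. -/
def periodDomain : Set (ℂ × ℂ) := {p | 0 < p.1.im ∧ 0 < p.2.re}

lemma isOpen_periodDomain : IsOpen periodDomain :=
  (isOpen_lt continuous_const (Complex.continuous_im.comp continuous_fst)).inter
    (isOpen_lt continuous_const (Complex.continuous_re.comp continuous_snd))

/-- `∫_0^∞ G(u + it) (s + t)^{-a} dt`. -/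
def periodIntegral (G : ℂ → ℂ) (a : ℝ) (p : ℂ × ℂ) : ℂ :=
  ∫ t in Ioi (0 : ℝ), G (p.1 + Complex.I * t) * (p.2 + t) ^ (-(a : ℂ))

lemma norm_cpow_le {a ε t : ℝ} (ha : 0 ≤ a) (hε : 0 < ε) (ht : 0 < t) {s : ℂ} (hs : ε ≤ s.re) :
    ‖(s + t) ^ (-(a : ℂ))‖ ≤ (t + ε) ^ (-a) := by
  rw [← Complex.ofReal_neg, Complex.norm_cpow_real]
  refine Real.rpow_le_rpow_of_nonpos (by positivity) ?_ (by linarith)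
  calc t + ε ≤ (s + t).re := by simp; linarith
    _ ≤ ‖s + t‖ := Complex.re_le_norm _

lemma add_I_mul_im (u : ℂ) (t : ℝ) : (u + Complex.I * t).im = u.im + t := by simp

lemma continuousOn_periodIntegrand {G : ℂ → ℂ} (hG : HolBounded G) (a : ℝ) {p : ℂ × ℂ}
    (hp : p ∈ periodDomain) :
    ContinuousOn (fun t : ℝ => G (p.1 + Complex.I * t) * (p.2 + t) ^ (-(a : ℂ))) (Ici 0) := by
  refine ContinuousOn.mul ?_ ?_
  · refine hG.diff.continuousOn.comp (by fun_prop) fun t ht => ?_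
    have : (0 : ℝ) ≤ t := ht
    change 0 < (p.1 + Complex.I * t).im
    rw [add_I_mul_im]
    linarith [hp.1]
  · refine ContinuousOn.cpow_const (by fun_prop) fun t ht => Or.inl ?_
    have : (0 : ℝ) ≤ t := ht
    simp only [Complex.add_re, Complex.ofReal_re]
    linarith [hp.2]

lemma integrable_periodIntegrand {G : ℂ → ℂ} (hG : HolBounded G) {a : ℝ} (ha : 1 < a)
    {p : ℂ × ℂ} (hp : p ∈ periodDomain) : IntegrableOn
      (fun t : ℝ => G (p.1 + Complex.I * t) * (p.2 + t) ^ (-(a : ℂ))) (Ioi 0) := by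
  obtain ⟨M, hM0, hM⟩ := hG.bound p.1.im hp.1
  refine Integrable.mono' (g := fun t => M * (t + p.2.re) ^ (-a))
    ((integrableOn_add_rpow_Ioi_of_lt (by linarith) (by linarith [hp.2])).const_mul M)
    (((continuousOn_periodIntegrand hG a hp).mono Ioi_subset_Ici_self).aestronglyMeasurable
      measurableSet_Ioi) ?_
  filter_upwards [ae_restrict_mem measurableSet_Ioi] with t ht
  have ht0 : (0 : ℝ) < t := ht
  rw [norm_mul]
  gcongr
  · exact hM _ (by rw [add_I_mul_im]; linarith)
  · exact norm_cpow_le (by linarith) hp.2 ht0 le_rfl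

lemma hasFDerivAt_periodIntegrand {G : ℂ → ℂ} (hG : HolBounded G) (a : ℝ) {p : ℂ × ℂ}
    (hp : p ∈ periodDomain) {t : ℝ} (ht : 0 ≤ t) :
    HasFDerivAt (fun q : ℂ × ℂ => G (q.1 + Complex.I * t) * (q.2 + t) ^ (-(a : ℂ)))
      ((deriv G (p.1 + Complex.I * t) * (p.2 + t) ^ (-(a : ℂ))) • ContinuousLinearMap.fst ℂ ℂ ℂ -
        (a * (G (p.1 + Complex.I * t) * (p.2 + t) ^ (-((a + 1 : ℝ) : ℂ)))) •
          ContinuousLinearMap.snd ℂ ℂ ℂ) p := by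
  have him : 0 < (p.1 + Complex.I * t).im := by rw [add_I_mul_im]; linarith [hp.1]
  have hre : 0 < (p.2 + (t : ℂ)).re := by simp; linarith [hp.2]
  have h1 : HasFDerivAt (fun q : ℂ × ℂ => q.1 + Complex.I * t) (ContinuousLinearMap.fst ℂ ℂ ℂ) p :=
    hasFDerivAt_fst.add_const _
  have h2 : HasFDerivAt (fun q : ℂ × ℂ => q.2 + (t : ℂ)) (ContinuousLinearMap.snd ℂ ℂ ℂ) p :=
    hasFDerivAt_snd.add_const _
  have hd := (hG.diff.differentiableAt (isOpen_im_pos.mem_nhds him)).hasDerivAt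
  have hc : HasDerivAt (fun s : ℂ => s ^ (-(a : ℂ))) (-(a : ℂ) * (p.2 + t) ^ (-(a : ℂ) - 1))
      (p.2 + t) := (Complex.hasStrictDerivAt_cpow_const (Or.inl hre)).hasDerivAt
  have h := (hd.comp_hasFDerivAt p h1).mul (hc.comp_hasFDerivAt p h2)
  refine h.congr_fderiv ?_
  have he : -((a + 1 : ℝ) : ℂ) = -(a : ℂ) - 1 := by push_cast; ring
  rw [he]
  ext <;> simp <;> ring

/-- The differential of a period integral is again given by period integrals. -/
lemma hasFDerivAt_periodIntegral {G : ℂ → ℂ} (hG : HolBounded G) {a : ℝ} (ha : 1 < a) {p : ℂ × ℂ}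
    (hp : p ∈ periodDomain) :
    HasFDerivAt (periodIntegral G a)
      (periodIntegral (deriv G) a p • ContinuousLinearMap.fst ℂ ℂ ℂ -
        (a * periodIntegral G (a + 1) p) • ContinuousLinearMap.snd ℂ ℂ ℂ) p := by
  have hG' := hG.deriv
  set ε₁ := p.1.im / 2 with hε₁
  set ε₂ := p.2.re / 2 with hε₂
  have he1 : 0 < ε₁ := half_pos hp.1
  have he2 : 0 < ε₂ := half_pos hp.2
  obtain ⟨M, hM0, hM⟩ := hG.bound ε₁ he1
  obtain ⟨M', hM'0, hM'⟩ := hG'.bound ε₁ he1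
  set s : Set (ℂ × ℂ) := {q | ε₁ < q.1.im ∧ ε₂ < q.2.re} with hs
  have hso : IsOpen s :=
    (isOpen_lt continuous_const (Complex.continuous_im.comp continuous_fst)).inter
      (isOpen_lt continuous_const (Complex.continuous_re.comp continuous_snd))
  have hsp : p ∈ s := ⟨half_lt_self hp.1, half_lt_self hp.2⟩
  have hsub : s ⊆ periodDomain := fun q hq => ⟨he1.trans hq.1, he2.trans hq.2⟩
  have i1 := integrable_periodIntegrand hG' ha hp
  have i2 := integrable_periodIntegrand hG (a := a + 1) (by linarith) hp
  have key := hasFDerivAt_integral_of_dominated_of_fderiv_le (𝕜 := ℂ)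
    (μ := volume.restrict (Ioi (0 : ℝ)))
    (F := fun (q : ℂ × ℂ) (t : ℝ) => G (q.1 + Complex.I * t) * (q.2 + t) ^ (-(a : ℂ)))
    (F' := fun (q : ℂ × ℂ) (t : ℝ) =>
      (deriv G (q.1 + Complex.I * t) * (q.2 + t) ^ (-(a : ℂ))) • ContinuousLinearMap.fst ℂ ℂ ℂ -
        (a * (G (q.1 + Complex.I * t) * (q.2 + t) ^ (-((a + 1 : ℝ) : ℂ)))) •
          ContinuousLinearMap.snd ℂ ℂ ℂ)
    (x₀ := p) (s := s)
    (bound := fun t => M' * (t + ε₂) ^ (-a) + a * (M * (t + ε₂) ^ (-(a + 1))))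
    (hso.mem_nhds hsp) ?_ (integrable_periodIntegrand hG ha hp) ?_ ?_ ?_ ?_
  · have e : (∫ t in Ioi (0 : ℝ), ((deriv G (p.1 + Complex.I * t) * (p.2 + t) ^ (-(a : ℂ))) •
        ContinuousLinearMap.fst ℂ ℂ ℂ -
        (a * (G (p.1 + Complex.I * t) * (p.2 + t) ^ (-((a + 1 : ℝ) : ℂ)))) •
          ContinuousLinearMap.snd ℂ ℂ ℂ)) =
        periodIntegral (deriv G) a p • ContinuousLinearMap.fst ℂ ℂ ℂ -
        (a * periodIntegral G (a + 1) p) • ContinuousLinearMap.snd ℂ ℂ ℂ := by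
      rw [integral_sub (i1.smul_const _) ((i2.const_mul _).smul_const _), integral_smul_const,
        integral_smul_const, integral_const_mul]
      rfl
    rw [e] at key
    exact key
  · filter_upwards [hso.mem_nhds hsp] with q hq
    exact ((continuousOn_periodIntegrand hG a (hsub hq)).mono
      Ioi_subset_Ici_self).aestronglyMeasurable measurableSet_Ioi
  · exact ((i1.smul_const _).sub ((i2.const_mul _).smul_const _)).aestronglyMeasurable
  · filter_upwards [ae_restrict_mem measurableSet_Ioi] with t ht q hq
    have ht0 : (0 : ℝ) < t := ht
    have hi : ε₁ ≤ (q.1 + Complex.I * t).im := by rw [add_I_mul_im]; linarith [hq.1]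
    have n1 : ‖(deriv G (q.1 + Complex.I * t) * (q.2 + t) ^ (-(a : ℂ))) •
        ContinuousLinearMap.fst ℂ ℂ ℂ‖ ≤ M' * (t + ε₂) ^ (-a) := by
      rw [norm_smul, norm_mul]
      refine (mul_le_of_le_one_right (by positivity) (ContinuousLinearMap.norm_fst_le ..)).trans ?_
      gcongr
      · exact hM' _ hi
      · exact norm_cpow_le (by linarith) he2 ht0 hq.2.le
    have n2 : ‖(a * (G (q.1 + Complex.I * t) * (q.2 + t) ^ (-((a + 1 : ℝ) : ℂ)))) •
        ContinuousLinearMap.snd ℂ ℂ ℂ‖ ≤ a * (M * (t + ε₂) ^ (-(a + 1))) := by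
      rw [norm_smul, norm_mul, norm_mul, Complex.norm_real, Real.norm_of_nonneg (by linarith)]
      refine (mul_le_of_le_one_right (by positivity) (ContinuousLinearMap.norm_snd_le ..)).trans ?_
      gcongr
      · exact hM _ hi
      · exact norm_cpow_le (by linarith) he2 ht0 hq.2.le
    exact (norm_sub_le _ _).trans (add_le_add n1 n2)
  · exact ((integrableOn_add_rpow_Ioi_of_lt (by linarith) (by linarith)).const_mul M').add
      (((integrableOn_add_rpow_Ioi_of_lt (by linarith) (by linarith)).const_mul M).const_mul a)
  · filter_upwards [ae_restrict_mem measurableSet_Ioi] with t ht q hq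
    exact hasFDerivAt_periodIntegrand hG a (hsub hq) (le_of_lt ht)

lemma contDiffOn_periodIntegral_nat (n : ℕ) : ∀ {G : ℂ → ℂ} (_ : HolBounded G) {a : ℝ} (_ : 1 < a),
    ContDiffOn ℂ n (periodIntegral G a) periodDomain := by
  induction n with
  | zero =>
    intro G hG a ha
    rw [Nat.cast_zero, contDiffOn_zero]
    exact fun p hp => (hasFDerivAt_periodIntegral hG ha hp).continuousAt.continuousWithinAt
  | succ n ih =>
    intro G hG a ha
    rw [Nat.cast_succ, contDiffOn_succ_iff_fderiv_of_isOpen isOpen_periodDomain]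
    refine ⟨fun p hp => (hasFDerivAt_periodIntegral hG ha hp).differentiableAt.differentiableWithinAt,
      fun h => absurd h (by simp), ?_⟩
    refine ContDiffOn.congr ?_ fun p hp => (hasFDerivAt_periodIntegral hG ha hp).fderiv
    exact ((ih hG.deriv ha).smul contDiffOn_const).sub
      ((contDiffOn_const.mul (ih hG (by linarith))).smul contDiffOn_const)

/-- Differentiation stays within the class of period integrals, whence smoothness by induction. -/
theorem contDiffOn_periodIntegral {G : ℂ → ℂ} (hG : HolBounded G) {a : ℝ} (ha : 1 < a) :
    ContDiffOn ℂ ∞ (periodIntegral G a) periodDomain :=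
  contDiffOn_infty.2 fun n => contDiffOn_periodIntegral_nat n hG ha

/-- The combination `i ∂/∂u + ∂/∂s` of the derivatives of the period integral is the integral of a
`t`-derivative, so that only the boundary term at `t = 0` remains. -/
lemma periodIntegral_boundary {G : ℂ → ℂ} (hG : HolBounded G) {a : ℝ} (ha : 1 < a) {p : ℂ × ℂ}
    (hp : p ∈ periodDomain) : Complex.I * periodIntegral (deriv G) a p -
      a * periodIntegral G (a + 1) p = -(G p.1 * p.2 ^ (-(a : ℂ))) := by
  have i1 := integrable_periodIntegrand hG.deriv ha hp
  have i2 := integrable_periodIntegrand hG (a := a + 1) (by linarith) hp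
  have hder : ∀ t ∈ Ioi (0 : ℝ), HasDerivAt
      (fun t : ℝ => G (p.1 + Complex.I * t) * (p.2 + t) ^ (-(a : ℂ)))
      (Complex.I * (deriv G (p.1 + Complex.I * t) * (p.2 + t) ^ (-(a : ℂ))) -
        a * (G (p.1 + Complex.I * t) * (p.2 + t) ^ (-((a + 1 : ℝ) : ℂ)))) t := by
    intro t ht
    have ht0 : (0 : ℝ) < t := ht
    have him : 0 < (p.1 + Complex.I * t).im := by rw [add_I_mul_im]; linarith [hp.1]
    have hre : 0 < (p.2 + (t : ℂ)).re := by simp; linarith [hp.2]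
    have hd := (hG.diff.differentiableAt (isOpen_im_pos.mem_nhds him)).hasDerivAt
    have hc : HasDerivAt (fun s : ℂ => s ^ (-(a : ℂ))) (-(a : ℂ) * (p.2 + t) ^ (-(a : ℂ) - 1))
        (p.2 + t) := (Complex.hasStrictDerivAt_cpow_const (Or.inl hre)).hasDerivAt
    have l0 : HasDerivAt (fun t : ℝ => (t : ℂ)) 1 t := Complex.ofRealCLM.hasDerivAt
    have l1 : HasDerivAt (fun t : ℝ => p.1 + Complex.I * (t : ℂ)) (Complex.I * 1) t :=
      (l0.const_mul Complex.I).const_add _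
    have l2 : HasDerivAt (fun t : ℝ => p.2 + (t : ℂ)) 1 t := l0.const_add _
    have h := (hd.comp t l1).mul (hc.comp t l2)
    have he : -((a + 1 : ℝ) : ℂ) = -(a : ℂ) - 1 := by push_cast; ring
    rw [he]
    refine h.congr_deriv ?_
    simp only [Function.comp_apply]
    ring
  have hlim : Tendsto (fun t : ℝ => G (p.1 + Complex.I * t) * (p.2 + t) ^ (-(a : ℂ))) atTop
      (𝓝 0) := by
    obtain ⟨M, hM0, hM⟩ := hG.bound p.1.im hp.1
    have hz : Tendsto (fun t : ℝ => M * (t + p.2.re) ^ (-a)) atTop (𝓝 0) := by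
      have := ((tendsto_rpow_neg_atTop (y := a) (by linarith)).comp
        (tendsto_atTop_add_const_right atTop p.2.re tendsto_id)).const_mul M
      simpa using this
    refine squeeze_zero_norm' ?_ hz
    filter_upwards [eventually_gt_atTop 0] with t ht0
    rw [norm_mul]
    gcongr
    · exact hM _ (by rw [add_I_mul_im]; linarith)
    · exact norm_cpow_le (by linarith) hp.2 ht0 le_rfl
  have h := integral_Ioi_of_hasDerivAt_of_tendsto
    ((continuousOn_periodIntegrand hG a hp) 0 self_mem_Ici) hder
    ((i1.const_mul _).sub (i2.const_mul _)) hlim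
  rw [integral_sub (i1.const_mul _) (i2.const_mul _), integral_const_mul, integral_const_mul] at h
  simpa [periodIntegral] using h

end
end RankMoment

namespace RankMoment
noncomputable section

/-! ### Smoothness and the Laplace equation -/

open Filter Topology MeasureTheory Set

lemma differentiableOn_R2 : DifferentiableOn ℂ R2 (Metric.ball 0 1) := by
  intro q hq
  rw [mem_ball_zero_iff] at hq
  obtain ⟨r, hqr, hr1⟩ := exists_between hq
  have hr0 : 0 ≤ r := (norm_nonneg _).trans hqr.le
  have hs := (hasSum_R2 (q := (r : ℂ)) (by
    rwa [Complex.norm_real, Real.norm_of_nonneg hr0])).summable.norm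
  have hd : DifferentiableOn ℂ R2 (Metric.ball 0 r) := by
    refine Complex.differentiableOn_tsum_of_summable_norm hs (fun n => by fun_prop) Metric.isOpen_ball
      fun n w hw => ?_
    rw [mem_ball_zero_iff] at hw
    rw [norm_mul, norm_mul, norm_pow, norm_pow, Complex.norm_real, Real.norm_of_nonneg hr0]
    gcongr
  exact (hd.differentiableAt (Metric.isOpen_ball.mem_nhds
    (mem_ball_zero_iff.2 hqr))).differentiableWithinAt

lemma differentiableAt_eta {τ : ℂ} (hτ : 0 < τ.im) : DifferentiableAt ℂ ModularForm.eta τ :=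
  ModularForm.differentiableAt_eta_of_mem_upperHalfPlaneSet hτ

lemma differentiableOn_E2 : DifferentiableOn ℂ E2 {z : ℂ | 0 < z.im} := by
  have hη : DifferentiableOn ℂ ModularForm.eta {z : ℂ | 0 < z.im} :=
    fun z hz => (differentiableAt_eta hz).differentiableWithinAt
  have h := ((hη.deriv isOpen_im_pos).div hη fun z hz => ModularForm.eta_ne_zero hz).const_mul
    (12 / (Real.pi * Complex.I))
  refine h.congr fun z hz => ?_
  have hl := ModularForm.logDeriv_eta_eq_E2 ⟨z, hz⟩
  rw [← E2_coe, logDeriv_apply] at hl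
  change deriv ModularForm.eta z / ModularForm.eta z = Real.pi * Complex.I / 12 * E2 z at hl
  have hpi : (Real.pi : ℂ) ≠ 0 := by exact_mod_cast Real.pi_ne_zero
  simp only [Pi.div_apply]
  rw [hl]
  have := Complex.I_ne_zero
  field_simp

/-- `η(24 τ)`, the integrand of the period integral. -/
def etaScaled (τ : ℂ) : ℂ := ModularForm.eta (24 * τ)

lemma holBounded_etaScaled : HolBounded etaScaled where
  diff z hz := by
    have him : 0 < (24 * z).im := by
      have : 0 < z.im := hz
      simpa using this
    exact ((differentiableAt_eta him).comp z (by fun_prop)).differentiableWithinAt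
  bound ε hε := by
    have hpi := Real.pi_pos
    have hs : Summable fun k : ℤ => Real.exp (-(2 * Real.pi * ε) * (6 * k - 1) ^ 2) := by
      have hinj : Function.Injective fun k : ℤ => 6 * k - 1 := fun a b h => by
        simp only at h; omega
      have := (summable_int_gaussian (δ := 2 * Real.pi * ε) (by positivity)).comp_injective hinj
      refine this.congr fun k => ?_
      simp
    refine ⟨∑' k : ℤ, Real.exp (-(2 * Real.pi * ε) * (6 * k - 1) ^ 2),
      tsum_nonneg fun k => (Real.exp_pos _).le, fun z hz => ?_⟩
    have him : 0 < (24 * z).im := by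
      have : 0 < z.im := hε.trans_le hz
      simpa using this
    rw [etaScaled, ← (hasSum_eta him).tsum_eq]
    refine tsum_of_norm_bounded hs.hasSum fun k => ?_
    have h1 : ‖((Int.negOnePow k : ℤ) : ℂ)‖ = 1 := by
      rcases Int.even_or_odd k with h | h
      · rw [Int.negOnePow_even _ h]; simp
      · rw [Int.negOnePow_odd _ h]; simp
    rw [norm_mul, h1, one_mul, Complex.norm_exp, Real.exp_le_exp]
    have e : (Real.pi * Complex.I / 12 * (24 * z) * (6 * k - 1) ^ 2).re =
        -(2 * Real.pi * z.im) * (6 * (k : ℝ) - 1) ^ 2 := by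
      have : (Real.pi * Complex.I / 12 * (24 * z) * (6 * k - 1) ^ 2) =
        ((2 * Real.pi * (6 * (k : ℝ) - 1) ^ 2 : ℝ) : ℂ) * (Complex.I * z) := by push_cast; ring
      rw [this, Complex.re_ofReal_mul, Complex.I_mul_re]
      ring
    rw [e]
    have : 2 * Real.pi * ε ≤ 2 * Real.pi * z.im := by gcongr
    nlinarith [mul_le_mul_of_nonneg_right this (sq_nonneg (6 * (k : ℝ) - 1))]

/-- The real-linear map `w ↦ (-w̄, 2 Im w)`. The nonholomorphic part of the completed generating
function is a function holomorphic in two variables composed with it. -/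
def conjPair : ℂ →L[ℝ] ℂ × ℂ :=
  (-(Complex.conjCLE : ℂ →L[ℝ] ℂ)).prod ((2 : ℝ) • Complex.ofRealCLM.comp Complex.imCLM)

lemma conjPair_apply (w : ℂ) : conjPair w = (-(starRingEnd ℂ w), ((2 * w.im : ℝ) : ℂ)) := by
  simp [conjPair]

lemma conjPair_mem {w : ℂ} (hw : 0 < w.im) : conjPair w ∈ periodDomain := by
  rw [conjPair_apply]
  constructor
  · simpa using hw
  · simp only [Complex.ofReal_re]; positivity

/-- The constant `1/(4√2π)`. -/
def periodConst : ℂ := 1 / (4 * (Real.sqrt 2 : ℂ) * (Real.pi : ℂ))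

lemma calN_eq (z : UpperHalfPlane) :
    calN z = periodConst * periodIntegral etaScaled (3 / 2) (conjPair z) := by
  rw [calN, verticalIntegral, periodIntegral, periodConst, conjPair_apply, integral_mul_const]
  have e : ∀ t : ℝ, ModularForm.eta (24 * (-(starRingEnd ℂ (z : ℂ)) + Complex.I * t)) /
      (-Complex.I * (-(starRingEnd ℂ (z : ℂ)) + Complex.I * t + (z : ℂ))) ^ ((3 : ℂ) / 2) =
      etaScaled (-(starRingEnd ℂ (z : ℂ)) + Complex.I * t) *
        (((2 * (z : ℂ).im : ℝ) : ℂ) + t) ^ (-((3 / 2 : ℝ) : ℂ)) := by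
    intro t
    have hz : (z : ℂ) - starRingEnd ℂ (z : ℂ) = 2 * Complex.I * ((z : ℂ).im : ℂ) := by
      apply Complex.ext <;> simp
      ring
    have hb : -Complex.I * (-(starRingEnd ℂ (z : ℂ)) + Complex.I * t + (z : ℂ)) =
        ((2 * (z : ℂ).im : ℝ) : ℂ) + t := by
      push_cast
      linear_combination (-Complex.I) * hz - (2 * (z : ℂ).im + t) * Complex.I_sq
    rw [hb, Complex.cpow_neg, div_eq_mul_inv, etaScaled]
    norm_num
  simp only [e]
  linear_combination (-1 / (4 * (Real.sqrt 2 : ℂ) * (Real.pi : ℂ)) *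
    ∫ t in Ioi (0 : ℝ), etaScaled (-(starRingEnd ℂ (z : ℂ)) + Complex.I * t) *
        (((2 * (z : ℂ).im : ℝ) : ℂ) + t) ^ (-((3 / 2 : ℝ) : ℂ))) * Complex.I_sq

/-- The holomorphic part of the completed generating function. -/
def holPart (w : ℂ) : ℂ :=
  R2 (Complex.exp (2 * Real.pi * Complex.I * (24 * w))) * Complex.exp (-(2 * Real.pi * Complex.I * w)) -
    1 / (24 * ModularForm.eta (24 * w)) + E2 (24 * w) / (8 * ModularForm.eta (24 * w))

lemma differentiableOn_holPart : DifferentiableOn ℂ holPart {z : ℂ | 0 < z.im} := by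
  have hmaps : MapsTo (fun w : ℂ => 24 * w) {z : ℂ | 0 < z.im} {z : ℂ | 0 < z.im} := by
    intro w hw
    have : 0 < w.im := hw
    change 0 < (24 * w).im
    simpa using this
  have hη : DifferentiableOn ℂ (fun w => ModularForm.eta (24 * w)) {z : ℂ | 0 < z.im} :=
    holBounded_etaScaled.diff
  have hη0 : ∀ w ∈ {z : ℂ | 0 < z.im}, ModularForm.eta (24 * w) ≠ 0 := fun w hw =>
    ModularForm.eta_ne_zero (hmaps hw)
  have hR : DifferentiableOn ℂ (fun w => R2 (Complex.exp (2 * Real.pi * Complex.I * (24 * w))))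
      {z : ℂ | 0 < z.im} :=
    differentiableOn_R2.comp (by fun_prop) fun w hw => by
      rw [mem_ball_zero_iff]
      exact norm_exp_lt_one (hmaps hw)
  have hE : DifferentiableOn ℂ (fun w => E2 (24 * w)) {z : ℂ | 0 < z.im} :=
    differentiableOn_E2.comp (by fun_prop) hmaps
  exact ((hR.mul (by fun_prop)).sub ((differentiableOn_const 1).div (hη.const_mul 24)
    fun w hw => mul_ne_zero (by norm_num) (hη0 w hw))).add
    (hE.div (hη.const_mul 8) fun w hw => mul_ne_zero (by norm_num) (hη0 w hw))

lemma calM_ofComplex {w : ℂ} (hw : 0 < w.im) : calM (UpperHalfPlane.ofComplex w) =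
    holPart w - periodConst * periodIntegral etaScaled (3 / 2) (conjPair w) := by
  rw [UpperHalfPlane.ofComplex_apply_of_im_pos hw, calM, calR, calN_eq, holPart]
  simp only
  ring

theorem contDiffOn_calM :
    ContDiffOn ℝ ∞ (fun w : ℂ => calM (UpperHalfPlane.ofComplex w)) {z : ℂ | 0 < z.im} := by
  have h1 : ContDiffOn ℝ ∞ holPart {z : ℂ | 0 < z.im} :=
    (differentiableOn_holPart.contDiffOn isOpen_im_pos).restrict_scalars ℝ
  have h2 : ContDiffOn ℝ ∞ (fun w : ℂ => periodIntegral etaScaled (3 / 2) (conjPair w))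
      {z : ℂ | 0 < z.im} :=
    ((contDiffOn_periodIntegral holBounded_etaScaled (by norm_num)).restrict_scalars ℝ).comp
      conjPair.contDiff.contDiffOn fun w hw => conjPair_mem hw
  exact (h1.sub (contDiffOn_const.mul h2)).congr fun w hw => calM_ofComplex hw

/-- A real differential of the form `α du - β ds` pulled back along `w ↦ (-w̄, 2 Im w)`. -/
lemma partial_comp_conjPair {f : ℂ × ℂ → ℂ} {α β w : ℂ}
    (hf : HasFDerivAt f (α • ContinuousLinearMap.fst ℂ ℂ ℂ - β • ContinuousLinearMap.snd ℂ ℂ ℂ)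
      (conjPair w)) :
    DifferentiableAt ℝ (fun w => f (conjPair w)) w ∧
    partialX (fun w => f (conjPair w)) w = -α ∧
      partialY (fun w => f (conjPair w)) w = Complex.I * α - 2 * β := by
  have h := (hf.restrictScalars ℝ).comp w conjPair.hasFDerivAt
  have h' : HasFDerivAt (fun w => f (conjPair w)) _ w := h
  refine ⟨h'.differentiableAt, ?_, ?_⟩
  · rw [partialX, h'.fderiv]
    simp [conjPair_apply]
  · rw [partialY, h'.fderiv]
    simp [conjPair_apply]
    ring

lemma partial_of_holomorphic {h : ℂ → ℂ} {w : ℂ} (hh : DifferentiableAt ℂ h w) :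
    partialX h w + Complex.I * partialY h w = 0 := by
  have hd := hh.hasDerivAt.hasFDerivAt.restrictScalars ℝ
  rw [partialX, partialY, hd.fderiv]
  simp
  linear_combination deriv h w * Complex.I_sq

/-- The function `η(-24 w̄) (2 Im w)^{-3/2}`, a multiple of the antiholomorphic derivative of the
completed generating function. -/
def shadowTerm (w : ℂ) : ℂ :=
  etaScaled (conjPair w).1 * (conjPair w).2 ^ (-((3 / 2 : ℝ) : ℂ))

/-- The antiholomorphic derivative of the completed generating function. -/
lemma dbar_calM {w : ℂ} (hw : 0 < w.im) :
    partialX (fun w : ℂ => calM (UpperHalfPlane.ofComplex w)) w +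
      Complex.I * partialY (fun w : ℂ => calM (UpperHalfPlane.ofComplex w)) w =
    2 * Complex.I * periodConst * shadowTerm w := by
  have hev : (fun w : ℂ => calM (UpperHalfPlane.ofComplex w)) =ᶠ[𝓝 w]
      fun w => holPart w - periodConst * periodIntegral etaScaled (3 / 2) (conjPair w) := by
    filter_upwards [isOpen_im_pos.mem_nhds hw] with v hv using calM_ofComplex hv
  have hh : DifferentiableAt ℂ holPart w :=
    differentiableOn_holPart.differentiableAt (isOpen_im_pos.mem_nhds hw)
  obtain ⟨hd, hx, hy⟩ := partial_comp_conjPair (hasFDerivAt_periodIntegral holBounded_etaScaled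
    (a := 3 / 2) (by norm_num) (conjPair_mem hw))
  have hb := periodIntegral_boundary holBounded_etaScaled (a := 3 / 2) (by norm_num)
    (conjPair_mem hw)
  have h0 := partial_of_holomorphic hh
  have hsub : ∀ v : ℂ, fderiv ℝ (fun w : ℂ => calM (UpperHalfPlane.ofComplex w)) w v =
      fderiv ℝ holPart w v - periodConst *
        fderiv ℝ (fun w => periodIntegral etaScaled (3 / 2) (conjPair w)) w v := by
    intro v
    rw [hev.fderiv_eq, fderiv_fun_sub (hh.restrictScalars ℝ) (hd.const_mul _),
      fderiv_const_mul hd]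
    simp
  rw [partialX] at hx h0 ⊢
  rw [partialY] at hy h0 ⊢
  rw [hsub, hsub, hx, hy, shadowTerm]
  linear_combination h0 - 2 * Complex.I * periodConst * hb +
    periodConst * periodIntegral (deriv etaScaled) (3 / 2) (conjPair w) * Complex.I_sq

/-- The Laplacian as a composition of the two Wirtinger operators. -/
lemma partial_sq_eq {F : ℂ → ℂ} {z : ℂ} (hF : ContDiffAt ℝ 2 F z) :
    partialX (partialX F) z + partialY (partialY F) z =
      partialX (fun w => partialX F w + Complex.I * partialY F w) z -
        Complex.I * partialY (fun w => partialX F w + Complex.I * partialY F w) z := by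
  have hd : DifferentiableAt ℝ (fderiv ℝ F) z :=
    (hF.fderiv_right (m := 1) (by norm_num)).differentiableAt (by norm_num)
  have hsymm := hF.isSymmSndFDerivAt (by simp)
  have hv : ∀ v : ℂ, HasFDerivAt (fun w => fderiv ℝ F w v)
      ((ContinuousLinearMap.apply ℝ ℂ v).comp (fderiv ℝ (fderiv ℝ F) z)) z := fun v =>
    (ContinuousLinearMap.apply ℝ ℂ v).hasFDerivAt.comp z hd.hasFDerivAt
  have hX : HasFDerivAt (partialX F) _ z := hv 1
  have hY : HasFDerivAt (partialY F) _ z := hv Complex.I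
  have hD := hX.add (hY.const_mul Complex.I)
  have hD' : HasFDerivAt (fun w => partialX F w + Complex.I * partialY F w) _ z := hD
  have h1 := hsymm 1 Complex.I
  rw [partialX, partialY, partialX, partialY, hX.fderiv, hY.fderiv, hD'.fderiv]
  simp
  linear_combination (-Complex.I) * h1 +
    (fderiv ℝ (fderiv ℝ F) z Complex.I Complex.I) * Complex.I_sq

/-- The Laplace equation in weight `3/2` says that `(Im w)^{3/2} ∂F/∂w̄` is antiholomorphic; by
`dbar_calM` this function is a multiple of `η(-24 w̄)`. -/
theorem hypLaplacian_calM (z : UpperHalfPlane) :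
    hypLaplacian (3 / 2) (fun w : ℂ => calM (UpperHalfPlane.ofComplex w)) (z : ℂ) = 0 := by
  have hz : 0 < (z : ℂ).im := z.im_pos
  have hC : ContDiffAt ℝ 2 (fun w : ℂ => calM (UpperHalfPlane.ofComplex w)) z :=
    by
    have := (contDiffOn_infty.1 contDiffOn_calM 2).contDiffAt (isOpen_im_pos.mem_nhds hz)
    exact_mod_cast this
  have hev : (fun w : ℂ => partialX (fun w : ℂ => calM (UpperHalfPlane.ofComplex w)) w +
      Complex.I * partialY (fun w : ℂ => calM (UpperHalfPlane.ofComplex w)) w) =ᶠ[𝓝 (z : ℂ)]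
      fun w => 2 * Complex.I * periodConst * shadowTerm w := by
    filter_upwards [isOpen_im_pos.mem_nhds hz] with v hv using dbar_calM hv
  have hb := hasFDerivAt_periodIntegrand holBounded_etaScaled (3 / 2) (conjPair_mem hz) le_rfl
  simp only [Complex.ofReal_zero, mul_zero, add_zero] at hb
  obtain ⟨hd, hx, hy⟩ := partial_comp_conjPair hb
  change DifferentiableAt ℝ shadowTerm z at hd
  change partialX shadowTerm z = _ at hx
  change partialY shadowTerm z = _ at hy
  have hp : ∀ v : ℂ, fderiv ℝ (fun w => 2 * Complex.I * periodConst * shadowTerm w) z v =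
      2 * Complex.I * periodConst * fderiv ℝ shadowTerm z v := by
    intro v
    rw [fderiv_const_mul hd]
    simp
  have hs : (conjPair z).2 = 2 * ((z : ℂ).im : ℂ) := by rw [conjPair_apply]; push_cast; rfl
  have hs0 : (conjPair z).2 ≠ 0 := by
    rw [hs]; exact mul_ne_zero two_ne_zero (by exact_mod_cast hz.ne')
  have hpow : (conjPair z).2 ^ (-((3 / 2 : ℝ) : ℂ)) =
      2 * ((z : ℂ).im : ℂ) * (conjPair z).2 ^ (-((3 / 2 + 1 : ℝ) : ℂ)) := by
    rw [← hs, show (-((3 / 2 : ℝ) : ℂ)) = 1 + (-((3 / 2 + 1 : ℝ) : ℂ)) by push_cast; ring,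
      Complex.cpow_add _ _ hs0, Complex.cpow_one]
  rw [hypLaplacian, partial_sq_eq hC, dbar_calM hz, partialX, partialY, hev.fderiv_eq, hp, hp]
  rw [partialX] at hx
  rw [partialY] at hy
  rw [hx, hy, shadowTerm, hpow]
  push_cast
  ring_nf
  simp only [Complex.I_pow_three]
  ring

end
end RankMoment

theorem theorem1p1 :
    RankMoment.IsHarmonicWeakMaassForm (twoK := 3) RankMoment.chi12
      (CongruenceSubgroup.Gamma0 576) RankMoment.calM := by
  have h3 : (((3 : ℤ) : ℂ) / 2) = 3 / 2 := by norm_num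
  refine ⟨by decide, fun A hA => ?_, RankMoment.contDiffOn_calM, fun A hA z => ?_, fun z => ?_,
    fun B _ => ?_⟩
  · rw [CongruenceSubgroup.Gamma0_mem] at hA ⊢
    rw [ZMod.intCast_zmod_eq_zero_iff_dvd] at hA ⊢
    exact dvd_trans (by norm_num) hA
  · rw [h3]
    exact RankMoment.calM_transform A hA z
  · rw [h3]
    exact RankMoment.hypLaplacian_calM z
  · rw [h3]
    exact RankMoment.calM_growth B
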